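/- **Theorem (Poincaré Lemma for Integral Forms).** Let $\mathbb K=\mathbb R$ or $\mathbb C$ and let $M=(|M|,\mathcal O_M)$ be a real (smooth) or complex (analytic) supermanifold of dimension $p|q$, i.e. a topological space with a sheaf of supercommutative $\mathbb K$-superalgebras that is locally isomorphic to $\mathbb K^{p|q}$: open sets $U\subseteq\mathbb K^p$ with the sheaf $C^\infty_U\otimes\Lambda[\theta_1,\dots,\theta_q]$ (holomorphic functions in place of $C^\infty_U$ if $\mathbb K=\mathbb C$). For $i\in\mathbb Z$ let $\Sigma^{i}_M=\mathcal Ber(M)\otimes_{\mathcal O_M}S^{p-i}\Pi\mathcal T_M$ be the sheaf of integral forms of degree $i$ (zero for $i>p$). In local coordinates $x_a=z_1,\dots,z_p\,|\,\theta_1,\dots,\theta_q$ its sections are finite sums of terms $\varphi(x) f\otimes\pi\partial^I$, where $\varphi(x)$ is the generator of the Berezinian sheaf defined by the coordinates, $f$ is a function, and $\pi\partial^I$ is a monomial of degree $p-i$ in the odd $\pi\partial_{z_j}$ and the even $\pi\partial_{\theta_\alpha}$. Under a change of coordinates $x\to x'$ one has $\varphi(x)=\varphi(x')\,\mathrm{Ber}\big(\partial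 x_b/\partial x'_a\big)_{ab}$ and $\pi\partial_{x_a}=\sum_b\frac{\partial x'_b}{\partial x_a}\,\pi\partial_{x'_b}$. Let $$\delta\big(\varphi(x) f\otimes\pi\partial^I\big)=-\sum_a(-1)^{|x_a||f|+|\pi\partial^I|}\,\varphi(x)\,(\partial_a f)\otimes\langle dx_a,\pi\partial^I\rangle ,$$ where $\langle dx_a,\cdot\rangle$ is the superderivation of parity $|x_a|+1$ with $\langle dx_a,\pi\partial_b\rangle=(-1)^{(|x_a|+1)(|x_b|+1)}\delta_{ab}$. Then $\delta$ is a well-defined (coordinate-independent) morphism $\Sigma^i_M\to\Sigma^{i+1}_M$ with $\delta^2=0$, and the cohomology sheaves of the complex $(\Sigma_M^{p-\bullet},\delta)$ (whose degree $i$ term is $\Sigma^i_M$) are $$H^i_\delta(\Sigma^{p-\bullet}_M)\cong\begin{cases}\mathbb K_M & i=0,\\ 0 & i\neq 0,\end{cases}$$ where $\mathbb K_M$ is the constant sheaf. More precisely, there is a closed global section $s_0$ of $\Sigma^0_M$ that in every local coordinate system equals $$s_0=\varphi(x)\,\theta_1\cdots\theta_q\otimes\pi\partial_{z_1}\cdots\pi\partial_{z_p},$$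 and the isomorphism $\mathbb K_M\cong H^0_\delta(\Sigma_M^{p-\bullet})$ is given by $a\mapsto a\,[s_0]$; in particular $H^0_\delta$ is generated by the class of $s_0$. -/

import Mathlib

open CategoryTheory TopologicalSpace Opposite
open scoped ContDiff TensorProduct

universe u

namespace SuperGeometry

noncomputable section

/-! ## The local model `𝕜^{p|q}`

`𝕜` is `ℝ` (smooth supermanifolds) or `ℂ` (complex analytic supermanifolds; on an open set of `ℂ^p`
complex differentiable, `C^∞` over `ℂ` and holomorphic mean the same).  Coordinates of `𝕜^{p|q}`
are indexed by `Fin p ⊕ Fin q`: `inl i` is the even coordinate `z_i`, `inr α` the odd one `θ_α`. -/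

section Model

variable {𝕜 : Type u} [RCLike 𝕜] {p : ℕ}

/-- Extension by zero of a function on an open set of `𝕜^p`. -/
def extendZero {U : Opens (Fin p → 𝕜)} (f : U → 𝕜) : (Fin p → 𝕜) → 𝕜 :=
  Function.extend Subtype.val f 0

lemma extendZero_apply {U : Opens (Fin p → 𝕜)} (f : U → 𝕜) (x : U) : extendZero f x = f x :=
  Subtype.val_injective.extend_apply f 0 x

lemma smooth_of_eq {U : Opens (Fin p → 𝕜)} {f : U → 𝕜} {g : (Fin p → 𝕜) → 𝕜}
    (hg : ContDiffOn 𝕜 ∞ g U) (h : ∀ x : U, f x = g x) : ContDiffOn 𝕜 ∞ (extendZero f) U :=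
  hg.congr fun x hx => (extendZero_apply f ⟨x, hx⟩).trans (h ⟨x, hx⟩)

/-- The algebra of smooth (`𝕜 = ℝ`), resp. holomorphic (`𝕜 = ℂ`), functions on the open set `U`. -/
def smoothFun (U : Opens (Fin p → 𝕜)) : Subalgebra 𝕜 (U → 𝕜) where
  carrier := {f | ContDiffOn 𝕜 ∞ (extendZero f) U}
  mul_mem' {f g} hf hg := smooth_of_eq (ContDiffOn.mul hf hg) fun x => by
    simp only [Pi.mul_apply, extendZero_apply]
  add_mem' {f g} hf hg := smooth_of_eq (ContDiffOn.add hf hg) fun x => by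
    simp only [Pi.add_apply, extendZero_apply]
  algebraMap_mem' r := smooth_of_eq (g := fun _ => r) contDiffOn_const fun _ => rfl

/-- Restriction of smooth functions. -/
def smoothRes {U V : Opens (Fin p → 𝕜)} (h : V ≤ U) : smoothFun U →ₐ[𝕜] smoothFun V where
  toFun f := ⟨fun x => f.1 ⟨x.1, h x.2⟩,
    smooth_of_eq (ContDiffOn.mono f.2 h) fun x => (extendZero_apply f.1 ⟨x.1, h x.2⟩).symm⟩
  map_one' := rfl
  map_mul' _ _ := rfl
  map_zero' := rfl
  map_add' _ _ := rfl
  commutes' _ := rfl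

lemma differentiableAt_extendZero {U : Opens (Fin p → 𝕜)} (f : smoothFun U) (x : U) :
    DifferentiableAt 𝕜 (extendZero f.1) x :=
  (f.2.differentiableOn (by simp)).differentiableAt (U.isOpen.mem_nhds x.2)

/-- The partial derivative `∂/∂z_i` of smooth functions. -/
def smoothPd (U : Opens (Fin p → 𝕜)) (i : Fin p) : smoothFun U →ₗ[𝕜] smoothFun U where
  toFun f := ⟨fun x => fderiv 𝕜 (extendZero f.1) x (Pi.single i 1), by
    refine smooth_of_eq (g := fun x => fderiv 𝕜 (extendZero f.1) x (Pi.single i 1)) ?_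
      fun _ => rfl
    exact (ContDiffOn.fderiv_of_isOpen (m := ∞) f.2 U.isOpen (by simp)).clm_apply
      contDiffOn_const⟩
  map_add' f g := by
    ext x
    have e : extendZero (f + g).1 =ᶠ[nhds x.1] extendZero f.1 + extendZero g.1 := by
      filter_upwards [U.isOpen.mem_nhds x.2] with y hy
      have := fun k : U → 𝕜 => extendZero_apply k ⟨y, hy⟩
      simp only at this
      simp [this]
    simp only [e.fderiv_eq]
    rw [fderiv_add (differentiableAt_extendZero f x) (differentiableAt_extendZero g x)]
    rfl
  map_smul' r f := by
    ext x
    have e : extendZero (r • f).1 =ᶠ[nhds x.1] r • extendZero f.1 := by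
      filter_upwards [U.isOpen.mem_nhds x.2] with y hy
      have := fun k : U → 𝕜 => extendZero_apply k ⟨y, hy⟩
      simp only at this
      simp [this]
    simp only [e.fderiv_eq]
    rw [fderiv_const_smul (differentiableAt_extendZero f x)]
    rfl

lemma smoothRes_smoothPd {U V : Opens (Fin p → 𝕜)} (h : V ≤ U) (i : Fin p) (f : smoothFun U) :
    smoothRes h (smoothPd U i f) = smoothPd V i (smoothRes h f) := by
  ext x
  have e : extendZero (smoothRes h f).1 =ᶠ[nhds x.1] extendZero f.1 := by
    filter_upwards [V.isOpen.mem_nhds x.2] with y hy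
    have h1 := extendZero_apply (smoothRes h f).1 ⟨y, hy⟩
    have h2 := extendZero_apply f.1 ⟨y, h hy⟩
    simp only at h1 h2
    rw [h1, h2]
    rfl
  change fderiv 𝕜 (extendZero f.1) x.1 _ = fderiv 𝕜 (extendZero (smoothRes h f).1) x.1 _
  rw [e.fderiv_eq]

/-- Superfunctions on the superdomain `U^{p|q}`: the superalgebra `C^∞(U) ⊗ Λ[θ_1, …, θ_q]`. -/
abbrev Model (q : ℕ) (U : Opens (Fin p → 𝕜)) : Type u :=
  smoothFun U ⊗[𝕜] ExteriorAlgebra 𝕜 (Fin q → 𝕜)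

variable {q : ℕ}

/-- Restriction of superfunctions. -/
def Model.res {U V : Opens (Fin p → 𝕜)} (h : V ≤ U) : Model q U →ₐ[𝕜] Model q V :=
  Algebra.TensorProduct.map (smoothRes h) (AlgHom.id 𝕜 _)

/-- The parity involution `f ↦ (-1)^{|f|} f`. -/
def Model.parity (q : ℕ) (U : Opens (Fin p → 𝕜)) : Model q U →ₐ[𝕜] Model q U :=
  Algebra.TensorProduct.map (AlgHom.id 𝕜 _) CliffordAlgebra.involute

/-- The coordinates `z_1, …, z_p | θ_1, …, θ_q`. -/
def Model.coord (U : Opens (Fin p → 𝕜)) : Fin p ⊕ Fin q → Model q U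
  | .inl i => (⟨fun x => x.1 i, smooth_of_eq (g := fun x => x i) (by fun_prop) fun _ => rfl⟩ :
      smoothFun U) ⊗ₜ 1
  | .inr α => 1 ⊗ₜ ExteriorAlgebra.ι 𝕜 (Pi.single α 1)

/-- The coordinate vector fields `∂/∂z_i` and `∂/∂θ_α` (left derivatives). -/
def Model.pd (U : Opens (Fin p → 𝕜)) : Fin p ⊕ Fin q → (Model q U →ₗ[𝕜] Model q U)
  | .inl i => LinearMap.rTensor _ (smoothPd U i)
  | .inr α => LinearMap.lTensor _ (CliffordAlgebra.contractLeft (LinearMap.proj α))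

lemma Model.res_pd {U V : Opens (Fin p → 𝕜)} (h : V ≤ U) (a : Fin p ⊕ Fin q) (f : Model q U) :
    Model.res h (Model.pd U a f) = Model.pd V a (Model.res h f) := by
  induction f using TensorProduct.induction_on with
  | zero => simp
  | add f g hf hg => simp only [map_add, hf, hg]
  | tmul f w =>
    cases a with
    | inl i => simp [Model.res, Model.pd, smoothRes_smoothPd]
    | inr α => simp [Model.res, Model.pd]

end Model

/-! ## Polynomial calculus of polyfields in coordinates

`S` is an algebra of superfunctions with parity involution `ε`.  A monomial `n = (I, m)` stands for
the polyfield `∏_{i ∈ I} π∂_{z_i} · ∏_α (π∂_{θ_α})^{m α}`, the product over `I` taken in increasing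
order; the `π∂_z` are odd, the `π∂_θ` even.  An element of `PolyField S` is a sum `∑_n f_n n` with
the functions on the left. -/

section PolyField

variable {p q : ℕ}

/-- Exponents of monomials in the odd `π∂_{z_i}` and the even `π∂_{θ_α}`. -/
abbrev Mon (p q : ℕ) : Type := Finset (Fin p) × (Fin q →₀ ℕ)

/-- The polynomial degree of a monomial. -/
def Mon.deg (n : Mon p q) : ℕ := n.1.card + n.2.sum fun _ k => k

/-- The parity sign `(-1)^{|π∂^I|}` of a monomial. -/
def Mon.sign (n : Mon p q) : ℤ := (-1) ^ n.1.card

/-- The monomial as the list of its factors, in order. -/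
def Mon.word (n : Mon p q) : List (Fin p ⊕ Fin q) :=
  (n.1.sort (· ≤ ·)).map Sum.inl ++
    (List.finRange q).flatMap fun α => List.replicate (n.2 α) (Sum.inr α)

/-- `π∂_a · n = mulCoeff a n · mulMon a n`. -/
def mulCoeff : Fin p ⊕ Fin q → Mon p q → ℤ
  | .inl i, n => if i ∈ n.1 then 0 else (-1) ^ (n.1.filter (· < i)).card
  | .inr _, _ => 1

/-- The monomial part of `π∂_a · n`. -/
def mulMon : Fin p ⊕ Fin q → Mon p q → Mon p q
  | .inl i, n => (insert i n.1, n.2)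
  | .inr α, n => (n.1, n.2 + Finsupp.single α 1)

/-- The contraction `⟨dx_a, n⟩ = contrCoeff a n · contrMon a n`: the superderivation (odd for
`a = z_i`, even for `a = θ_α`) with `⟨dx_a, π∂_b⟩ = (-1)^{(|x_a| + 1)(|x_b| + 1)} δ_{ab}`. -/
def contrCoeff : Fin p ⊕ Fin q → Mon p q → ℤ
  | .inl i, n => if i ∈ n.1 then -(-1) ^ (n.1.filter (· < i)).card else 0
  | .inr α, n => n.2 α

/-- The monomial part of the contraction `⟨dx_a, n⟩`. -/
def contrMon : Fin p ⊕ Fin q → Mon p q → Mon p q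
  | .inl i, n => (n.1.erase i, n.2)
  | .inr α, n => (n.1, n.2 - Finsupp.single α 1)

variable {𝕜 : Type u} [RCLike 𝕜] {S : Type u} [Ring S] [Algebra 𝕜 S]

/-- Left multiplication by `π∂_a`; as `π∂_a` has parity `|x_a| + 1`, moving it past the
coefficient `f` costs the sign `(-1)^{|f|(|x_a| + 1)}`. -/
def leftMul (ε : S →ₗ[𝕜] S) (a : Fin p ⊕ Fin q) : (Mon p q →₀ S) →ₗ[𝕜] (Mon p q →₀ S) :=
  Finsupp.lsum 𝕜 fun n => mulCoeff a n •
    (Finsupp.lsingle (mulMon a n) ∘ₗ Sum.elim (fun _ => ε) (fun _ => LinearMap.id) a)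

/-- The image of the monomial `n` under the substitution `π∂_a ↦ ∑_b J_{ab} π∂_b`: the product
of the images of its factors, in order. -/
def substMon (ε : S →ₗ[𝕜] S) (J : Matrix (Fin p ⊕ Fin q) (Fin p ⊕ Fin q) S) (n : Mon p q) :
    Mon p q →₀ S :=
  n.word.foldr (fun a s => ∑ b, J a b • leftMul ε b s) (Finsupp.single (∅, 0) 1)

/-- The substitution `π∂_a ↦ ∑_b J_{ab} π∂_b` in polyfields. -/
def subst (ε : S →ₗ[𝕜] S) (J : Matrix (Fin p ⊕ Fin q) (Fin p ⊕ Fin q) S) :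
    (Mon p q →₀ S) →ₗ[𝕜] (Mon p q →₀ S) :=
  Finsupp.lsum 𝕜 fun n => (LinearMap.toSpanSingleton S _ (substMon ε J n)).restrictScalars 𝕜

/-- The coordinate expression of the differential of integral forms,
`f · n ↦ - ∑_a (-1)^{|x_a||f| + |n|} (∂_a f) · ⟨dx_a, n⟩`, for coordinate derivations `∂`. -/
def coordDelta (ε : S →ₗ[𝕜] S) (pd : Fin p ⊕ Fin q → (S →ₗ[𝕜] S)) :
    (Mon p q →₀ S) →ₗ[𝕜] (Mon p q →₀ S) :=
  Finsupp.lsum 𝕜 fun n => ∑ a, (-(n.sign * contrCoeff a n)) •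
    (Finsupp.lsingle (contrMon a n) ∘ₗ pd a ∘ₗ
      Sum.elim (fun _ => LinearMap.id) (fun _ => ε) a)

/-- The determinant by the Leibniz formula, for matrices with (commuting) even entries in a
possibly noncommutative ring. -/
def leibnizDet {n : ℕ} (A : Matrix (Fin n) (Fin n) S) : S :=
  ∑ σ : Equiv.Perm (Fin n), (Equiv.Perm.sign σ : ℤ) • (List.ofFn fun i => A (σ i) i).prod

/-- The Berezinian `Ber (A B; C D) = det (A - B D⁻¹ C) · det (D⁻¹)` of an even supermatrix. -/
def berezinian (J : Matrix (Fin p ⊕ Fin q) (Fin p ⊕ Fin q) S) : S :=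
  leibnizDet (J.toBlocks₁₁ - J.toBlocks₁₂ * Ring.inverse J.toBlocks₂₂ * J.toBlocks₂₁) *
    leibnizDet (Ring.inverse J.toBlocks₂₂)

end PolyField

/-! ## Supermanifolds -/

/-- A superspace over `𝕜`: a topological space with a sheaf of supercommutative `𝕜`-superalgebras.
The `ℤ/2`-grading is given by the parity involution `f ↦ (-1)^{|f|} f`; its eigenspaces for `1` and
`-1` are the even and the odd sections. -/
structure SuperSpace (𝕜 : Type u) [RCLike 𝕜] where
  /-- The underlying topological space. -/
  carrier : TopCat.{u}
  /-- The structure sheaf. -/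
  sheaf : TopCat.Sheaf (AlgCat.{u} 𝕜) carrier
  /-- The parity involution. -/
  parity : sheaf.presheaf ⟶ sheaf.presheaf
  parity_parity : parity ≫ parity = 𝟙 _
  even_comm : ∀ (W : Opens carrier) (f g : sheaf.presheaf.obj (op W)),
    (parity.app (op W)).hom f = f → f * g = g * f
  odd_anticomm : ∀ (W : Opens carrier) (f g : sheaf.presheaf.obj (op W)),
    (parity.app (op W)).hom f = -f → (parity.app (op W)).hom g = -g → f * g = -(g * f)

namespace SuperSpace

variable {𝕜 : Type u} [RCLike 𝕜] (X : SuperSpace.{u} 𝕜)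

/-- Sections of the structure sheaf over an open set. -/
abbrev Sec (W : Opens X.carrier) : Type u := X.sheaf.presheaf.obj (op W)

/-- Restriction of sections. -/
def res {V W : Opens X.carrier} (h : V ≤ W) : X.Sec W →ₐ[𝕜] X.Sec V :=
  (X.sheaf.presheaf.map (homOfLE h).op).hom

/-- The parity involution on sections. -/
def par (W : Opens X.carrier) : X.Sec W →ₐ[𝕜] X.Sec W := (X.parity.app (op W)).hom

lemma res_par {V W : Opens X.carrier} (h : V ≤ W) (f : X.Sec W) :
    X.res h (X.par W f) = X.par V (X.res h f) :=
  (congrArg (fun g => g.hom f) (X.parity.naturality (homOfLE h).op)).symm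

lemma res_rfl {W : Opens X.carrier} (f : X.Sec W) : X.res le_rfl f = f :=
  congrArg (fun g => g.hom f) (X.sheaf.presheaf.map_id (op W))

lemma res_res {U V W : Opens X.carrier} (h : V ≤ W) (k : U ≤ V) (f : X.Sec W) :
    X.res k (X.res h f) = X.res (k.trans h) f :=
  (congrArg (fun g => g.hom f)
    (X.sheaf.presheaf.map_comp (homOfLE h).op (homOfLE k).op)).symm

/-- The open set of `𝕜^p` that corresponds to `W`, for `W` contained in the domain of `e`. -/
def image {p : ℕ} (e : OpenPartialHomeomorph X.carrier (Fin p → 𝕜)) (W : Opens X.carrier) :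
    Opens (Fin p → 𝕜) :=
  ⟨e.target ∩ e.symm ⁻¹' W, e.isOpen_inter_preimage_symm W.isOpen⟩

lemma image_mono {p : ℕ} (e : OpenPartialHomeomorph X.carrier (Fin p → 𝕜))
    {V W : Opens X.carrier} (h : V ≤ W) : X.image e V ≤ X.image e W :=
  fun _ hx => ⟨hx.1, h hx.2⟩

/-- A chart of dimension `p|q`, i.e. a local coordinate system: an isomorphism of superspaces from
an open subspace onto an open subspace of `𝕜^{p|q}`. -/
structure Chart (p q : ℕ) where
  /-- The underlying homeomorphism between open sets. -/
  e : OpenPartialHomeomorph X.carrier (Fin p → 𝕜)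
  /-- The isomorphism of sheaves of algebras. -/
  iso : ∀ W : Opens X.carrier, (W : Set X.carrier) ⊆ e.source →
    (X.Sec W ≃ₐ[𝕜] Model q (X.image e W))
  iso_res : ∀ (V W : Opens X.carrier) (hV : (V : Set X.carrier) ⊆ e.source)
    (hW : (W : Set X.carrier) ⊆ e.source) (h : V ≤ W) (f : X.Sec W),
    iso V hV (X.res h f) = Model.res (X.image_mono e h) (iso W hW f)
  iso_par : ∀ (W : Opens X.carrier) (hW : (W : Set X.carrier) ⊆ e.source) (f : X.Sec W),
    iso W hW (X.par W f) = Model.parity q (X.image e W) (iso W hW f)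

namespace Chart

variable {X} {p q : ℕ} (c : X.Chart p q)

/-- The domain of a chart. -/
def dom : Opens X.carrier := ⟨c.e.source, c.e.open_source⟩

variable {W : Opens X.carrier} (hW : W ≤ c.dom)

/-- The local coordinates `x_a` on an open subset of the domain. -/
def coord (a : Fin p ⊕ Fin q) : X.Sec W := (c.iso W hW).symm (Model.coord _ a)

/-- The coordinate vector fields `∂/∂x_a` on an open subset of the domain. -/
def pd (a : Fin p ⊕ Fin q) : X.Sec W →ₗ[𝕜] X.Sec W :=
  (c.iso W hW).symm.toLinearMap ∘ₗ Model.pd _ a ∘ₗ (c.iso W hW).toLinearMap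

lemma res_pd {V : Opens X.carrier} (h : V ≤ W) (a : Fin p ⊕ Fin q) (f : X.Sec W) :
    X.res h (c.pd hW a f) = c.pd (h.trans hW) a (X.res h f) := by
  apply (c.iso V (h.trans hW)).injective
  rw [c.iso_res V W (h.trans hW) hW h]
  simp [pd, Model.res_pd, c.iso_res V W (h.trans hW) hW h]

end Chart

/-- The Jacobian `J_{ab} = ∂x'_b/∂x_a` of the coordinates `x'` of `c'` with respect to the
coordinates `x` of `c`, on an open set on which both are defined. -/
def jacobian {p q : ℕ} (c c' : X.Chart p q) {W : Opens X.carrier} (h : W ≤ c.dom)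
    (h' : W ≤ c'.dom) : Matrix (Fin p ⊕ Fin q) (Fin p ⊕ Fin q) (X.Sec W) :=
  Matrix.of fun a b => c.pd h a (c'.coord h' b)

end SuperSpace

/-- A real (`𝕜 = ℝ`) or complex (`𝕜 = ℂ`) supermanifold of dimension `p|q`: a superspace that is
locally isomorphic to `𝕜^{p|q}`.  No separation or countability axiom is needed here. -/
structure Supermanifold (𝕜 : Type u) [RCLike 𝕜] (p q : ℕ) extends SuperSpace.{u} 𝕜 where
  exists_chart : ∀ x : carrier, ∃ c : toSuperSpace.Chart p q, x ∈ c.dom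

/-! ## Integral forms -/

namespace Supermanifold

variable {𝕜 : Type u} [RCLike 𝕜] {p q : ℕ} (M : Supermanifold.{u} 𝕜 p q)

/-- All charts of `M`. -/
abbrev Chart : Type u := M.toSuperSpace.Chart p q

/-- Coordinate expressions over `W`: `∑_n f_n n` stands for the local integral form
`∑_n φ(x) f_n ⊗ n`, where `φ(x) = [dz_1 … dz_p ⊗ ∂_{θ_1} … ∂_{θ_q}]` is the generator of the
Berezinian sheaf given by the coordinates. -/
abbrev Expr (W : Opens M.carrier) : Type u := Mon p q →₀ M.Sec W

/-- Restriction of coordinate expressions. -/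
def exprRes {V W : Opens M.carrier} (h : V ≤ W) : M.Expr W →ₗ[𝕜] M.Expr V :=
  Finsupp.mapRange.linearMap (M.res h).toLinearMap

/-- The change of coordinates of integral forms from `c` to `c'`, induced by
`φ(x) = φ(x') · Ber (∂x/∂x')` and `π∂_{x_a} = ∑_b (∂x'_b/∂x_a) π∂_{x'_b}`. -/
def transition (c c' : M.Chart) {W : Opens M.carrier} (h : W ≤ c.dom) (h' : W ≤ c'.dom) :
    M.Expr W →ₗ[𝕜] M.Expr W where
  toFun s := berezinian (M.jacobian c' c h' h) •
    subst (M.par W).toLinearMap (M.jacobian c c' h h') s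
  map_add' s t := by rw [map_add, smul_add]
  map_smul' r s := by rw [map_smul, RingHom.id_apply, smul_comm]

/-- Families of coordinate expressions over `W`, one in each chart. -/
def Family (W : Opens M.carrier) : Type u := ∀ c : M.Chart, M.Expr (W ⊓ c.dom)

instance (W : Opens M.carrier) : AddCommGroup (M.Family W) :=
  inferInstanceAs (AddCommGroup (∀ c : M.Chart, M.Expr (W ⊓ c.dom)))

instance (W : Opens M.carrier) : Module 𝕜 (M.Family W) :=
  inferInstanceAs (Module 𝕜 (∀ c : M.Chart, M.Expr (W ⊓ c.dom)))

/-- Restriction of families. -/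
def famRes {V W : Opens M.carrier} (h : V ≤ W) : M.Family W →ₗ[𝕜] M.Family V where
  toFun s c := M.exprRes (inf_le_inf_right c.dom h) (s c)
  map_add' s t := funext fun c => map_add (M.exprRes _) (s c) (t c)
  map_smul' r s := funext fun c => map_smul (M.exprRes _) r (s c)

/-- `Σ^i(W)`: the integral forms of degree `i` over `W`, i.e. the sections over `W` of
`Ber(M) ⊗ S^{p-i} ΠT_M`.  Such a section is a family of coordinate expressions, homogeneous of
polynomial degree `p - i`, that are related by the coordinate changes wherever two charts overlap.
In particular `Σ^i = 0` for `i > p`. -/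
def integralForms (i : ℤ) (W : Opens M.carrier) : Submodule 𝕜 (M.Family W) where
  carrier := {s | (∀ c, ∀ n ∈ (s c).support, (p : ℤ) - n.deg = i) ∧
    ∀ (c c' : M.Chart) (V : Opens M.carrier) (hV : V ≤ W) (h : V ≤ c.dom) (h' : V ≤ c'.dom),
      M.exprRes (le_inf hV h') (s c') =
        M.transition c c' h h' (M.exprRes (le_inf hV h) (s c))}
  zero_mem' := by
    refine ⟨fun c n hn => ?_, fun c c' V hV h h' => ?_⟩
    · exact absurd rfl (Finsupp.mem_support_iff.1 hn)
    · exact (map_zero (M.exprRes _)).trans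
        ((congrArg _ (map_zero (M.exprRes _))).trans (map_zero (M.transition c c' h h'))).symm
  add_mem' {s t} hs ht := by
    classical
    refine ⟨fun c n hn => ?_, fun c c' V hV h h' => ?_⟩
    · rcases Finset.mem_union.1 (Finsupp.support_add (g₁ := s c) (g₂ := t c) hn) with hn | hn
      exacts [hs.1 c n hn, ht.1 c n hn]
    · change M.exprRes _ (s c' + t c') = M.transition c c' h h' (M.exprRes _ (s c + t c))
      simp only [map_add, hs.2 c c' V hV h h', ht.2 c c' V hV h h']
  smul_mem' r s hs := by
    refine ⟨fun c n hn => hs.1 c n (Finsupp.support_smul (b := r) (g := s c) hn),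
      fun c c' V hV h h' => ?_⟩
    change M.exprRes _ (r • s c') = M.transition c c' h h' (M.exprRes _ (r • s c))
    simp only [map_smul, hs.2 c c' V hV h h']

/-- The differential `δ`, given in each coordinate system by
`δ(φ(x) f ⊗ n) = - ∑_a (-1)^{|x_a||f| + |n|} φ(x) (∂_a f) ⊗ ⟨dx_a, n⟩`. -/
def delta (W : Opens M.carrier) : M.Family W →ₗ[𝕜] M.Family W :=
  { toFun := fun s c => coordDelta (M.par _).toLinearMap (c.pd inf_le_right) (s c)
    map_add' := fun s t => funext fun c => map_add (coordDelta _ _) (s c) (t c)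
    map_smul' := fun r s => funext fun c => map_smul (coordDelta _ _) r (s c) }

/-- The closed integral forms of degree `i` over `W`. -/
def cocycles (i : ℤ) (W : Opens M.carrier) : Submodule 𝕜 (M.Family W) :=
  M.integralForms i W ⊓ LinearMap.ker (M.delta W)

/-- The exact integral forms of degree `i` over `W`. -/
def coboundaries (i : ℤ) (W : Opens M.carrier) : Submodule 𝕜 (M.Family W) :=
  (M.integralForms (i - 1) W).map (M.delta W)

/-- `H^i_δ(Σ(W))`: closed forms modulo exact forms over `W`. -/
abbrev Cohomology (i : ℤ) (W : Opens M.carrier) : Type u :=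
  M.cocycles i W ⧸ (M.coboundaries i W).submoduleOf (M.cocycles i W)

lemma famRes_delta {V W : Opens M.carrier} (h : V ≤ W) (s : M.Family W) :
    M.famRes h (M.delta W s) = M.delta V (M.famRes h s) := by
  funext c
  change M.exprRes (inf_le_inf_right c.dom h) (coordDelta _ _ (s c)) =
    coordDelta _ _ (M.exprRes (inf_le_inf_right c.dom h) (s c))
  induction s c using Finsupp.induction_linear with
  | zero => simp only [map_zero]
  | add f g hf hg => simp only [map_add, hf, hg]
  | single n f =>
    have hres : ∀ (n : Mon p q) (f : M.Sec (W ⊓ c.dom)),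
        M.exprRes (inf_le_inf_right c.dom h) (Finsupp.single n f) =
          Finsupp.single n (M.res (inf_le_inf_right c.dom h) f) := fun n f => by
      simp [exprRes]
    rw [hres]
    simp only [coordDelta, Finsupp.lsum_single, LinearMap.sum_apply, LinearMap.smul_apply,
      LinearMap.comp_apply, map_sum, map_zsmul, Finsupp.lsingle_apply, hres]
    refine Finset.sum_congr rfl fun a _ => ?_
    rw [SuperSpace.Chart.res_pd]
    cases a with
    | inl i => rfl
    | inr α =>
      simp only [Sum.elim_inr, AlgHom.toLinearMap_apply, SuperSpace.res_par]

lemma exprRes_exprRes {U V W : Opens M.carrier} (h : V ≤ W) (k : U ≤ V) (s : M.Expr W) :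
    M.exprRes k (M.exprRes h s) = M.exprRes (k.trans h) s := by
  ext n
  exact M.res_res h k (s n)

lemma famRes_mem {V W : Opens M.carrier} (h : V ≤ W) {i : ℤ} {s : M.Family W}
    (hs : s ∈ M.integralForms i W) : M.famRes h s ∈ M.integralForms i V := by
  refine ⟨fun c n hn => hs.1 c n ?_, fun c c' U hU k k' => ?_⟩
  · rw [Finsupp.mem_support_iff] at hn ⊢
    intro h0
    apply hn
    change M.res _ (s c n) = 0
    rw [h0, map_zero]
  · change M.exprRes _ (M.exprRes _ (s c')) = M.transition c c' k k' (M.exprRes _ (M.exprRes _ (s c)))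
    rw [exprRes_exprRes, exprRes_exprRes]
    exact hs.2 c c' U (hU.trans h) k k'

lemma famRes_mem_cocycles {V W : Opens M.carrier} (h : V ≤ W) {i : ℤ} {s : M.Family W}
    (hs : s ∈ M.cocycles i W) : M.famRes h s ∈ M.cocycles i V := by
  refine ⟨M.famRes_mem h hs.1, ?_⟩
  change M.delta V (M.famRes h s) = 0
  rw [← famRes_delta, LinearMap.mem_ker.1 hs.2, map_zero]

/-- Restriction of closed forms. -/
def cocycleRes (i : ℤ) {V W : Opens M.carrier} (h : V ≤ W) :
    M.cocycles i W →ₗ[𝕜] M.cocycles i V :=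
  (M.famRes h).restrict fun _ hs => M.famRes_mem_cocycles h hs

/-- Restriction of cohomology classes. -/
def cohomologyRes (i : ℤ) {V W : Opens M.carrier} (h : V ≤ W) :
    M.Cohomology i W →ₗ[𝕜] M.Cohomology i V :=
  Submodule.mapQ _ _ (M.cocycleRes i h) (by
    rintro ⟨s, hs⟩ ⟨t, ht, hts⟩
    exact ⟨M.famRes h t, M.famRes_mem h ht, by
      rw [← famRes_delta, hts]
      rfl⟩)

/-- The presheaf `W ↦ H^i_δ(Σ(W))`. -/
def cohomologyPresheaf (i : ℤ) : (Opens M.carrier)ᵒᵖ ⥤ ModuleCat.{u} 𝕜 where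
  obj W := ModuleCat.of 𝕜 (M.Cohomology i W.unop)
  map f := ModuleCat.ofHom (M.cohomologyRes i f.unop.le)
  map_id W := by
    ext s
    change Submodule.Quotient.mk _ = Submodule.Quotient.mk _
    congr 1
    apply Subtype.ext
    funext c
    ext n
    exact M.res_rfl _
  map_comp f g := by
    ext s
    change Submodule.Quotient.mk _ = Submodule.Quotient.mk _
    congr 1
    apply Subtype.ext
    funext c
    ext n
    exact (M.res_res _ _ _).symm

/-- The cohomology sheaf `H^i_δ(Σ)` of the complex of sheaves of integral forms: the sheaf
associated with `W ↦ H^i_δ(Σ(W))`. -/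
def cohomologySheaf (i : ℤ) : TopCat.Sheaf (ModuleCat.{u} 𝕜) M.carrier :=
  (presheafToSheaf (Opens.grothendieckTopology M.carrier) (ModuleCat.{u} 𝕜)).obj
    (M.cohomologyPresheaf i)

/-- The section of the cohomology sheaf over `W` defined by a closed form over `W`. -/
def cohomologyClass {i : ℤ} {W : Opens M.carrier} (s : M.cocycles i W) :
    (M.cohomologySheaf i).presheaf.obj (op W) :=
  ((toSheafify (Opens.grothendieckTopology M.carrier) (M.cohomologyPresheaf i)).app (op W)).hom
    (Submodule.Quotient.mk s : M.Cohomology i W)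

/-- The constant sheaf `𝕜_M`. -/
def constSheaf : TopCat.Sheaf (ModuleCat.{u} 𝕜) M.carrier :=
  (constantSheaf (Opens.grothendieckTopology M.carrier) (ModuleCat.{u} 𝕜)).obj
    (ModuleCat.of 𝕜 𝕜)

/-- The section over `W` of the constant sheaf with value `a`. -/
def constSection (W : Opens M.carrier) (a : 𝕜) : M.constSheaf.presheaf.obj (op W) :=
  ((toSheafify (Opens.grothendieckTopology M.carrier)
    ((Functor.const (Opens M.carrier)ᵒᵖ).obj (ModuleCat.of 𝕜 𝕜))).app (op W)).hom
    (a : 𝕜)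

/-- The coordinate expression of `φ(x) θ_1 … θ_q ⊗ π∂_{z_1} … π∂_{z_p}`. -/
def generator (c : M.Chart) {W : Opens M.carrier} (hW : W ≤ c.dom) : M.Expr W :=
  Finsupp.single (Finset.univ, 0) (List.ofFn fun α : Fin q => c.coord hW (Sum.inr α)).prod

end Supermanifold

end

end SuperGeometry

/-! In coordinates `δ` is `-∑ ⟨dx_a, ·⟩ ∘ ∂_a ∘ parity` (`coordDelta_eq`), and left multiplications
by `π∂_b`, contractions and derivatives satisfy canonical (anti)commutation relations. Contraction
by `dx_a` and `∂_a` have opposite parities, so the double sum expressing `δ²` is antisymmetric in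
its two indices and vanishes.

Coordinate independence. Polyfields are generated from functions by the `π∂_b`, and the commutator
of `δ` with `π∂_b` is `-∂_b` up to parity, a Cartan formula. Hence a transition map commutes with
`δ` once it carries `∂_b` to the Lie derivative along the same field written in the new coordinates
(`subst_pd`). Besides the chain rule and the commutation of coordinate fields, this needs one fact:
the logarithmic derivative of the Berezinian factor along `∂_b` is minus the divergence of `∂_b` in
the new coordinates (`piola`). It follows from `∂ Ber J = str(J⁻¹ ∂J) Ber J` and the symmetry of
second derivatives. Berezinians are handled by factoring an invertible even supermatrix into
unitriangular and block diagonal ones (`exists_udl`), by determinants over the commutative ring of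
even elements, and by `det(1 + XY) det(1 + YX) = 1` for odd `X`, `Y`. The chain rule holds because
the difference of its two sides is a superderivation that kills the coordinates, hence zero by
Hadamard's lemma.

The generator is global because `θ_1 ⋯ θ_q` annihilates every odd function: only the diagonal blocks
of the Jacobian act on it, and they cancel against the Berezinian (`generator_transition`).

Poincaré lemma. On a coordinate ball there is one homotopy per coordinate. For `z_i`, integrate in
`z_i` and multiply by `π∂_{z_i}`; what remains contains `π∂_{z_i}` and has coefficients independent
of `z_i`. For `θ_α`, multiply by `θ_α π∂_{θ_α}` with weights `1/(m+1)`; what remains contains no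
`π∂_{θ_α}` and has coefficients divisible by `θ_α`. After all coordinates only constant multiples of
`s₀` survive (`exists_eq_delta_add`). Nonzero multiples are not exact even locally: the coefficient
of the top monomial in `δt` is a sum of odd derivatives, killed by the full odd derivative, which
sends `θ_1 ⋯ θ_q` to `1` (`eq_zero_of_delta_eq`).

Thus the map `a ↦ a[s₀]` from the constant presheaf to the cohomology presheaf is locally bijective
in degree `0`, all classes of other degrees vanish locally, and sheafification gives the theorem. -/

namespace SuperGeometry

noncomputable section

/-! ## Supercommutative algebras -/

section SuperComm

variable {𝕜 : Type u} [RCLike 𝕜] {S : Type u} [Ring S] [Algebra 𝕜 S]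

/-- `ε` is the parity involution of a supercommutative algebra. -/
structure IsSuperComm (ε : S →ₐ[𝕜] S) : Prop where
  invol : ∀ f, ε (ε f) = f
  even_comm : ∀ f g, ε f = f → f * g = g * f
  odd_anticomm : ∀ f g, ε f = -f → ε g = -g → f * g = -(g * f)

/-- `f` is homogeneous of parity `k` modulo `2`. -/
def IsHom (ε : S →ₐ[𝕜] S) (k : ℕ) (f : S) : Prop := ε f = (-1 : ℤ) ^ k • f

namespace IsSuperComm

variable {ε : S →ₐ[𝕜] S} (h : IsSuperComm ε)
include h

lemma sq : ε ^ 2 = 1 := by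
  ext f
  simp [pow_two, h.invol]

lemma pow_even {k : ℕ} (hk : Even k) : ε ^ k = 1 := by
  obtain ⟨m, rfl⟩ := hk
  rw [← two_mul, pow_mul, h.sq, one_pow]

lemma pow_odd {k : ℕ} (hk : ¬ Even k) : ε ^ k = ε := by
  obtain ⟨m, rfl⟩ := Nat.not_even_iff_odd.1 hk
  rw [pow_succ, pow_mul, h.sq, one_pow, one_mul]

lemma pow_congr {k l : ℕ} (hkl : Even k ↔ Even l) : ε ^ k = ε ^ l := by
  by_cases hk : Even k
  · rw [h.pow_even hk, h.pow_even (hkl.1 hk)]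
  · rw [h.pow_odd hk, h.pow_odd (fun hl => hk (hkl.2 hl))]

/-- The projections `(f ± ε f)/2` onto the eigenspaces of the involution; `2` is invertible in `𝕜`.
-/
lemma even_add_odd (f : S) : ∃ g k, ε g = g ∧ ε k = -k ∧ f = g + k := by
  refine ⟨(2⁻¹ : 𝕜) • (f + ε f), (2⁻¹ : 𝕜) • (f - ε f), ?_, ?_, ?_⟩
  · rw [map_smul, map_add, h.invol, add_comm]
  · rw [map_smul, map_sub, h.invol, ← smul_neg, neg_sub]
  · rw [← smul_add, add_add_sub_cancel, ← two_smul 𝕜 f, smul_smul,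
      inv_mul_cancel₀ two_ne_zero, one_smul]

/-- Recording the sign rule as a power of `ε` on the second factor makes it available for
inhomogeneous `g`. -/
lemma hom_mul_comm {k : ℕ} {f : S} (hf : IsHom ε k f) (g : S) : f * g = (ε ^ k) g * f := by
  unfold IsHom at hf
  by_cases hk : Even k
  · rw [h.pow_even hk]
    exact h.even_comm _ _ (by simpa [hk.neg_one_pow] using hf)
  · rw [h.pow_odd hk]
    rw [(Nat.not_even_iff_odd.1 hk).neg_one_pow] at hf
    have hf' : ε f = -f := by simpa using hf
    obtain ⟨a, b, ha, hb, rfl⟩ := h.even_add_odd g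
    rw [mul_add, map_add, add_mul, ha, hb, h.odd_anticomm f b hf' hb, ← h.even_comm a f ha,
      neg_mul]

lemma hom_mul_hom_comm {k l : ℕ} {f g : S} (hf : IsHom ε k f) (hg : IsHom ε l g) :
    f * g = (-1 : ℤ) ^ (k * l) • (g * f) := by
  rw [h.hom_mul_comm hf]
  have : ∀ k : ℕ, (ε ^ k) g = (-1 : ℤ) ^ (k * l) • g := by
    intro k
    induction k with
    | zero => simp
    | succ k ih =>
      unfold IsHom at hg
      rw [pow_succ', AlgHom.mul_apply, ih, map_zsmul, hg, smul_smul, ← pow_add]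
      congr 2
      ring
  rw [this, smul_mul_assoc]

omit h in
lemma hom_pow {k l : ℕ} {g : S} (hg : IsHom ε l g) : (ε ^ k) g = (-1 : ℤ) ^ (k * l) • g := by
  induction k with
  | zero => simp
  | succ k ih =>
    unfold IsHom at hg
    rw [pow_succ', AlgHom.mul_apply, ih, map_zsmul, hg, smul_smul, ← pow_add]
    congr 2
    ring

end IsSuperComm

lemma IsHom.mul {ε : S →ₐ[𝕜] S} {k l : ℕ} {f g : S} (hf : IsHom ε k f) (hg : IsHom ε l g) :
    IsHom ε (k + l) (f * g) := by
  unfold IsHom at *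
  rw [map_mul, hf, hg, smul_mul_smul_comm, ← pow_add]

lemma IsHom.sum {ε : S →ₐ[𝕜] S} {k : ℕ} {α : Type*} {s : Finset α} {f : α → S}
    (hf : ∀ a ∈ s, IsHom ε k (f a)) : IsHom ε k (∑ a ∈ s, f a) := by
  unfold IsHom at *
  rw [map_sum, Finset.smul_sum]
  exact Finset.sum_congr rfl hf

lemma IsHom.congr {ε : S →ₐ[𝕜] S} {k l : ℕ} {f : S} (hf : IsHom ε k f)
    (hkl : Even k ↔ Even l) : IsHom ε l f := by
  unfold IsHom at *
  rw [hf, neg_one_pow_congr hkl]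

end SuperComm

/-! ## Operators on polyfields -/

section Operators

variable {p q : ℕ}

/-- The parity of a coordinate. -/
def pe : Fin p ⊕ Fin q → ℕ := Sum.elim (fun _ => 0) (fun _ => 1)

@[simp] lemma pe_inl (i : Fin p) : pe (Sum.inl i : Fin p ⊕ Fin q) = 0 := rfl
@[simp] lemma pe_inr (i : Fin q) : pe (Sum.inr i : Fin p ⊕ Fin q) = 1 := rfl

/-- The exponent in the sign of an odd multiplication or contraction counts smaller indices; this
governs how it changes when another odd factor joins. -/
lemma card_filter_insert {I : Finset (Fin p)} {j : Fin p} (hj : j ∉ I) (i : Fin p) :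
    ((insert j I).filter (· < i)).card = (I.filter (· < i)).card + if j < i then 1 else 0 := by
  rw [Finset.filter_insert]
  split_ifs with hji
  · rw [Finset.card_insert_of_notMem (by simp [hj])]
  · rfl

lemma mulCoeff_of_mem {i : Fin p} {n : Mon p q} (hi : i ∈ n.1) : mulCoeff (.inl i) n = 0 :=
  if_pos hi

lemma mulCoeff_of_notMem {i : Fin p} {n : Mon p q} (hi : i ∉ n.1) :
    mulCoeff (.inl i) n = (-1) ^ (n.1.filter (· < i)).card :=
  if_neg hi

lemma contrCoeff_of_mem {i : Fin p} {n : Mon p q} (hi : i ∈ n.1) :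
    contrCoeff (.inl i) n = -(-1) ^ (n.1.filter (· < i)).card :=
  if_pos hi

lemma contrCoeff_of_notMem {i : Fin p} {n : Mon p q} (hi : i ∉ n.1) :
    contrCoeff (.inl i) n = 0 :=
  if_neg hi

lemma mulMon_comm (a b : Fin p ⊕ Fin q) (n : Mon p q) :
    mulMon a (mulMon b n) = mulMon b (mulMon a n) := by
  cases a <;> cases b <;> simp [mulMon, Finset.insert_comm, add_right_comm]

/-- `π∂_a` has parity `pe a + 1`. For two distinct even coordinates the sign comes from the single
one of `i < j`, `j < i` that holds. -/
lemma mulCoeff_comm (a b : Fin p ⊕ Fin q) (n : Mon p q) :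
    mulCoeff b n * mulCoeff a (mulMon b n) =
      (-1) ^ ((pe a + 1) * (pe b + 1)) * (mulCoeff a n * mulCoeff b (mulMon a n)) := by
  obtain ⟨I, m⟩ := n
  rcases a with i | α <;> rcases b with j | β
  · by_cases hi : i ∈ I
    · rw [mulCoeff_of_mem (i := i) (n := (I, m)) hi,
        mulCoeff_of_mem (i := i) (Finset.mem_insert_of_mem hi)]
      simp
    by_cases hj : j ∈ I
    · rw [mulCoeff_of_mem (i := j) (n := (I, m)) hj,
        mulCoeff_of_mem (i := j) (Finset.mem_insert_of_mem hj)]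
      simp
    rcases eq_or_ne i j with rfl | hij
    · rw [mulCoeff_of_mem (i := i) (n := mulMon (.inl i) (I, m)) (Finset.mem_insert_self _ _)]
      simp
    have hi' : i ∉ insert j I := by simp [hi, hij]
    have hj' : j ∉ insert i I := by simp [hj, hij.symm]
    rw [mulCoeff_of_notMem (i := i) (n := (I, m)) hi, mulCoeff_of_notMem (i := j) (n := (I, m)) hj,
      mulCoeff_of_notMem (i := i) (n := mulMon (.inl j) (I, m)) hi',
      mulCoeff_of_notMem (i := j) (n := mulMon (.inl i) (I, m)) hj']
    simp only [mulMon, card_filter_insert hi, card_filter_insert hj]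
    rcases lt_or_gt_of_ne hij with hlt | hlt <;> simp [hlt, hlt.not_gt, pow_succ] <;> ring
  · by_cases hi : i ∈ I <;> simp [mulCoeff, mulMon, hi]
  · by_cases hj : j ∈ I <;> simp [mulCoeff, mulMon, hj]
  · simp [mulCoeff]

variable {𝕜 : Type u} [RCLike 𝕜] {S : Type u} [Ring S] [Algebra 𝕜 S]

/-- The contraction `⟨dx_a, ·⟩`, extended to coefficients as a superderivation. -/
def contr (ε : S →ₐ[𝕜] S) (a : Fin p ⊕ Fin q) : (Mon p q →₀ S) →ₗ[𝕜] (Mon p q →₀ S) :=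
  Finsupp.lsum 𝕜 fun n => contrCoeff a n •
    (Finsupp.lsingle (contrMon a n) ∘ₗ (ε ^ (pe a + 1)).toLinearMap)

/-- The parity involution on polyfields. -/
def parOp (ε : S →ₐ[𝕜] S) : (Mon p q →₀ S) →ₗ[𝕜] (Mon p q →₀ S) :=
  Finsupp.lsum 𝕜 fun n => n.sign • (Finsupp.lsingle n ∘ₗ ε.toLinearMap)

/-- A linear map applied to all coefficients. -/
abbrev coeffMap (d : S →ₗ[𝕜] S) : (Mon p q →₀ S) →ₗ[𝕜] (Mon p q →₀ S) :=
  Finsupp.mapRange.linearMap d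

lemma contr_single (ε : S →ₐ[𝕜] S) (a : Fin p ⊕ Fin q) (n : Mon p q) (f : S) :
    contr ε a (Finsupp.single n f) =
      contrCoeff a n • Finsupp.single (contrMon a n) ((ε ^ (pe a + 1)) f) := by
  simp [contr]

lemma parOp_single (ε : S →ₐ[𝕜] S) (n : Mon p q) (f : S) :
    parOp ε (Finsupp.single n f) = n.sign • Finsupp.single n (ε f) := by
  simp [parOp]

lemma coeffMap_single (d : S →ₗ[𝕜] S) (n : Mon p q) (f : S) :
    coeffMap d (Finsupp.single n f) = Finsupp.single n (d f) := by
  simp [coeffMap]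

variable {ε : S →ₐ[𝕜] S} (h : IsSuperComm ε)

lemma coeffMap_smul (d : S →ₗ[𝕜] S) (k : S →ₗ[𝕜] S) (e f : S)
    (hd : ∀ g, d (f * g) = e * g + k f * d g) (s : Mon p q →₀ S) :
    coeffMap d (f • s) = e • s + k f • coeffMap d s := by
  ext n
  simp [hd]

lemma pow_comm_apply (ε : S →ₐ[𝕜] S) (k l : ℕ) (f : S) :
    (ε ^ k) ((ε ^ l) f) = (ε ^ l) ((ε ^ k) f) := by
  rw [← AlgHom.mul_apply, ← AlgHom.mul_apply, (Commute.pow_pow_self ε k l).eq]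

include h

lemma leftMul_single (a : Fin p ⊕ Fin q) (n : Mon p q) (f : S) :
    leftMul ε.toLinearMap a (Finsupp.single n f) =
      mulCoeff a n • Finsupp.single (mulMon a n) ((ε ^ (pe a + 1)) f) := by
  cases a <;> simp [leftMul, h.sq]

lemma leftMul_smul (a : Fin p ⊕ Fin q) (f : S) (s : Mon p q →₀ S) :
    leftMul ε.toLinearMap a (f • s) = (ε ^ (pe a + 1)) f • leftMul ε.toLinearMap a s := by
  induction s using Finsupp.induction_linear with
  | zero => simp
  | add s t hs ht => simp only [smul_add, map_add, hs, ht]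
  | single n g =>
    rw [Finsupp.smul_single, leftMul_single h, leftMul_single h, smul_comm, Finsupp.smul_single (_ : S),
      smul_eq_mul, map_mul, smul_eq_mul]

omit h in
lemma contr_smul (a : Fin p ⊕ Fin q) (f : S) (s : Mon p q →₀ S) :
    contr ε a (f • s) = (ε ^ (pe a + 1)) f • contr ε a s := by
  induction s using Finsupp.induction_linear with
  | zero => simp
  | add s t hs ht => simp only [smul_add, map_add, hs, ht]
  | single n g =>
    rw [Finsupp.smul_single, contr_single, contr_single, smul_comm, Finsupp.smul_single (_ : S),
      smul_eq_mul, map_mul, smul_eq_mul]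

omit h in
lemma parOp_smul (f : S) (s : Mon p q →₀ S) : parOp ε (f • s) = ε f • parOp ε s := by
  induction s using Finsupp.induction_linear with
  | zero => simp
  | add s t hs ht => simp only [smul_add, map_add, hs, ht]
  | single n g =>
    rw [Finsupp.smul_single, parOp_single, parOp_single, smul_comm, Finsupp.smul_single (_ : S),
      smul_eq_mul, map_mul, smul_eq_mul]

lemma parOp_parOp (s : Mon p q →₀ S) : parOp ε (parOp ε s) = s := by
  induction s using Finsupp.induction_linear with
  | zero => simp
  | add s t hs ht => simp only [map_add, hs, ht]
  | single n g =>
    rw [parOp_single, map_zsmul, parOp_single, smul_smul, h.invol, Mon.sign, ← pow_add,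
      Even.neg_one_pow ⟨_, rfl⟩, one_smul]

lemma leftMul_comm (a b : Fin p ⊕ Fin q) (s : Mon p q →₀ S) :
    leftMul ε.toLinearMap a (leftMul ε.toLinearMap b s) =
      (-1 : ℤ) ^ ((pe a + 1) * (pe b + 1)) •
        leftMul ε.toLinearMap b (leftMul ε.toLinearMap a s) := by
  induction s using Finsupp.induction_linear with
  | zero => simp
  | add s t hs ht => simp only [smul_add, map_add, hs, ht]
  | single n g =>
    simp only [leftMul_single h, map_zsmul, smul_smul]
    rw [mulCoeff_comm, mulMon_comm a b, pow_comm_apply ε (pe a + 1) (pe b + 1)]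

/-- With `contr_leftMul_of_ne` these are the canonical (anti)commutation relations: contraction is a
superderivation, and the inhomogeneous term is its value `⟨dx_a, π∂_a⟩`. -/
lemma contr_leftMul_self (a : Fin p ⊕ Fin q) (s : Mon p q →₀ S) :
    contr ε a (leftMul ε.toLinearMap a s) =
      (-1 : ℤ) ^ (pe a + 1) • s + (-1 : ℤ) ^ (pe a + 1) • leftMul ε.toLinearMap a (contr ε a s) := by
  induction s using Finsupp.induction_linear with
  | zero => simp
  | add s t hs ht => simp only [smul_add, map_add, hs, ht]; abel
  | single n g =>
    simp only [leftMul_single h, contr_single, map_zsmul, smul_smul]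
    have e : (ε ^ (pe a + 1)) ((ε ^ (pe a + 1)) g) = g := by
      rw [← AlgHom.mul_apply, ← pow_add, h.pow_even ⟨_, rfl⟩, AlgHom.one_apply]
    rw [e]
    rcases a with i | α
    · by_cases hi : i ∈ n.1
      · have h2 : (n.1.erase i).filter (· < i) = n.1.filter (· < i) := by
          ext j; simp +contextual [ne_of_lt]
        simp [mulCoeff, contrCoeff, mulMon, contrMon, hi, h2, ← pow_add,
          Even.neg_one_pow ⟨_, rfl⟩]
      · have h2 : (insert i n.1).filter (· < i) = n.1.filter (· < i) := by
          ext j; simp +contextual [or_and_right]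
        simp [mulCoeff, contrCoeff, mulMon, contrMon, hi, h2, ← pow_add,
          Even.neg_one_pow ⟨_, rfl⟩]
    · by_cases hn : n.2 α = 0
      · simp [mulCoeff, contrCoeff, mulMon, contrMon, hn]
      · have : n.2 - Finsupp.single α 1 + Finsupp.single α 1 = n.2 :=
          tsub_add_cancel_of_le (by simpa [Finsupp.single_le_iff] using Nat.one_le_iff_ne_zero.2 hn)
        simp only [mulCoeff, contrCoeff, mulMon, contrMon, pe_inr, this]
        simp [add_smul]
        abel

lemma contr_leftMul_of_ne {a b : Fin p ⊕ Fin q} (hab : a ≠ b) (s : Mon p q →₀ S) :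
    contr ε a (leftMul ε.toLinearMap b s) =
      (-1 : ℤ) ^ ((pe a + 1) * (pe b + 1)) • leftMul ε.toLinearMap b (contr ε a s) := by
  induction s using Finsupp.induction_linear with
  | zero => simp
  | add s t hs ht => simp only [smul_add, map_add, hs, ht]
  | single n g =>
    simp only [leftMul_single h, contr_single, map_zsmul, smul_smul,
      pow_comm_apply ε (pe a + 1) (pe b + 1)]
    have e : contrMon a (mulMon b n) = mulMon b (contrMon a n) := by
      rcases a with i | α <;> rcases b with j | β <;> simp only [mulMon, contrMon]
      · rw [Finset.erase_insert_of_ne (fun e => hab (by rw [e]))]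
      · have : β ≠ α := fun e => hab (by rw [e])
        congr 1
        ext γ
        by_cases h1 : γ = α
        · subst h1; simp [this]
        · simp [Finsupp.single_apply, Ne.symm h1]
    rw [e]
    congr 1
    obtain ⟨I, m⟩ := n
    rcases a with i | α <;> rcases b with j | β
    · have hij : i ≠ j := fun e => hab (by rw [e])
      by_cases hj : j ∈ I
      · rw [mulCoeff_of_mem (i := j) (n := (I, m)) hj, mulCoeff_of_mem (i := j)
          (n := contrMon (.inl i) (I, m)) (Finset.mem_erase.2 ⟨hij.symm, hj⟩)]
        simp
      by_cases hi : i ∈ I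
      · have hj' : j ∉ I.erase i := fun hh => hj (Finset.mem_of_mem_erase hh)
        rw [mulCoeff_of_notMem (i := j) (n := (I, m)) hj,
          mulCoeff_of_notMem (i := j) (n := contrMon (.inl i) (I, m)) hj',
          contrCoeff_of_mem (i := i) (n := (I, m)) hi,
          contrCoeff_of_mem (i := i) (n := mulMon (.inl j) (I, m)) (Finset.mem_insert_of_mem hi)]
        simp only [mulMon, contrMon, card_filter_insert hj]
        -- With `I` split as `insert i K`, all the counting exponents are reduced to counts in `K`.
        obtain ⟨K, hK, rfl⟩ : ∃ K, i ∉ K ∧ I = insert i K :=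
          ⟨I.erase i, by simp, by simp [hi]⟩
        rw [Finset.erase_insert hK]
        simp only [card_filter_insert hK]
        rcases lt_or_gt_of_ne hij with hlt | hlt <;> simp [hlt, hlt.not_gt, pow_succ, mul_comm]
      · have hi' : i ∉ insert j I := by simp [hi, hij]
        rw [contrCoeff_of_notMem (i := i) (n := (I, m)) hi,
          contrCoeff_of_notMem (i := i) (n := mulMon (.inl j) (I, m)) hi']
        simp
    · by_cases hi : i ∈ I <;> simp [mulCoeff, contrCoeff, mulMon, hi]
    · by_cases hj : j ∈ I <;> simp [mulCoeff, contrCoeff, mulMon, contrMon, hj, mul_comm]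
    · have : β ≠ α := fun e => hab (by rw [e])
      simp [mulCoeff, contrCoeff, mulMon, this]

lemma parOp_leftMul (b : Fin p ⊕ Fin q) (s : Mon p q →₀ S) :
    parOp ε (leftMul ε.toLinearMap b s) =
      (-1 : ℤ) ^ (pe b + 1) • leftMul ε.toLinearMap b (parOp ε s) := by
  induction s using Finsupp.induction_linear with
  | zero => simp
  | add s t hs ht => simp only [smul_add, map_add, hs, ht]
  | single n g =>
    have hc : ε ((ε ^ (pe b + 1)) g) = (ε ^ (pe b + 1)) (ε g) := by
      simpa using pow_comm_apply ε 1 (pe b + 1) g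
    simp only [leftMul_single h, parOp_single, map_zsmul, smul_smul, hc]
    congr 1
    rcases b with j | β
    · by_cases hj : j ∈ n.1
      · simp [mulCoeff, hj]
      · simp [mulCoeff, mulMon, hj, Mon.sign, pow_succ]; ring
    · simp [mulCoeff, mulMon, Mon.sign]

omit h in
lemma parOp_contr (b : Fin p ⊕ Fin q) (s : Mon p q →₀ S) :
    parOp ε (contr ε b s) =
      (-1 : ℤ) ^ (pe b + 1) • contr ε b (parOp ε s) := by
  induction s using Finsupp.induction_linear with
  | zero => simp
  | add s t hs ht => simp only [smul_add, map_add, hs, ht]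
  | single n g =>
    have hc : ε ((ε ^ (pe b + 1)) g) = (ε ^ (pe b + 1)) (ε g) := by
      simpa using pow_comm_apply ε 1 (pe b + 1) g
    simp only [contr_single, parOp_single, map_zsmul, smul_smul, hc]
    congr 1
    rcases b with j | β
    · by_cases hj : j ∈ n.1
      · obtain ⟨I, hI, hiI⟩ : ∃ I, j ∉ I ∧ n.1 = insert j I :=
          ⟨n.1.erase j, by simp, by simp [hj]⟩
        simp [contrCoeff, contrMon, Mon.sign, hiI, hI, pow_succ]; ring
      · simp [contrCoeff, hj]
    · simp [contrCoeff, contrMon, Mon.sign, mul_comm]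

omit h in
lemma contr_single_one (a : Fin p ⊕ Fin q) (f : S) :
    contr ε a (Finsupp.single (∅, 0) f) = 0 := by
  rw [contr_single]
  cases a <;> simp [contrCoeff]

omit h in
lemma contr_comm (a b : Fin p ⊕ Fin q) (s : Mon p q →₀ S) :
    contr ε a (contr ε b s) =
      (-1 : ℤ) ^ ((pe a + 1) * (pe b + 1)) • contr ε b (contr ε a s) := by
  induction s using Finsupp.induction_linear with
  | zero => simp
  | add s t hs ht => simp only [smul_add, map_add, hs, ht]
  | single n g =>
    simp only [contr_single, map_zsmul, smul_smul, pow_comm_apply ε (pe a + 1) (pe b + 1)]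
    have e : contrMon a (contrMon b n) = contrMon b (contrMon a n) := by
      rcases a with i | α <;> rcases b with j | β <;>
        simp [contrMon, Finset.erase_right_comm, tsub_right_comm]
    rw [e]
    congr 1
    obtain ⟨I, m⟩ := n
    rcases a with i | α <;> rcases b with j | β
    · rcases eq_or_ne i j with rfl | hij
      · rw [contrCoeff_of_notMem (i := i) (n := contrMon (.inl i) (I, m)) (by simp [contrMon])]
        simp
      by_cases hi : i ∈ I
      · by_cases hj : j ∈ I
        · have hi' : i ∈ I.erase j := Finset.mem_erase.2 ⟨hij, hi⟩
          have hj' : j ∈ I.erase i := Finset.mem_erase.2 ⟨hij.symm, hj⟩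
          rw [contrCoeff_of_mem (i := i) (n := (I, m)) hi,
            contrCoeff_of_mem (i := j) (n := (I, m)) hj,
            contrCoeff_of_mem (i := i) (n := contrMon (.inl j) (I, m)) hi',
            contrCoeff_of_mem (i := j) (n := contrMon (.inl i) (I, m)) hj']
          simp only [contrMon]
          obtain ⟨K, hK, rfl⟩ : ∃ K, i ∉ K ∧ I = insert i K :=
            ⟨I.erase i, by simp, by simp [hi]⟩
          rw [Finset.erase_insert hK, Finset.erase_insert_of_ne hij, card_filter_insert hK]
          rw [Finset.erase_insert hK] at hj'
          obtain ⟨N, hN, rfl⟩ : ∃ N, j ∉ N ∧ K = insert j N :=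
            ⟨K.erase j, by simp, by simp [hj']⟩
          have hiN : i ∉ N := fun hh => hK (Finset.mem_insert_of_mem hh)
          rw [Finset.erase_insert hN, card_filter_insert hiN, card_filter_insert hK,
            card_filter_insert hN, card_filter_insert hN]
          rcases lt_or_gt_of_ne hij with hlt | hlt <;>
            simp [hlt, hlt.not_gt, pow_succ] <;> ring
        · rw [contrCoeff_of_notMem (i := j) (n := (I, m)) hj, contrCoeff_of_notMem (i := j)
            (n := contrMon (.inl i) (I, m)) (fun hh => hj (Finset.mem_of_mem_erase hh))]
          simp
      · rw [contrCoeff_of_notMem (i := i) (n := (I, m)) hi, contrCoeff_of_notMem (i := i)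
          (n := contrMon (.inl j) (I, m)) (fun hh => hi (Finset.mem_of_mem_erase hh))]
        simp
    · by_cases hi : i ∈ I <;> simp [contrCoeff, contrMon, hi, mul_comm]
    · by_cases hj : j ∈ I <;> simp [contrCoeff, contrMon, hj, mul_comm]
    · rcases eq_or_ne α β with rfl | hij
      · simp
      · simp [contrCoeff, contrMon, hij, hij.symm, mul_comm]

omit h in
/-- Polyfields are generated by the functions under left multiplication by the `π∂_a`. -/
lemma polyField_induction (h : IsSuperComm ε) {motive : (Mon p q →₀ S) → Prop}
    (add : ∀ s t, motive s → motive t → motive (s + t))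
    (base : ∀ f, motive (Finsupp.single (∅, 0) f))
    (mul : ∀ a s, motive s → motive (leftMul ε.toLinearMap a s)) (s : Mon p q →₀ S) :
    motive s := by
  induction s using Finsupp.induction_linear with
  | zero => simpa using base 0
  | add s t hs ht => exact add s t hs ht
  | single n f =>
    obtain ⟨I, m⟩ := n
    induction I using Finset.induction_on generalizing f with
    | empty =>
      obtain ⟨k, hk⟩ : ∃ k, k = m.sum fun _ k => k := ⟨_, rfl⟩
      induction k generalizing m with
      | zero =>
        have : m = 0 := by
          ext α
          by_contra hα
          exact hα (Finset.sum_eq_zero_iff.1 hk.symm α (Finsupp.mem_support_iff.2 hα))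
        exact this ▸ base f
      | succ k ih =>
        have : m ≠ 0 := by
          rintro rfl
          simp at hk
        obtain ⟨α, hα⟩ := Finsupp.ne_iff.1 this
        have e : m - Finsupp.single α 1 + Finsupp.single α 1 = m :=
          tsub_add_cancel_of_le (by simpa [Finsupp.single_le_iff] using Nat.one_le_iff_ne_zero.2 hα)
        have := mul (Sum.inr α) _ (ih (m - Finsupp.single α 1) (by
          rw [← e, Finsupp.sum_add_index' (by simp) (by simp)] at hk
          simpa using hk))
        rw [leftMul_single h] at this
        simpa [mulCoeff, mulMon, e, h.sq] using this
    | insert i I hi ih =>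
      -- The coefficient is chosen to undo the sign and the `ε` that left multiplication by
      -- `π∂_{z_i}` introduces.
      have := mul (Sum.inl i) _ (ih ((-1 : ℤ) ^ (I.filter (· < i)).card • ε f))
      rw [leftMul_single h, mulCoeff_of_notMem hi, map_zsmul, pe_inl, zero_add, pow_one, h.invol,
        ← Finsupp.smul_single, smul_smul, ← pow_add, Even.neg_one_pow ⟨_, rfl⟩, one_smul] at this
      exact this

end Operators

/-! ## Coordinate systems and the differential -/

section CoordSystem

variable {p q : ℕ} {𝕜 : Type u} [RCLike 𝕜] {S : Type u} [Ring S] [Algebra 𝕜 S]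

/-- `x` is a system of coordinates of a supercommutative algebra, with coordinate vector fields
`pd`. -/
structure IsCoordSystem (ε : S →ₐ[𝕜] S) (pd : Fin p ⊕ Fin q → (S →ₗ[𝕜] S))
    (x : Fin p ⊕ Fin q → S) : Prop extends IsSuperComm ε where
  leibniz : ∀ a f g, pd a (f * g) = pd a f * g + (ε ^ pe a) f * pd a g
  par_pd : ∀ a f, ε (pd a f) = (-1 : ℤ) ^ pe a • pd a (ε f)
  pd_comm : ∀ a b f, pd a (pd b f) = (-1 : ℤ) ^ (pe a * pe b) • pd b (pd a f)
  hom_x : ∀ a, IsHom ε (pe a) (x a)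
  pd_x : ∀ a b, pd a (x b) = if a = b then 1 else 0
  -- This is what makes the product of all odd coordinates annihilate every odd function.
  odd_gen : ∀ f, ε f = -f → ∃ k : Fin q → S, (∀ α, ε (k α) = k α) ∧ f = ∑ α, x (.inr α) * k α

namespace IsCoordSystem

variable {ε : S →ₐ[𝕜] S} {pd : Fin p ⊕ Fin q → (S →ₗ[𝕜] S)} {x : Fin p ⊕ Fin q → S}
  (h : IsCoordSystem ε pd x)
include h

lemma pd_pow (a : Fin p ⊕ Fin q) (k : ℕ) (f : S) :
    pd a ((ε ^ k) f) = (-1 : ℤ) ^ (k * pe a) • (ε ^ k) (pd a f) := by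
  induction k generalizing f with
  | zero => simp
  | succ k ih =>
    rw [pow_succ, AlgHom.mul_apply, ih, AlgHom.mul_apply, h.par_pd, map_zsmul, smul_smul,
      ← pow_add]
    congr 1
    exact neg_one_pow_congr (by simp [Nat.even_add, Nat.even_mul, add_mul])

lemma hom_pd (a : Fin p ⊕ Fin q) {k : ℕ} {f : S} (hf : IsHom ε k f) :
    IsHom ε (pe a + k) (pd a f) := by
  unfold IsHom at *
  rw [h.par_pd, hf, map_zsmul, smul_smul, ← pow_add]

lemma pd_one (a : Fin p ⊕ Fin q) : pd a 1 = 0 := by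
  have := h.leibniz a 1 1
  simpa using this

lemma pd_smul (a : Fin p ⊕ Fin q) (f : S) (s : Mon p q →₀ S) :
    coeffMap (pd a) (f • s) = pd a f • s + (ε ^ pe a) f • coeffMap (pd a) s :=
  coeffMap_smul _ (ε ^ pe a).toLinearMap _ _ (h.leibniz a f) s

lemma pd_leftMul (a b : Fin p ⊕ Fin q) (s : Mon p q →₀ S) :
    coeffMap (pd a) (leftMul ε.toLinearMap b s) =
      (-1 : ℤ) ^ (pe a * (pe b + 1)) • leftMul ε.toLinearMap b (coeffMap (pd a) s) := by
  induction s using Finsupp.induction_linear with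
  | zero => simp
  | add s t hs ht => simp only [smul_add, map_add, hs, ht]
  | single n g =>
    simp only [leftMul_single h.toIsSuperComm, coeffMap_single, map_zsmul, h.pd_pow]
    rw [← Finsupp.smul_single, smul_comm, mul_comm]

lemma pd_contr (a b : Fin p ⊕ Fin q) (s : Mon p q →₀ S) :
    coeffMap (pd a) (contr ε b s) =
      (-1 : ℤ) ^ (pe a * (pe b + 1)) • contr ε b (coeffMap (pd a) s) := by
  induction s using Finsupp.induction_linear with
  | zero => simp
  | add s t hs ht => simp only [smul_add, map_add, hs, ht]
  | single n g =>
    simp only [contr_single, coeffMap_single, map_zsmul, h.pd_pow]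
    rw [← Finsupp.smul_single, smul_comm, mul_comm]

lemma parOp_pd (a : Fin p ⊕ Fin q) (s : Mon p q →₀ S) :
    parOp ε (coeffMap (pd a) s) = (-1 : ℤ) ^ pe a • coeffMap (pd a) (parOp ε s) := by
  induction s using Finsupp.induction_linear with
  | zero => simp
  | add s t hs ht => simp only [smul_add, map_add, hs, ht]
  | single n g =>
    simp only [parOp_single, coeffMap_single, map_zsmul, h.par_pd]
    rw [← Finsupp.smul_single, smul_comm]

lemma pd_pd (a b : Fin p ⊕ Fin q) (s : Mon p q →₀ S) :
    coeffMap (pd a) (coeffMap (pd b) s) =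
      (-1 : ℤ) ^ (pe a * pe b) • coeffMap (pd b) (coeffMap (pd a) s) := by
  ext n
  simp [h.pd_comm a b]

/-- The sign `(-1)^{|x_a||f| + |n|}` is produced by the parity operator together with the power of
`ε` inside the contraction. In this form `δ` is built from operators whose commutation relations are
known. -/
lemma coordDelta_eq (s : Mon p q →₀ S) :
    coordDelta ε.toLinearMap pd s = -∑ a, contr ε a (coeffMap (pd a) (parOp ε s)) := by
  induction s using Finsupp.induction_linear with
  | zero => simp
  | add s t hs ht => simp only [map_add, hs, ht, Finset.sum_add_distrib, neg_add]
  | single n g =>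
    rw [coordDelta, Finsupp.lsum_single, LinearMap.sum_apply, ← Finset.sum_neg_distrib]
    refine Finset.sum_congr rfl fun a _ => ?_
    simp only [parOp_single, coeffMap_single, map_zsmul, contr_single,
      smul_smul, neg_smul]
    rw [LinearMap.neg_apply, LinearMap.smul_apply, LinearMap.comp_apply, Finsupp.lsingle_apply]
    congr 3
    cases a with
    | inl i =>
      have := h.par_pd (.inl i) (ε g)
      rw [h.invol] at this
      simpa using this.symm
    | inr α => simp [h.sq]

/-- Cartan's formula. Every summand `a ≠ b` of `δ` commutes with `π∂_b`, the signs cancelling in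
pairs; the summand `a = b` leaves the inhomogeneous term of the contraction relation. -/
lemma delta_leftMul (b : Fin p ⊕ Fin q) (s : Mon p q →₀ S) :
    coordDelta ε.toLinearMap pd (leftMul ε.toLinearMap b s) =
      leftMul ε.toLinearMap b (coordDelta ε.toLinearMap pd s) - coeffMap (pd b) (parOp ε s) := by
  rw [h.coordDelta_eq, h.coordDelta_eq, map_neg, map_sum, ← neg_add', neg_inj,
    ← Finset.sum_erase_add _ _ (Finset.mem_univ b),
    ← Finset.sum_erase_add (a := b) _ _ (Finset.mem_univ b), add_assoc]
  congr 1
  · refine Finset.sum_congr rfl fun a ha => ?_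
    rw [parOp_leftMul h.toIsSuperComm, map_zsmul, h.pd_leftMul, smul_smul, map_zsmul,
      contr_leftMul_of_ne h.toIsSuperComm (Finset.ne_of_mem_erase ha), smul_smul, ← pow_add,
      ← pow_add]
    rw [Even.neg_one_pow, one_smul]
    cases a <;> cases b <;> simp only [pe_inl, pe_inr] <;> decide
  · rw [parOp_leftMul h.toIsSuperComm, map_zsmul, h.pd_leftMul, smul_smul, map_zsmul,
      contr_leftMul_self h.toIsSuperComm, ← smul_add, smul_smul, ← pow_add, ← pow_add,
      Even.neg_one_pow, one_smul, add_comm]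
    cases b <;> simp only [pe_inl, pe_inr] <;> decide

/-- The failure of `δ` to be linear over functions: each `∂_a` obeys the Leibniz rule, while parity
and contraction only twist `f` by `ε`. -/
lemma delta_smul (f : S) (s : Mon p q →₀ S) :
    coordDelta ε.toLinearMap pd (f • s) =
      f • coordDelta ε.toLinearMap pd s -
        ∑ a, pd a ((ε ^ pe a) f) • contr ε a (parOp ε s) := by
  rw [h.coordDelta_eq, h.coordDelta_eq, smul_neg, ← neg_add', neg_inj, Finset.smul_sum,
    ← Finset.sum_add_distrib]
  refine Finset.sum_congr rfl fun a _ => ?_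
  rw [parOp_smul, h.pd_smul, map_add, contr_smul, contr_smul, add_comm]
  congr 2
  · rw [← AlgHom.mul_apply, ← pow_add, ← AlgHom.mul_apply, ← pow_succ, h.pow_even ⟨pe a + 1, by ring⟩]
    rfl
  · rw [h.pd_pow, pow_succ, AlgHom.mul_apply, h.par_pd, h.invol, map_zsmul]
    cases a <;> simp

/-- Exchanging the two summation indices changes the sign of every term, since contractions and
derivatives have opposite parities; a sum equal to its negative vanishes because `2` is invertible.
-/
lemma delta_delta (s : Mon p q →₀ S) :
    coordDelta ε.toLinearMap pd (coordDelta ε.toLinearMap pd s) = 0 := by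
  have e : coordDelta ε.toLinearMap pd (coordDelta ε.toLinearMap pd s) =
      - ∑ a, ∑ b, (-1 : ℤ) ^ (pe a * (pe b + 1)) •
        contr ε a (contr ε b (coeffMap (pd a) (coeffMap (pd b) s))) := by
    rw [h.coordDelta_eq, neg_inj]
    refine Finset.sum_congr rfl fun a _ => ?_
    rw [h.coordDelta_eq]
    simp only [map_neg, map_sum]
    rw [← Finset.sum_neg_distrib]
    refine Finset.sum_congr rfl fun b _ => ?_
    rw [parOp_contr, h.parOp_pd, parOp_parOp h.toIsSuperComm, map_zsmul, map_zsmul, map_zsmul,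
      map_zsmul, map_zsmul, h.pd_contr, map_zsmul, smul_smul, smul_smul, ← neg_smul, ← pow_add,
      ← pow_add]
    congr 1
    cases a <;> cases b <;> simp
  have e2 : ∑ a, ∑ b, (-1 : ℤ) ^ (pe a * (pe b + 1)) •
        contr ε a (contr ε b (coeffMap (pd a) (coeffMap (pd b) s))) =
      -∑ a, ∑ b, (-1 : ℤ) ^ (pe a * (pe b + 1)) •
        contr ε a (contr ε b (coeffMap (pd a) (coeffMap (pd b) s))) := by
    conv_lhs => rw [Finset.sum_comm]
    rw [← Finset.sum_neg_distrib]
    refine Finset.sum_congr rfl fun a _ => ?_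
    rw [← Finset.sum_neg_distrib]
    refine Finset.sum_congr rfl fun b _ => ?_
    rw [h.pd_pd b a, map_zsmul, map_zsmul, contr_comm b a, smul_smul, smul_smul, ← neg_smul]
    congr 1
    cases a <;> cases b <;> simp
  have h2 := add_eq_zero_iff_eq_neg.2 e2
  rw [← two_smul 𝕜] at h2
  rw [e, (smul_eq_zero.1 h2).resolve_left two_ne_zero, neg_zero]

end IsCoordSystem

end CoordSystem

/-! ## Substitution -/

section Subst

variable {p q : ℕ} {𝕜 : Type u} [RCLike 𝕜] {S : Type u} [Ring S] [Algebra 𝕜 S]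
  {ε : S →ₐ[𝕜] S}

/-- An even supermatrix. -/
def IsEvenMatrix (ε : S →ₐ[𝕜] S) (J : Matrix (Fin p ⊕ Fin q) (Fin p ⊕ Fin q) S) : Prop :=
  ∀ a b, IsHom ε (pe a + pe b) (J a b)

/-- Left multiplication by `∑_b J_{ab} π∂_b`. -/
def leftMulRow (ε : S →ₐ[𝕜] S) (J : Matrix (Fin p ⊕ Fin q) (Fin p ⊕ Fin q) S)
    (a : Fin p ⊕ Fin q) : (Mon p q →₀ S) →ₗ[𝕜] (Mon p q →₀ S) where
  toFun s := ∑ b, J a b • leftMul ε.toLinearMap b s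
  map_add' s t := by simp only [map_add, smul_add, Finset.sum_add_distrib]
  map_smul' r s := by simp only [map_smul, Finset.smul_sum, smul_comm r, RingHom.id_apply]

lemma leftMulRow_apply (J : Matrix (Fin p ⊕ Fin q) (Fin p ⊕ Fin q) S)
    (a : Fin p ⊕ Fin q) (s : Mon p q →₀ S) :
    leftMulRow ε J a s = ∑ b, J a b • leftMul ε.toLinearMap b s := rfl

lemma substMon_eq (J : Matrix (Fin p ⊕ Fin q) (Fin p ⊕ Fin q) S) (n : Mon p q) :
    substMon ε.toLinearMap J n =
      n.word.foldr (fun a s => leftMulRow ε J a s) (Finsupp.single (∅, 0) 1) := rfl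

lemma subst_single (J : Matrix (Fin p ⊕ Fin q) (Fin p ⊕ Fin q) S) (n : Mon p q) (f : S) :
    subst ε.toLinearMap J (Finsupp.single n f) = f • substMon ε.toLinearMap J n := by
  simp [subst]

lemma subst_smul (J : Matrix (Fin p ⊕ Fin q) (Fin p ⊕ Fin q) S) (f : S) (s : Mon p q →₀ S) :
    subst ε.toLinearMap J (f • s) = f • subst ε.toLinearMap J s := by
  induction s using Finsupp.induction_linear with
  | zero => simp
  | add s t hs ht => simp only [smul_add, map_add, hs, ht]
  | single n g => rw [Finsupp.smul_single, subst_single, subst_single, smul_smul, smul_eq_mul]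

lemma word_one : Mon.word ((∅, 0) : Mon p q) = [] := by
  simp [Mon.word]

lemma subst_single_one (J : Matrix (Fin p ⊕ Fin q) (Fin p ⊕ Fin q) S) (f : S) :
    subst ε.toLinearMap J (Finsupp.single (∅, 0) f) = Finsupp.single (∅, 0) f := by
  rw [subst_single, substMon_eq, word_one]
  simp

variable (h : IsSuperComm ε) {J : Matrix (Fin p ⊕ Fin q) (Fin p ⊕ Fin q) S}
  (hJ : IsEvenMatrix ε J)
include h hJ

/-- As `J` is even, each `J_{ab} π∂_b` has the parity of `π∂_a`, so the whole row obeys the sign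
rule of `π∂_a`. -/
lemma leftMulRow_smul (a : Fin p ⊕ Fin q) (f : S) (s : Mon p q →₀ S) :
    leftMulRow ε J a (f • s) = (ε ^ (pe a + 1)) f • leftMulRow ε J a s := by
  simp only [leftMulRow_apply, Finset.smul_sum]
  refine Finset.sum_congr rfl fun b _ => ?_
  rw [leftMul_smul h, smul_smul, smul_smul, h.hom_mul_comm (hJ a b), ← AlgHom.mul_apply, ← pow_add,
    h.pow_congr]
  cases a <;> cases b <;> simp only [pe_inl, pe_inr] <;> decide

lemma leftMulRow_comm (a b : Fin p ⊕ Fin q) (s : Mon p q →₀ S) :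
    leftMulRow ε J a (leftMulRow ε J b s) =
      (-1 : ℤ) ^ ((pe a + 1) * (pe b + 1)) • leftMulRow ε J b (leftMulRow ε J a s) := by
  rw [leftMulRow_apply (a := b), leftMulRow_apply (a := a) (s := s), map_sum, map_sum,
    Finset.smul_sum]
  simp only [leftMulRow_smul h hJ]
  simp only [leftMulRow_apply, Finset.smul_sum]
  rw [Finset.sum_comm]
  refine Finset.sum_congr rfl fun c _ => Finset.sum_congr rfl fun d _ => ?_
  rw [IsSuperComm.hom_pow (hJ b d), IsSuperComm.hom_pow (hJ a c), leftMul_comm h c d]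
  simp only [smul_assoc, smul_comm (_ : S) (_ : ℤ)]
  simp only [smul_smul (_ : S) (_ : S)]
  rw [h.hom_mul_hom_comm (hJ a c) (hJ b d)]
  simp only [smul_assoc, smul_smul (_ : ℤ) (_ : ℤ), ← pow_add]
  congr 1
  cases a <;> cases b <;> cases c <;> cases d <;> simp

lemma leftMulRow_inl_self (i : Fin p) (s : Mon p q →₀ S) :
    leftMulRow ε J (.inl i) (leftMulRow ε J (.inl i) s) = 0 := by
  have := leftMulRow_comm h hJ (.inl i) (.inl i) s
  simp only [pe_inl, zero_add, mul_one, pow_one, neg_smul, one_smul] at this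
  have h2 := add_eq_zero_iff_eq_neg.2 this
  rw [← two_smul 𝕜] at h2
  exact (smul_eq_zero.1 h2).resolve_left two_ne_zero

lemma leftMulRow_foldr_mem {i : Fin p} {l : List (Fin p)} (hi : i ∈ l) (s : Mon p q →₀ S) :
    leftMulRow ε J (.inl i) ((l.map Sum.inl).foldr (fun a s => leftMulRow ε J a s) s) = 0 := by
  induction l with
  | nil => simp at hi
  | cons j l ih =>
    simp only [List.map_cons, List.foldr_cons]
    rcases List.mem_cons.1 hi with rfl | hi
    · exact leftMulRow_inl_self h hJ _ _
    · rw [leftMulRow_comm h hJ, ih hi, map_zero, smul_zero]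

/-- The new odd factor travels to its place in the increasing order and passes exactly the smaller
indices, one sign each. -/
lemma leftMulRow_foldr_notMem {i : Fin p} {l : List (Fin p)} (hl : l.Pairwise (· < ·)) (hi : i ∉ l)
    (s : Mon p q →₀ S) :
    leftMulRow ε J (.inl i) ((l.map Sum.inl).foldr (fun a s => leftMulRow ε J a s) s) =
      (-1 : ℤ) ^ (l.filter (· < i)).length •
        ((l.orderedInsert (· ≤ ·) i).map Sum.inl).foldr (fun a s => leftMulRow ε J a s) s := by
  induction l with
  | nil => simp
  | cons j l ih =>
    rw [List.pairwise_cons] at hl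
    rw [List.mem_cons, not_or] at hi
    rw [List.orderedInsert]
    split_ifs with hij
    · have : (j :: l).filter (· < i) = [] := by
        rw [List.filter_eq_nil_iff]
        intro k hk
        rcases List.mem_cons.1 hk with rfl | hk
        · simpa using hij
        · simpa using hij.trans (hl.1 k hk).le
      rw [this]
      simp
    · simp only [List.map_cons, List.foldr_cons]
      rw [leftMulRow_comm h hJ, ih hl.2 hi.2, map_zsmul, smul_smul, ← pow_add,
        List.filter_cons_of_pos (by simpa using hij)]
      congr 1
      simp only [pe_inl, List.length_cons]
      ring

lemma leftMulRow_inr_foldr (α : Fin q) (l : List (Fin p ⊕ Fin q)) (s : Mon p q →₀ S) :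
    leftMulRow ε J (.inr α) (l.foldr (fun a s => leftMulRow ε J a s) s) =
      l.foldr (fun a s => leftMulRow ε J a s) (leftMulRow ε J (.inr α) s) := by
  induction l with
  | nil => rfl
  | cons b l ih =>
    simp only [List.foldr_cons]
    rw [leftMulRow_comm h hJ, ih, Even.neg_one_pow, one_smul]
    cases b <;> simp only [pe_inl, pe_inr] <;> decide

/-- The images of the `π∂_a` satisfy the same supercommutation relations as the `π∂_a`, so bringing
a product of images into normal order costs the same sign. This makes substitution multiplicative.
-/
lemma leftMulRow_substMon (a : Fin p ⊕ Fin q) (n : Mon p q) :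
    leftMulRow ε J a (substMon ε.toLinearMap J n) =
      mulCoeff a n • substMon ε.toLinearMap J (mulMon a n) := by
  obtain ⟨I, m⟩ := n
  simp only [substMon_eq, Mon.word, mulMon]
  cases a with
  | inl i =>
    simp only [List.foldr_append]
    by_cases hi : i ∈ I
    · rw [mulCoeff_of_mem hi, zero_smul, leftMulRow_foldr_mem h hJ]
      simpa using hi
    · rw [mulCoeff_of_notMem hi, leftMulRow_foldr_notMem h hJ (Finset.sortedLT_sort I).pairwise
        (by simpa using hi)]
      have e1 : (I.sort (· ≤ ·)).orderedInsert (· ≤ ·) i = (insert i I).sort (· ≤ ·) := by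
        refine List.Perm.eq_of_pairwise' ?_ ?_ ?_ (r := (· ≤ ·))
        · exact List.Pairwise.orderedInsert _ _ (Finset.pairwise_sort I _)
        · exact Finset.pairwise_sort _ _
        · refine (List.perm_orderedInsert _ _ _).trans ?_
          rw [List.perm_ext_iff_of_nodup]
          · simp
          · simpa using hi
          · exact Finset.sort_nodup _ _
      have e2 : ((I.sort (· ≤ ·)).filter (· < i)).length = (I.filter (· < i)).card := by
        rw [← List.toFinset_card_of_nodup ((Finset.sort_nodup I _).filter _)]
        congr 1
        ext j
        simp
      rw [e1, e2]
  | inr α =>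
    rw [List.foldr_append, leftMulRow_inr_foldr h hJ, List.foldr_append]
    simp only [mulCoeff, one_smul]
    congr 1
    have hw : ∀ m : Fin q →₀ ℕ,
        ((List.finRange q).flatMap fun α => List.replicate (m α) (Sum.inr α : Fin p ⊕ Fin q)) =
        ((List.finRange q).flatMap fun α => List.replicate (m α) α).map Sum.inr := fun m => by
      simp [List.map_flatMap]
    -- The factors belonging to odd coordinates are even and commute, so only the multiplicity of
    -- each one matters.
    have : LeftCommutative fun (α : Fin q) (s : Mon p q →₀ S) => leftMulRow ε J (.inr α) s :=
      ⟨fun α β s => by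
        rw [leftMulRow_comm h hJ, Even.neg_one_pow (by simp only [pe_inr]; decide), one_smul]⟩
    rw [hw, hw, List.foldr_map, List.foldr_map,
      ← List.foldr_cons (f := fun (α : Fin q) (s : Mon p q →₀ S) => leftMulRow ε J (.inr α) s)]
    refine List.Perm.foldr_eq ?_ _
    rw [List.perm_iff_count]
    intro γ
    have hc : ∀ m : Fin q →₀ ℕ,
        List.count γ ((List.finRange q).flatMap fun α => List.replicate (m α) α) = m γ := fun m => by
      rw [List.count_flatMap]
      simp only [Function.comp_def, List.count_replicate]
      simp only [beq_iff_eq]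
      rw [← List.ofFn_eq_map, List.sum_ofFn]
      simp
    rw [List.count_cons, hc, hc]
    simp [Finsupp.single_apply]

lemma subst_leftMul (a : Fin p ⊕ Fin q) (s : Mon p q →₀ S) :
    subst ε.toLinearMap J (leftMul ε.toLinearMap a s) =
      leftMulRow ε J a (subst ε.toLinearMap J s) := by
  induction s using Finsupp.induction_linear with
  | zero => simp
  | add s t hs ht => simp only [map_add, hs, ht]
  | single n g =>
    rw [leftMul_single h, map_zsmul, subst_single, subst_single, leftMulRow_smul h hJ,
      leftMulRow_substMon h hJ, smul_comm]

lemma subst_leftMulRow (K : Matrix (Fin p ⊕ Fin q) (Fin p ⊕ Fin q) S) (a : Fin p ⊕ Fin q)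
    (s : Mon p q →₀ S) :
    subst ε.toLinearMap J (leftMulRow ε K a s) =
      leftMulRow ε (K * J) a (subst ε.toLinearMap J s) := by
  simp only [leftMulRow_apply, map_sum, subst_smul, subst_leftMul h hJ, Matrix.mul_apply,
    Finset.smul_sum, Finset.sum_smul, smul_smul]
  exact Finset.sum_comm

omit h in
lemma IsEvenMatrix.mul {K : Matrix (Fin p ⊕ Fin q) (Fin p ⊕ Fin q) S} (hK : IsEvenMatrix ε K) :
    IsEvenMatrix ε (K * J) := fun a b => by
  rw [Matrix.mul_apply]
  refine IsHom.sum fun c _ => ((hK a c).mul (hJ c b)).congr ?_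
  cases a <;> cases b <;> cases c <;> simp only [pe_inl, pe_inr] <;> decide

/-- It suffices to compare on generators. The order is `K * J` because substitution is linear over
functions: the entries of `K` stay outside as coefficients while `J` is inserted for the `π∂_b`. -/
lemma subst_subst {K : Matrix (Fin p ⊕ Fin q) (Fin p ⊕ Fin q) S} (hK : IsEvenMatrix ε K)
    (s : Mon p q →₀ S) :
    subst ε.toLinearMap J (subst ε.toLinearMap K s) = subst ε.toLinearMap (K * J) s := by
  induction s using polyField_induction h with
  | add s t hs ht => simp only [map_add, hs, ht]
  | base f => simp only [subst_single_one]
  | mul a s hs =>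
    rw [subst_leftMul h hK, subst_leftMulRow h hJ, hs, subst_leftMul h (IsEvenMatrix.mul hJ hK)]

omit hJ in
lemma subst_one (s : Mon p q →₀ S) : subst ε.toLinearMap 1 s = s := by
  have h1 : IsEvenMatrix (p := p) (q := q) ε 1 := fun a b => by
    unfold IsHom
    rcases eq_or_ne a b with rfl | hab
    · simp [← two_mul]
    · simp [hab]
  induction s using polyField_induction h with
  | add s t hs ht => simp only [map_add, hs, ht]
  | base f => simp only [subst_single_one]
  | mul a s hs =>
    rw [subst_leftMul h h1, hs, leftMulRow_apply, Finset.sum_eq_single a]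
    · simp
    · intro b _ hb
      simp [hb.symm]
    · simp

end Subst

/-! ## Invariance of the differential -/

section Invariance

variable {p q : ℕ} {𝕜 : Type u} [RCLike 𝕜] {S : Type u} [Ring S] [Algebra 𝕜 S]
  {ε : S →ₐ[𝕜] S}

/-- Turns an identity of Koszul signs into a polynomial identity over `ZMod 2`, to be checked on all
values of the parities. -/
lemma sign_congr {A B : ℕ} (hAB : (A : ZMod 2) = B) : (-1 : ℤ) ^ A = (-1) ^ B :=
  neg_one_pow_congr (by
    rw [← ZMod.natCast_eq_zero_iff_even, ← ZMod.natCast_eq_zero_iff_even, hAB])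

lemma contr_leftMul (h : IsSuperComm ε) (a b : Fin p ⊕ Fin q) (s : Mon p q →₀ S) :
    contr ε a (leftMul ε.toLinearMap b s) =
      (if a = b then (-1 : ℤ) ^ (pe a + 1) else 0) • s +
        (-1 : ℤ) ^ ((pe a + 1) * (pe b + 1)) • leftMul ε.toLinearMap b (contr ε a s) := by
  split_ifs with hab
  · subst hab
    rw [contr_leftMul_self h]
    congr 2
    cases a <;> simp
  · rw [contr_leftMul_of_ne h hab, zero_smul, zero_add]

/-- The Lie derivative of integral forms along the vector field `∑_c J_{bc} ∂_c`. -/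
def lieOp (ε : S →ₐ[𝕜] S) (pd : Fin p ⊕ Fin q → (S →ₗ[𝕜] S))
    (J : Matrix (Fin p ⊕ Fin q) (Fin p ⊕ Fin q) S) (b : Fin p ⊕ Fin q) (s : Mon p q →₀ S) :
    Mon p q →₀ S :=
  ∑ c, J b c • coeffMap (pd c) s +
    ∑ c, ∑ a, (-1 : ℤ) ^ (pe c + 1 + pe a * (pe b + pe c)) •
      pd a (J b c) • contr ε a (leftMul ε.toLinearMap c s)

lemma lieOp_add (pd : Fin p ⊕ Fin q → (S →ₗ[𝕜] S))
    (J : Matrix (Fin p ⊕ Fin q) (Fin p ⊕ Fin q) S) (b : Fin p ⊕ Fin q) (s t : Mon p q →₀ S) :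
    lieOp ε pd J b (s + t) = lieOp ε pd J b s + lieOp ε pd J b t := by
  simp only [lieOp, map_add, smul_add, Finset.sum_add_distrib]
  abel

variable {pd : Fin p ⊕ Fin q → (S →ₗ[𝕜] S)} {x : Fin p ⊕ Fin q → S}
  {pd' : Fin p ⊕ Fin q → (S →ₗ[𝕜] S)} {x' : Fin p ⊕ Fin q → S}
  (h : IsCoordSystem ε pd x) (h' : IsCoordSystem ε pd' x')
  {J : Matrix (Fin p ⊕ Fin q) (Fin p ⊕ Fin q) S}
  (hJ : IsEvenMatrix ε J)

-- Cartan's formula for a general even row. The first sum in `lieOp` comes from `delta_leftMul`, the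
-- second from derivatives falling on the coefficients, as in `delta_smul`.
include h' hJ in
lemma delta_leftMulRow (b : Fin p ⊕ Fin q) (s : Mon p q →₀ S) :
    coordDelta ε.toLinearMap pd' (leftMulRow ε J b s) =
      leftMulRow ε J b (coordDelta ε.toLinearMap pd' s) - lieOp ε pd' J b (parOp ε s) := by
  simp only [leftMulRow_apply, map_sum, lieOp]
  rw [← Finset.sum_add_distrib, ← Finset.sum_sub_distrib]
  refine Finset.sum_congr rfl fun c _ => ?_
  rw [h'.delta_smul, h'.delta_leftMul, smul_sub, sub_sub]
  congr 2
  refine Finset.sum_congr rfl fun a _ => ?_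
  rw [IsSuperComm.hom_pow (hJ b c), map_zsmul, parOp_leftMul h'.toIsSuperComm, map_zsmul,
    smul_assoc, smul_comm (_ : S) (_ : ℤ), smul_smul, ← pow_add, add_comm]

set_option maxHeartbeats 400000 in
/-- Commutation of the Lie derivative with multiplication by a vector field. -/
lemma lieOp_leftMulRow (h' : IsCoordSystem ε pd' x') (hJ : IsEvenMatrix ε J)
    (b c : Fin p ⊕ Fin q)
    (hbc : ∀ e, ∑ d, J b d * pd' d (J c e) =
      (-1 : ℤ) ^ (pe b * pe c) • ∑ d, J c d * pd' d (J b e)) (s : Mon p q →₀ S) :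
    lieOp ε pd' J b (leftMulRow ε J c s) =
      (-1 : ℤ) ^ (pe b * (pe c + 1)) • leftMulRow ε J c (lieOp ε pd' J b s) := by
  have hs := h'.toIsSuperComm
  -- the terms with derivatives of `s`
  have e1 : ∑ a, J b a • coeffMap (pd' a) (leftMulRow ε J c s) =
      ∑ e, (∑ d, J b d * pd' d (J c e)) • leftMul ε.toLinearMap e s +
        (-1 : ℤ) ^ (pe b * (pe c + 1)) • leftMulRow ε J c (∑ a, J b a • coeffMap (pd' a) s) := by
    simp only [leftMulRow_apply, map_sum, h'.pd_smul, Finset.smul_sum, smul_add,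
      Finset.sum_add_distrib, Finset.sum_smul]
    congr 1
    · rw [Finset.sum_comm]
      simp only [smul_smul]
    · refine Finset.sum_congr rfl fun a _ => Finset.sum_congr rfl fun d _ => ?_
      rw [IsSuperComm.hom_pow (hJ c d), h'.pd_leftMul, leftMul_smul hs,
        IsSuperComm.hom_pow (hJ b a)]
      simp only [smul_assoc, smul_comm (_ : S) (_ : ℤ)]
      simp only [smul_smul (_ : S) (_ : S)]
      rw [hs.hom_mul_hom_comm (hJ b a) (hJ c d)]
      simp only [smul_assoc, smul_smul (_ : ℤ) (_ : ℤ), ← pow_add]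
      congr 1
      refine sign_congr ?_
      push_cast
      generalize (pe a : ZMod 2) = a, (pe b : ZMod 2) = b, (pe c : ZMod 2) = c,
        (pe d : ZMod 2) = d
      decide +revert
  -- the terms with derivatives of `J`
  have e2 : ∑ e, ∑ a, (-1 : ℤ) ^ (pe e + 1 + pe a * (pe b + pe e)) •
        pd' a (J b e) • contr ε a (leftMul ε.toLinearMap e (leftMulRow ε J c s)) =
      -((-1 : ℤ) ^ (pe b * pe c) • ∑ e, (∑ d, J c d * pd' d (J b e)) •
          leftMul ε.toLinearMap e s) +
        (-1 : ℤ) ^ (pe b * (pe c + 1)) • leftMulRow ε J c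
          (∑ e, ∑ a, (-1 : ℤ) ^ (pe e + 1 + pe a * (pe b + pe e)) •
            pd' a (J b e) • contr ε a (leftMul ε.toLinearMap e s)) := by
    have e3 : ∀ e a d, (-1 : ℤ) ^ (pe e + 1 + pe a * (pe b + pe e)) •
        pd' a (J b e) • contr ε a (leftMul ε.toLinearMap e (J c d • leftMul ε.toLinearMap d s)) =
        (if a = d then -(-1 : ℤ) ^ (pe b * pe c) else 0) •
          (J c d * pd' a (J b e)) • leftMul ε.toLinearMap e s +
        (-1 : ℤ) ^ (pe b * (pe c + 1)) • J c d • leftMul ε.toLinearMap d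
          ((-1 : ℤ) ^ (pe e + 1 + pe a * (pe b + pe e)) •
            pd' a (J b e) • contr ε a (leftMul ε.toLinearMap e s)) := by
      intro e a d
      have hd := h'.hom_pd a (hJ b e)
      rw [leftMul_smul hs, contr_smul, ← AlgHom.mul_apply, ← pow_add, IsSuperComm.hom_pow (hJ c d),
        leftMul_comm hs e d, map_zsmul, contr_leftMul hs, map_zsmul, leftMul_smul hs,
        IsSuperComm.hom_pow hd]
      simp only [smul_assoc, smul_comm (_ : S) (_ : ℤ), smul_add]
      simp only [smul_smul (_ : S) (_ : S)]
      rw [hs.hom_mul_hom_comm hd (hJ c d)]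
      simp only [smul_assoc, smul_smul (_ : ℤ) (_ : ℤ), ← pow_add]
      congr 1
      · split_ifs with had
        · subst had
          rw [← neg_one_mul ((-1 : ℤ) ^ _), ← pow_succ']
          congr 1
          simp only [← pow_add]
          refine sign_congr ?_
          push_cast
          generalize (pe a : ZMod 2) = a, (pe b : ZMod 2) = b, (pe c : ZMod 2) = c,
            (pe e : ZMod 2) = e
          decide +revert
        · simp
      · congr 1
        refine sign_congr ?_
        push_cast
        generalize (pe a : ZMod 2) = a, (pe b : ZMod 2) = b, (pe c : ZMod 2) = c,
          (pe d : ZMod 2) = d, (pe e : ZMod 2) = e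
        decide +revert
    simp only [map_sum (leftMulRow ε J c)]
    simp only [leftMulRow_apply (a := c), map_sum, Finset.smul_sum, e3, Finset.sum_add_distrib,
      Finset.sum_smul]
    congr 1
    · rw [← Finset.sum_neg_distrib]
      refine Finset.sum_congr rfl fun e _ => ?_
      rw [← Finset.sum_neg_distrib]
      refine Finset.sum_congr rfl fun a _ => ?_
      rw [Finset.sum_eq_single a]
      · simp
      · intro d _ hd
        simp [hd.symm]
      · simp
  -- The two vector fields supercommute, so the extra terms in `e1` and `e2` cancel.
  have e4 : ∑ e, (∑ d, J b d * pd' d (J c e)) • leftMul ε.toLinearMap e s =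
      (-1 : ℤ) ^ (pe b * pe c) • ∑ e, (∑ d, J c d * pd' d (J b e)) •
        leftMul ε.toLinearMap e s := by
    rw [Finset.smul_sum]
    refine Finset.sum_congr rfl fun e _ => ?_
    rw [hbc, smul_assoc]
  rw [lieOp, lieOp, e1, e2, map_add, smul_add, e4]
  rw [add_add_add_comm, add_neg_cancel, zero_add]

/-- The Lie derivative of a multiple of the generator of the Berezinian sheaf. -/
lemma lieOp_single_one (hs : IsSuperComm ε) (b : Fin p ⊕ Fin q) (g : S) :
    lieOp ε pd' J b (Finsupp.single (∅, 0) g) = Finsupp.single (∅, 0)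
      (∑ c, J b c * pd' c g + ∑ c, (-1 : ℤ) ^ (pe c * (pe b + 1)) • (pd' c (J b c) * g)) := by
  have e : ∀ c a : Fin p ⊕ Fin q, contr ε a (leftMul ε.toLinearMap c (Finsupp.single (∅, 0) g)) =
      if a = c then (-1 : ℤ) ^ (pe a + 1) • Finsupp.single (∅, 0) g else 0 := fun c a => by
    rw [contr_leftMul hs, contr_single_one, map_zero, smul_zero, add_zero, ite_smul, zero_smul]
  simp only [lieOp, e, smul_ite, smul_zero, Finset.sum_ite_eq', Finset.mem_univ, if_true,
    coeffMap_single, Finsupp.smul_single, Finsupp.single_add, Finsupp.single_finsetSum, smul_eq_mul]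
  congr 1
  refine Finset.sum_congr rfl fun c _ => ?_
  simp only [mul_smul_comm, smul_smul, ← pow_add]
  congr 2
  refine sign_congr ?_
  push_cast
  generalize (pe b : ZMod 2) = b, (pe c : ZMod 2) = c
  decide +revert

include h h' in
/-- Transition functions intertwine coordinate vector fields and Lie derivatives. -/
lemma subst_pd (hJx : ∀ a b, J a b = pd a (x' b)) (hch : ∀ a f, pd a f = ∑ b, J a b * pd' b f)
    {β : S} (hβ : ε β = β)
    (hβ' : ∀ b, pd b β = -∑ c, (-1 : ℤ) ^ (pe c * (pe b + 1)) • (pd' c (J b c) * β))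
    (hJ : IsEvenMatrix ε J) (b : Fin p ⊕ Fin q) (s : Mon p q →₀ S) :
    β • subst ε.toLinearMap J (coeffMap (pd b) s) =
      lieOp ε pd' J b (β • subst ε.toLinearMap J s) := by
  have hs := h.toIsSuperComm
  have hbb : ∀ k, (ε ^ k) β = β := fun k => by
    induction k with
    | zero => rfl
    | succ k ih => rw [pow_succ, AlgHom.mul_apply, hβ, ih]
  have hm : ∀ c t, leftMulRow ε J c (β • t) = β • leftMulRow ε J c t := fun c t => by
    rw [leftMulRow_smul hs hJ, hbb]
  induction s using polyField_induction hs with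
  | add s t hs ht => simp only [map_add, smul_add, lieOp_add, hs, ht]
  -- Here the first sum of the Lie derivative is `∂_b (β f)` by the chain rule. Its term `(∂_b β) f`
  -- cancels the divergence sum by `hβ'`.
  | base f =>
    rw [coeffMap_single, subst_single_one, subst_single_one, Finsupp.smul_single,
      Finsupp.smul_single, lieOp_single_one hs, smul_eq_mul, smul_eq_mul,
      ← hch, h.leibniz, hβ', hbb, neg_mul, Finset.sum_mul]
    congr 1
    simp only [smul_mul_assoc, mul_assoc]
    abel
  | mul c s ih =>
    rw [h.pd_leftMul, map_zsmul, subst_leftMul hs hJ, subst_leftMul hs hJ, smul_comm, ← hm, ← hm,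
      ih, lieOp_leftMulRow h' hJ]
    -- By the chain rule the rows of `J` are the coordinate fields `∂_b`, so their commutation is
    -- the symmetry of second derivatives applied to `x'_e`.
    intro e
    rw [← hch, ← hch, hJx, hJx, h.pd_comm]

include h h' in
/-- The differential of integral forms does not depend on the coordinates. -/
theorem delta_transition (hJx : ∀ a b, J a b = pd a (x' b))
    (hch : ∀ a f, pd a f = ∑ b, J a b * pd' b f) {β : S} (hβ : ε β = β)
    (hβ' : ∀ b, pd b β = -∑ c, (-1 : ℤ) ^ (pe c * (pe b + 1)) • (pd' c (J b c) * β))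
    (hJ : IsEvenMatrix ε J) (s : Mon p q →₀ S) :
    coordDelta ε.toLinearMap pd' (β • subst ε.toLinearMap J s) =
      β • subst ε.toLinearMap J (coordDelta ε.toLinearMap pd s) := by
  have hs := h.toIsSuperComm
  have hbb : ∀ k, (ε ^ k) β = β := fun k => by
    induction k with
    | zero => rfl
    | succ k ih => rw [pow_succ, AlgHom.mul_apply, hβ, ih]
  have hm : ∀ c t, leftMulRow ε J c (β • t) = β • leftMulRow ε J c t := fun c t => by
    rw [leftMulRow_smul hs hJ, hbb]
  have hpar : ∀ s, parOp ε (β • subst ε.toLinearMap J s) =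
      β • subst ε.toLinearMap J (parOp ε s) := by
    intro s
    induction s using polyField_induction hs with
    | add s t hs ht => simp only [map_add, smul_add, hs, ht]
    | base f =>
      simp only [subst_single_one, parOp_single, Finsupp.smul_single, smul_eq_mul, map_mul, hβ,
        mul_smul_comm]
    | mul c s ih =>
      rw [subst_leftMul hs hJ, ← hm, parOp_leftMul hs, map_zsmul, subst_leftMul hs hJ, smul_comm,
        ← hm, ← ih, leftMulRow_apply, leftMulRow_apply, map_sum, Finset.smul_sum]
      refine Finset.sum_congr rfl fun b _ => ?_
      rw [parOp_smul, parOp_leftMul hs, hJ c b, smul_assoc, smul_comm (_ : S) (_ : ℤ), smul_smul,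
        ← pow_add]
      congr 1
      refine sign_congr ?_
      push_cast
      generalize (pe b : ZMod 2) = b, (pe c : ZMod 2) = c
      decide +revert
  induction s using polyField_induction hs with
  | add s t hs ht => simp only [map_add, smul_add, hs, ht]
  -- Both sides vanish: there is no `π∂` to contract.
  | base f =>
    rw [subst_single_one, Finsupp.smul_single, h.coordDelta_eq, h'.coordDelta_eq]
    simp only [parOp_single, map_zsmul, coeffMap_single, contr_single_one, smul_zero]
    simp only [smul_zero,
      Finset.sum_const_zero, neg_zero, map_zero]
  -- Cartan's formula in both coordinate systems leaves exactly the compatibility of `∂_c` with its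
  -- Lie derivative.
  | mul c s ih =>
    rw [subst_leftMul hs hJ, ← hm, delta_leftMulRow h' hJ, ih, h.delta_leftMul, map_sub, smul_sub,
      subst_leftMul hs hJ, ← hm, hpar, ← subst_pd h h' hJx hch hβ hβ' hJ]

end Invariance

/-! ## Determinants of even matrices -/

section EvenDet

variable {𝕜 : Type u} [RCLike 𝕜] {S : Type u} [Ring S] [Algebra 𝕜 S] {ε : S →ₐ[𝕜] S}

/-- Matrices all of whose entries are homogeneous of parity `k`. -/
def HomMatrix (ε : S →ₐ[𝕜] S) (k : ℕ) {m n : Type*} (A : Matrix m n S) : Prop :=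
  ∀ i j, IsHom ε k (A i j)

lemma HomMatrix.mul {k l : ℕ} {m n o : Type*} [Fintype n] {A : Matrix m n S} {B : Matrix n o S}
    (hA : HomMatrix ε k A) (hB : HomMatrix ε l B) : HomMatrix ε (k + l) (A * B) := fun i j => by
  rw [Matrix.mul_apply]
  exact IsHom.sum fun c _ => (hA i c).mul (hB c j)

lemma HomMatrix.add {k : ℕ} {m n : Type*} {A B : Matrix m n S}
    (hA : HomMatrix ε k A) (hB : HomMatrix ε k B) : HomMatrix ε k (A + B) := fun i j => by
  have h1 := hA i j
  have h2 := hB i j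
  unfold IsHom at *
  rw [Matrix.add_apply, map_add, h1, h2, smul_add]

lemma HomMatrix.neg {k : ℕ} {m n : Type*} {A : Matrix m n S}
    (hA : HomMatrix ε k A) : HomMatrix ε k (-A) := fun i j => by
  have h1 := hA i j
  unfold IsHom at *
  rw [Matrix.neg_apply, map_neg, h1, smul_neg]

lemma HomMatrix.congr {k l : ℕ} {m n : Type*} {A : Matrix m n S}
    (hA : HomMatrix ε k A) (hkl : Even k ↔ Even l) : HomMatrix ε l A :=
  fun i j => (hA i j).congr hkl

lemma HomMatrix.one {m : Type*} [DecidableEq m] : HomMatrix ε 0 (1 : Matrix m m S) := fun i j => by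
  unfold IsHom
  rcases eq_or_ne i j with rfl | hij
  · simp
  · simp [hij]

lemma isHom_zero_iff {f : S} : IsHom ε 0 f ↔ ε f = f := by
  simp [IsHom]

/-- The commutative subalgebra of even elements. -/
def evenPart (ε : S →ₐ[𝕜] S) : Subalgebra 𝕜 S := AlgHom.equalizer ε (AlgHom.id 𝕜 S)

/-- The even elements of a supercommutative algebra commute. -/
abbrev evenCommRing (h : IsSuperComm ε) : CommRing (evenPart ε) :=
  { (inferInstance : Ring (evenPart ε)) with
    mul_comm := fun f g => Subtype.ext (h.even_comm f.1 g.1 f.2) }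

/-- Lifting even matrices to the commutative ring `evenPart ε` makes the usual theory of
determinants applicable, through `leibnizDet_map`. -/
lemma HomMatrix.exists_lift {m n : Type*} {A : Matrix m n S} (hA : HomMatrix ε 0 A) :
    ∃ A' : Matrix m n (evenPart ε), A = A'.map Subtype.val :=
  ⟨fun i j => ⟨A i j, isHom_zero_iff.1 (hA i j)⟩, rfl⟩

lemma homMatrix_map_val {m n : Type*} (A : Matrix m n (evenPart ε)) :
    HomMatrix ε 0 (A.map Subtype.val) :=
  fun i j => isHom_zero_iff.2 (A i j).2

lemma map_val_mul (h : IsSuperComm ε) {m n o : Type*} [Fintype n] (A : Matrix m n (evenPart ε))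
    (B : Matrix n o (evenPart ε)) :
    letI := evenCommRing h
    (A * B).map Subtype.val = A.map Subtype.val * B.map Subtype.val := by
  ext i j
  simp only [Matrix.map_apply, Matrix.mul_apply]
  exact map_sum (evenPart ε).val _ _

lemma map_val_one (h : IsSuperComm ε) {m : Type*} [DecidableEq m] :
    letI := evenCommRing h
    (1 : Matrix m m (evenPart ε)).map Subtype.val = 1 := by
  ext i j
  rcases eq_or_ne i j with rfl | hij
  · simp
  · simp [hij]

lemma leibnizDet_map (h : IsSuperComm ε) {n : ℕ} (A : Matrix (Fin n) (Fin n) (evenPart ε)) :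
    letI := evenCommRing h
    leibnizDet (A.map Subtype.val) = (A.det : S) := by
  let := evenCommRing h
  rw [Matrix.det_apply, leibnizDet]
  refine Eq.trans (Finset.sum_congr rfl fun σ _ => ?_) (map_sum (evenPart ε).val _ _).symm
  rw [← List.prod_ofFn]
  change _ = (evenPart ε).val (((Equiv.Perm.sign σ : ℤˣ) : ℤ) • _)
  rw [map_zsmul, map_list_prod, List.map_ofFn]
  rfl

lemma pow_apply_even {f : S} (hf : ε f = f) (k : ℕ) : (ε ^ k) f = f := by
  induction k with
  | zero => rfl
  | succ k ih => rw [pow_succ, AlgHom.mul_apply, hf, ih]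

variable (h : IsSuperComm ε)
include h

lemma leibnizDet_even {n : ℕ} {A : Matrix (Fin n) (Fin n) S} (hA : HomMatrix ε 0 A) :
    ε (leibnizDet A) = leibnizDet A := by
  obtain ⟨A, rfl⟩ := hA.exists_lift
  rw [leibnizDet_map h]
  exact Subtype.prop (p := fun f => ε f = f) _

lemma leibnizDet_mul {n : ℕ} {A B : Matrix (Fin n) (Fin n) S} (hA : HomMatrix ε 0 A)
    (hB : HomMatrix ε 0 B) : leibnizDet (A * B) = leibnizDet A * leibnizDet B := by
  let := evenCommRing h
  obtain ⟨A, rfl⟩ := hA.exists_lift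
  obtain ⟨B, rfl⟩ := hB.exists_lift
  rw [← map_val_mul h, leibnizDet_map h, leibnizDet_map h, leibnizDet_map h, Matrix.det_mul]
  rfl

lemma leibnizDet_one {n : ℕ} : leibnizDet (1 : Matrix (Fin n) (Fin n) S) = 1 := by
  let := evenCommRing h
  rw [← map_val_one h, leibnizDet_map h, Matrix.det_one]
  rfl

/-- Inverses of even matrices whose determinant is invertible. -/
lemma exists_inverse_of_leibnizDet {n : ℕ} {A : Matrix (Fin n) (Fin n) S} (hA : HomMatrix ε 0 A)
    {c : S} (hc : ε c = c) (hAc : leibnizDet A * c = 1) :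
    ∃ B, HomMatrix ε 0 B ∧ A * B = 1 ∧ B * A = 1 := by
  let := evenCommRing h
  obtain ⟨A, rfl⟩ := hA.exists_lift
  rw [leibnizDet_map h] at hAc
  have hu : IsUnit A.det :=
    IsUnit.of_mul_eq_one (⟨c, hc⟩ : evenPart ε) (Subtype.ext hAc)
  refine ⟨A⁻¹.map Subtype.val, homMatrix_map_val _, ?_, ?_⟩
  · rw [← map_val_mul h, Matrix.mul_nonsing_inv _ hu, map_val_one h]
  · rw [← map_val_mul h, Matrix.nonsing_inv_mul _ hu, map_val_one h]

/-- The rank-one case `det(1 + u vᵀ) = 1 + vᵀ u` with `v` a standard basis vector; with its row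
version it handles the changes of a single entry below. -/
lemma leibnizDet_one_add_col {n : ℕ} (i : Fin n) {u : Fin n → S} (hu : ∀ j, ε (u j) = u j) :
    leibnizDet (1 + Matrix.of fun j k => if k = i then u j else 0) = 1 + u i := by
  let := evenCommRing h
  let u' : Fin n → evenPart ε := fun j => ⟨u j, hu j⟩
  have := Matrix.det_one_add_replicateCol_mul_replicateRow (ι := Unit) u' (Pi.single i 1)
  rw [single_one_dotProduct] at this
  have h2 := congrArg (Subtype.val : evenPart ε → S) this
  rw [← leibnizDet_map h] at h2
  refine Eq.trans ?_ h2
  congr 1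
  ext j k
  simp only [Matrix.add_apply, Matrix.map_apply, Matrix.of_apply, Matrix.mul_apply,
    Matrix.replicateCol_apply, Matrix.replicateRow_apply, Finset.univ_unique, Finset.sum_singleton]
  by_cases hjk : j = k <;> by_cases hki : k = i <;>
    simp [Matrix.one_apply, hjk, hki, eq_comm, u'] <;> split_ifs <;> simp

lemma leibnizDet_one_add_row {n : ℕ} (i : Fin n) {u : Fin n → S} (hu : ∀ j, ε (u j) = u j) :
    leibnizDet (1 + Matrix.of fun k j => if k = i then u j else 0) = 1 + u i := by
  let := evenCommRing h
  let u' : Fin n → evenPart ε := fun j => ⟨u j, hu j⟩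
  have := Matrix.det_one_add_replicateCol_mul_replicateRow (ι := Unit) (Pi.single i 1) u'
  rw [dotProduct_single_one] at this
  have h2 := congrArg (Subtype.val : evenPart ε → S) this
  rw [← leibnizDet_map h] at h2
  refine Eq.trans ?_ h2
  congr 1
  ext k j
  simp only [Matrix.add_apply, Matrix.map_apply, Matrix.of_apply, Matrix.mul_apply,
    Matrix.replicateCol_apply, Matrix.replicateRow_apply, Finset.univ_unique, Finset.sum_singleton]
  by_cases hjk : j = k <;> by_cases hki : k = i <;>
    simp [Matrix.one_apply, hjk, hki, u'] <;> split_ifs <;> simp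

lemma odd_mul_self {f : S} (hf : IsHom ε 1 f) : f * f = 0 := by
  have := h.hom_mul_hom_comm hf hf
  simp only [mul_one, pow_one, neg_smul, one_smul] at this
  have h2 := add_eq_zero_iff_eq_neg.2 this
  rw [← two_smul 𝕜] at h2
  exact (smul_eq_zero.1 h2).resolve_left two_ne_zero

lemma even_one_add_mul {m n : ℕ} {X : Matrix (Fin m) (Fin n) S}
    {Y : Matrix (Fin n) (Fin m) S} (hX : HomMatrix ε 1 X) (hY : HomMatrix ε 1 Y) :
    HomMatrix ε 0 (1 + X * Y) :=
  HomMatrix.one.add ((hX.mul hY).congr (by decide))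

/-- For odd matrices `X`, `Y` one has `det (1 + XY) = det (1 + YX)⁻¹`. -/
lemma leibnizDet_one_add_mul_comm {m n : ℕ} {X : Matrix (Fin m) (Fin n) S}
    {Y : Matrix (Fin n) (Fin m) S} (hX : HomMatrix ε 1 X) (hY : HomMatrix ε 1 Y) :
    leibnizDet (1 + X * Y) * leibnizDet (1 + Y * X) = 1 := by
  -- The matrix `Y` is built up one entry at a time. Adding an entry `y` to `Y₁` multiplies the two
  -- determinants by those of `1 + Z E` and `1 + E Z`, where `E` has the only entry `y` and `Z = (1
  -- + X Y₁)⁻¹ X`.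
  suffices H : ∀ (s : Finset (Fin n × Fin m)) (X : Matrix (Fin m) (Fin n) S), HomMatrix ε 1 X →
      leibnizDet (1 + X * ∑ a ∈ s, Matrix.single a.1 a.2 (Y a.1 a.2)) *
        leibnizDet (1 + (∑ a ∈ s, Matrix.single a.1 a.2 (Y a.1 a.2)) * X) = 1 by
    have hsum : ∑ a : Fin n × Fin m, Matrix.single a.1 a.2 (Y a.1 a.2) = Y := by
      rw [Fintype.sum_prod_type]
      exact (Matrix.matrix_eq_sum_single Y).symm
    have := H Finset.univ X hX
    rwa [hsum] at this
  have hs : ∀ a : Fin n × Fin m, HomMatrix ε 1 (Matrix.single a.1 a.2 (Y a.1 a.2)) := by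
    intro a i j
    unfold IsHom
    rw [Matrix.single_apply]
    split_ifs with hij
    · exact hY a.1 a.2
    · simp
  intro s
  induction s using Finset.induction_on with
  | empty =>
    intro X hX
    simp [leibnizDet_one h]
  | insert a s ha ih =>
    intro X hX
    have hY1 : HomMatrix ε 1 (∑ a ∈ s, Matrix.single a.1 a.2 (Y a.1 a.2)) := by
      intro i j
      rw [Matrix.sum_apply]
      exact IsHom.sum fun a _ => hs a i j
    rw [Finset.sum_insert ha, add_comm (Matrix.single _ _ _)]
    have hYX := ih X hX
    set Y1 := ∑ a ∈ s, Matrix.single a.1 a.2 (Y a.1 a.2)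
    have hy := hY a.1 a.2
    set y := Y a.1 a.2
    have hM := even_one_add_mul h hX hY1
    have hN := even_one_add_mul h hY1 hX
    obtain ⟨M, hM0, hM1, hM2⟩ := exists_inverse_of_leibnizDet h hM (leibnizDet_even h hN) hYX
    obtain ⟨N, hN0, hN1, hN2⟩ := exists_inverse_of_leibnizDet h hN (leibnizDet_even h hM)
      (by rw [h.even_comm _ _ (leibnizDet_even h hN)]; exact hYX)
    -- The push-through identity `(1 + X Y₁)⁻¹ X = X (1 + Y₁ X)⁻¹`.
    have e : M * X = X * N := by
      have : (1 + X * Y1) * X = X * (1 + Y1 * X) := by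
        rw [Matrix.add_mul, Matrix.mul_add, Matrix.one_mul, Matrix.mul_one, Matrix.mul_assoc]
      calc M * X = M * (X * (1 + Y1 * X)) * N := by
            rw [Matrix.mul_assoc, Matrix.mul_assoc X, hN1, Matrix.mul_one]
        _ = X * N := by rw [← this, ← Matrix.mul_assoc, hM2, Matrix.one_mul]
    have hX' : HomMatrix ε 1 (M * X) := (hM0.mul hX).congr (by decide)
    have e1 : 1 + X * (Y1 + Matrix.single a.1 a.2 y) =
        (1 + X * Y1) * (1 + M * X * Matrix.single a.1 a.2 y) := by
      rw [Matrix.mul_add (1 + X * Y1), Matrix.mul_one, Matrix.mul_assoc M,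
        ← Matrix.mul_assoc (1 + X * Y1), hM1, Matrix.one_mul, Matrix.mul_add, add_assoc]
    have e2 : 1 + (Y1 + Matrix.single a.1 a.2 y) * X =
        (1 + Matrix.single a.1 a.2 y * (M * X)) * (1 + Y1 * X) := by
      rw [e, Matrix.add_mul (1 : Matrix (Fin n) (Fin n) S) _ (1 + Y1 * X), Matrix.one_mul,
        Matrix.mul_assoc, Matrix.mul_assoc X, hN2,
        Matrix.mul_one, Matrix.add_mul, add_assoc]
    rw [e1, e2, leibnizDet_mul h hM (even_one_add_mul h hX' (hs a)),
      leibnizDet_mul h (even_one_add_mul h (hs a) hX') hN, mul_assoc,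
      ← mul_assoc (leibnizDet (1 + M * X * Matrix.single a.1 a.2 y))]
    suffices H : leibnizDet (1 + M * X * Matrix.single a.1 a.2 y) *
        leibnizDet (1 + Matrix.single a.1 a.2 y * (M * X)) = 1 by
      rw [H, one_mul, hYX]
    generalize M * X = Z at hX'
    have e3 : Z * Matrix.single a.1 a.2 y =
        Matrix.of fun j k => if k = a.2 then Z j a.1 * y else 0 := by
      ext j k
      rcases eq_or_ne k a.2 with rfl | hk
      · simp
      · simp [hk]
    have e4 : Matrix.single a.1 a.2 y * Z =
        Matrix.of fun k j => if k = a.1 then y * Z a.2 j else 0 := by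
      ext k j
      rcases eq_or_ne k a.1 with rfl | hk
      · simp
      · simp [hk]
    have hev : ∀ f g, IsHom ε 1 f → IsHom ε 1 g → ε (f * g) = f * g := fun f g hf hg =>
      isHom_zero_iff.1 ((hf.mul hg).congr (by decide))
    rw [e3, e4, leibnizDet_one_add_col h _ fun j => hev _ _ (hX' _ _) hy,
      leibnizDet_one_add_row h _ fun j => hev _ _ hy (hX' _ _)]
    -- For odd `z`, `y` one has `(1 + zy)(1 + yz) = (1 - yz)(1 + yz) = 1`, since `yzyz = 0`.
    have h1 := h.hom_mul_hom_comm (hX' a.2 a.1) hy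
    simp only [mul_one, pow_one, neg_smul, one_smul] at h1
    rw [h1, mul_add, add_mul, add_mul, mul_one, one_mul, mul_one, neg_mul,
      mul_assoc y, ← mul_assoc (Z a.2 a.1), h1, neg_mul, mul_assoc y, odd_mul_self h (hX' _ _)]
    simp

-- The cofactors in the shape in which they appear when the Leibniz formula is differentiated: one
-- factor removed from each product, grouped by the entry it came from.
omit h in
lemma prod_erase_updateRow {R : Type*} [CommRing R] {n : ℕ} (A : Matrix (Fin n) (Fin n) R)
    (k j : Fin n) :
    A.adjugate k j = ∑ σ : Equiv.Perm (Fin n), if σ k = j then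
      ((Equiv.Perm.sign σ : ℤˣ) : ℤ) • ∏ i ∈ Finset.univ.erase k, A (σ i) i else 0 := by
  rw [Matrix.adjugate_apply, Matrix.det_apply]
  refine Finset.sum_congr rfl fun σ _ => ?_
  rw [Units.smul_def]
  split_ifs with hσ
  · subst hσ
    rw [← Finset.mul_prod_erase _ _ (Finset.mem_univ k)]
    simp only [Matrix.updateRow_self, Pi.single_eq_same, one_mul]
    congr 1
    refine Finset.prod_congr rfl fun i hi => ?_
    rw [Matrix.updateRow_ne]
    exact fun e => Finset.ne_of_mem_erase hi (σ.injective e)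
  · rw [Finset.prod_eq_zero (Finset.mem_univ (σ.symm j)), smul_zero]
    rw [Equiv.apply_symm_apply, Matrix.updateRow_self, Pi.single_eq_of_ne]
    rintro rfl
    simp at hσ

/-- Jacobi's formula for superderivations. -/
lemma derivation_leibnizDet {d : S →ₗ[𝕜] S} {k : ℕ}
    (hd : ∀ f g, d (f * g) = d f * g + (ε ^ k) f * d g)
    {n : ℕ} {A B : Matrix (Fin n) (Fin n) S} (hA : HomMatrix ε 0 A) (hB : HomMatrix ε 0 B)
    (hAB : A * B = 1) :
    d (leibnizDet A) = (∑ i, ∑ j, B i j * d (A j i)) * leibnizDet A := by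
  let := evenCommRing h
  have hpow : ∀ f : evenPart ε, (ε ^ k) (f : S) = f := fun f => pow_apply_even f.2 k
  have hd1 : d 1 = 0 := by
    have := hd 1 1
    simpa using this
  -- All factors are even, so `d` passes them without a twist and the differentiated factor can be
  -- moved to the right.
  have hprod : ∀ (s : Finset (Fin n)) (f : Fin n → evenPart ε), d ((∏ i ∈ s, f i : evenPart ε) : S) =
      ∑ l ∈ s, ((∏ i ∈ s.erase l, f i : evenPart ε) : S) * d (f l) := by
    intro s f
    induction s using Finset.induction_on with
    | empty => simpa using hd1
    | insert a s ha ih =>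
      rw [Finset.prod_insert ha, Finset.sum_insert ha, Finset.erase_insert ha]
      change d ((f a : S) * ((∏ i ∈ s, f i : evenPart ε) : S)) = _
      rw [hd, ih, hpow, h.even_comm _ (d (f a)) (∏ i ∈ s, f i : evenPart ε).2, Finset.mul_sum]
      congr 1
      refine Finset.sum_congr rfl fun l hl => ?_
      have hla : l ≠ a := fun e => ha (e ▸ hl)
      rw [Finset.erase_insert_of_ne hla.symm, Finset.prod_insert (by simp [ha]), ← mul_assoc]
      rfl
  obtain ⟨A, rfl⟩ := hA.exists_lift
  obtain ⟨B, rfl⟩ := hB.exists_lift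
  rw [leibnizDet_map h]
  have hAB' : A * B = 1 := by
    have h2 := hAB
    rw [← map_val_mul h, ← map_val_one h] at h2
    exact Matrix.map_injective Subtype.val_injective h2
  have hadj : ∀ i j, ((A.adjugate i j : evenPart ε) : S) = B i j * (A.det : evenPart ε) := by
    have : A.adjugate = A.det • B := by
      rw [← Matrix.mul_one A.adjugate, ← hAB', ← Matrix.mul_assoc, Matrix.adjugate_mul,
        Matrix.smul_mul, Matrix.one_mul]
    intro i j
    rw [this, Matrix.smul_apply, smul_eq_mul, mul_comm]
    rfl
  have hdet : d ((A.det : evenPart ε) : S) =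
      ∑ i, ∑ j, ((A.adjugate i j : evenPart ε) : S) * d (A j i) := by
    have hcoe : ∀ (f : Equiv.Perm (Fin n) → evenPart ε), ((∑ σ, f σ : evenPart ε) : S) =
        ∑ σ, (f σ : S) := fun f => map_sum (evenPart ε).val _ _
    have hcoe2 : ∀ (z : ℤ) (f : evenPart ε), ((z • f : evenPart ε) : S) = z • (f : S) :=
      fun z f => map_zsmul (evenPart ε).val _ _
    simp only [prod_erase_updateRow, hcoe, Finset.sum_mul]
    rw [Matrix.det_apply, hcoe, map_sum]
    simp only [Units.smul_def, hcoe2, map_zsmul, hprod, Finset.smul_sum]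
    rw [Finset.sum_comm]
    refine Finset.sum_congr rfl fun i _ => ?_
    rw [Finset.sum_comm]
    refine Finset.sum_congr rfl fun σ _ => ?_
    rw [Finset.sum_eq_single (σ i)]
    · rw [if_pos rfl, hcoe2, smul_mul_assoc]
    · intro j _ hj
      rw [if_neg hj.symm]
      simp
    · simp
  rw [hdet, Finset.sum_mul]
  refine Finset.sum_congr rfl fun i _ => ?_
  rw [Finset.sum_mul]
  refine Finset.sum_congr rfl fun j _ => ?_
  rw [hadj, mul_assoc, h.even_comm _ (d _) (A.det : evenPart ε).2, ← mul_assoc]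
  rfl

end EvenDet

/-! ## The Berezinian -/

section Berezinian

variable {p q : ℕ} {𝕜 : Type u} [RCLike 𝕜] {S : Type u} [Ring S] [Algebra 𝕜 S]
  {ε : S →ₐ[𝕜] S}

lemma ringInverse_eq {R : Type*} [Ring R] {a b : R} (hab : a * b = 1) (hba : b * a = 1) :
    Ring.inverse a = b :=
  Ring.inverse_unit ⟨a, b, hab, hba⟩

/-- The supermatrix `(1 X; 0 1) (P 0; 0 D) (1 0; Y 1)`. -/
def udl (X : Matrix (Fin p) (Fin q) S) (P : Matrix (Fin p) (Fin p) S)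
    (D : Matrix (Fin q) (Fin q) S) (Y : Matrix (Fin q) (Fin p) S) :
    Matrix (Fin p ⊕ Fin q) (Fin p ⊕ Fin q) S :=
  Matrix.fromBlocks (P + X * D * Y) (X * D) (D * Y) D

lemma berezinian_udl (X : Matrix (Fin p) (Fin q) S) (P : Matrix (Fin p) (Fin p) S)
    {D D' : Matrix (Fin q) (Fin q) S} (Y : Matrix (Fin q) (Fin p) S) (hD : D * D' = 1)
    (hD' : D' * D = 1) : berezinian (udl X P D Y) = leibnizDet P * leibnizDet D' := by
  rw [berezinian, udl, Matrix.toBlocks_fromBlocks₁₁, Matrix.toBlocks_fromBlocks₁₂,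
    Matrix.toBlocks_fromBlocks₂₁, Matrix.toBlocks_fromBlocks₂₂, ringInverse_eq hD hD',
    Matrix.mul_assoc X D D', hD, Matrix.mul_one, Matrix.mul_assoc X D Y, add_sub_cancel_right]

/-- The inner factors `(1 0; Y₁ 1)(1 X₂; 0 1)` must be refactored with the upper triangular one on
the left: the new pivot is `Q = 1 + Y₁ X₂`, and its Schur complement is `1 - X₂ Q⁻¹ Y₁`. -/
lemma udl_mul {X₁ X₂ : Matrix (Fin p) (Fin q) S} {P₁ P₂ : Matrix (Fin p) (Fin p) S}
    {D₁ D₁' D₂ D₂' Q Q' : Matrix (Fin q) (Fin q) S} {Y₁ Y₂ : Matrix (Fin q) (Fin p) S}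
    (h₁ : D₁' * D₁ = 1) (h₂ : D₂ * D₂' = 1) (hQ : Q = 1 + Y₁ * X₂) (hQ₁ : Q * Q' = 1)
    (hQ₂ : Q' * Q = 1) :
    udl X₁ P₁ D₁ Y₁ * udl X₂ P₂ D₂ Y₂ = udl (X₁ + P₁ * X₂ * Q' * D₁')
      (P₁ * (1 - X₂ * Q' * Y₁) * P₂) (D₁ * Q * D₂) (D₂' * Q' * Y₁ * P₂ + Y₂) := by
  have c₁ : ∀ M : Matrix (Fin q) (Fin q) S, D₁' * (D₁ * M) = M := fun M => by
    rw [← Matrix.mul_assoc, h₁, Matrix.one_mul]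
  have c₂ : ∀ M : Matrix (Fin q) (Fin p) S, D₂ * (D₂' * M) = M := fun M => by
    rw [← Matrix.mul_assoc, h₂, Matrix.one_mul]
  have c₃ : ∀ M : Matrix (Fin q) (Fin p) S, Q * (Q' * M) = M := fun M => by
    rw [← Matrix.mul_assoc, hQ₁, Matrix.one_mul]
  have c₄ : ∀ M : Matrix (Fin q) (Fin q) S, Q' * (Q * M) = M := fun M => by
    rw [← Matrix.mul_assoc, hQ₂, Matrix.one_mul]
  have d₁ : (X₁ + P₁ * X₂ * Q' * D₁') * (D₁ * Q * D₂) = X₁ * D₁ * Q * D₂ + P₁ * X₂ * D₂ := by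
    simp only [Matrix.add_mul, Matrix.mul_assoc, c₁, c₄]
  have d₂ : D₁ * Q * D₂ * (D₂' * Q' * Y₁ * P₂ + Y₂) = D₁ * Y₁ * P₂ + D₁ * Q * D₂ * Y₂ := by
    simp only [Matrix.mul_add, Matrix.mul_assoc, c₂, c₃]
  have d₃ : (X₁ + P₁ * X₂ * Q' * D₁') * (D₁ * Q * D₂) * (D₂' * Q' * Y₁ * P₂ + Y₂) =
      X₁ * D₁ * Y₁ * P₂ + X₁ * D₁ * Q * D₂ * Y₂ + P₁ * X₂ * Q' * Y₁ * P₂ +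
        P₁ * X₂ * D₂ * Y₂ := by
    rw [d₁]
    simp only [Matrix.mul_add, Matrix.add_mul, Matrix.mul_assoc, c₂, c₃]
    abel
  rw [udl, udl, udl, Matrix.fromBlocks_multiply, d₃, d₁, d₂, hQ]
  congr 1
  · simp only [Matrix.mul_add, Matrix.add_mul, Matrix.mul_assoc, Matrix.mul_one,
      Matrix.mul_sub, Matrix.sub_mul]
    abel
  · simp only [Matrix.mul_add, Matrix.add_mul, Matrix.mul_assoc, Matrix.mul_one]
    abel
  · simp only [Matrix.mul_add, Matrix.add_mul, Matrix.mul_assoc, Matrix.mul_one]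
    abel
  · simp only [Matrix.mul_add, Matrix.add_mul, Matrix.mul_assoc, Matrix.mul_one]
    abel

variable (h : IsSuperComm ε)
include h

/-- For odd `X`, `Y` the determinant of `1 + XY` is automatically invertible, with inverse `det(1 +
YX)`. -/
lemma exists_inverse_one_add_mul {m n : ℕ} {X : Matrix (Fin m) (Fin n) S}
    {Y : Matrix (Fin n) (Fin m) S} (hX : HomMatrix ε 1 X) (hY : HomMatrix ε 1 Y) :
    ∃ B, HomMatrix ε 0 B ∧ (1 + X * Y) * B = 1 ∧ B * (1 + X * Y) = 1 :=
  exists_inverse_of_leibnizDet h (even_one_add_mul h hX hY)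
    (leibnizDet_even h (even_one_add_mul h hY hX)) (leibnizDet_one_add_mul_comm h hX hY)

/-- An invertible even supermatrix is a product of unitriangular and block diagonal ones. -/
lemma exists_udl {J J' : Matrix (Fin p ⊕ Fin q) (Fin p ⊕ Fin q) S} (hJ : IsEvenMatrix ε J)
    (hJ' : IsEvenMatrix ε J') (hJJ' : J * J' = 1) (hJ'J : J' * J = 1) :
    ∃ X P P' D D' Y, HomMatrix ε 1 X ∧ HomMatrix ε 0 P ∧ HomMatrix ε 0 P' ∧ HomMatrix ε 0 D ∧
      HomMatrix ε 0 D' ∧ HomMatrix ε 1 Y ∧ P * P' = 1 ∧ P' * P = 1 ∧ D * D' = 1 ∧ D' * D = 1 ∧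
      J = udl X P D Y := by
  obtain ⟨A, B, C, D, rfl⟩ : ∃ A B C D, J = Matrix.fromBlocks A B C D :=
    ⟨_, _, _, _, (Matrix.fromBlocks_toBlocks J).symm⟩
  obtain ⟨A', B', C', D', rfl⟩ : ∃ A B C D, J' = Matrix.fromBlocks A B C D :=
    ⟨_, _, _, _, (Matrix.fromBlocks_toBlocks J').symm⟩
  have hA : HomMatrix ε 0 A := fun i j => hJ (.inl i) (.inl j)
  have hB : HomMatrix ε 1 B := fun i j => hJ (.inl i) (.inr j)
  have hC : HomMatrix ε 1 C := fun i j => hJ (.inr i) (.inl j)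
  have hD : HomMatrix ε 0 D := fun i j => (hJ (.inr i) (.inr j)).congr (by simp only [pe_inr]; decide)
  have hA' : HomMatrix ε 0 A' := fun i j => hJ' (.inl i) (.inl j)
  have hB' : HomMatrix ε 1 B' := fun i j => hJ' (.inl i) (.inr j)
  have hC' : HomMatrix ε 1 C' := fun i j => hJ' (.inr i) (.inl j)
  have hD' : HomMatrix ε 0 D' := fun i j => (hJ' (.inr i) (.inr j)).congr (by simp only [pe_inr]; decide)
  rw [Matrix.fromBlocks_multiply, ← Matrix.fromBlocks_one, Matrix.fromBlocks_inj] at hJJ' hJ'J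
  obtain ⟨a₁, a₂, a₃, a₄⟩ := hJJ'
  obtain ⟨b₁, b₂, b₃, b₄⟩ := hJ'J
  -- From `CB' + DD' = 1` the product `DD' = 1 - CB'` is invertible because `C`, `B'` are odd, which
  -- gives `D` a right inverse; `D'D = 1 - C'B` gives a left inverse in the same way.
  obtain ⟨E, hE, hE1, -⟩ := exists_inverse_one_add_mul h hC.neg hB'
  obtain ⟨F, hF, -, hF2⟩ := exists_inverse_one_add_mul h hC'.neg hB
  have e₁ : D * (D' * E) = 1 := by
    rw [← Matrix.mul_assoc, ← hE1, eq_sub_of_add_eq' a₄, Matrix.neg_mul, sub_eq_add_neg]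
  have e₂ : F * D' * D = 1 := by
    rw [Matrix.mul_assoc, ← hF2, eq_sub_of_add_eq' b₄, Matrix.neg_mul, sub_eq_add_neg]
  have e₃ : F * D' = D' * E := by
    rw [← Matrix.mul_one (F * D'), ← e₁, ← Matrix.mul_assoc, e₂, Matrix.one_mul]
  rw [e₃] at e₂
  have hG : HomMatrix ε 0 (D' * E) := hD'.mul hE
  generalize D' * E = G at e₁ e₂ hG
  -- The off-diagonal blocks express `C'` and `B'` through `A'`; inserted in the first diagonal
  -- block they show that `A'` inverts the Schur complement `A - BGC`.
  have hC2 : C' = -(G * C * A') := by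
    have : D * C' = -(C * A') := by rw [eq_neg_iff_add_eq_zero, add_comm]; exact a₃
    rw [← Matrix.one_mul C', ← e₂, Matrix.mul_assoc, this, Matrix.mul_neg, Matrix.mul_assoc]
  have hB2 : B' = -(A' * B * G) := by
    have : B' * D = -(A' * B) := by rw [eq_neg_iff_add_eq_zero, add_comm]; exact b₂
    rw [← Matrix.mul_one B', ← e₁, ← Matrix.mul_assoc, this, Matrix.neg_mul]
  refine ⟨B * G, A - B * G * C, A', D, G, G * C, (hB.mul hG), ?_, hA', hD, hG,
    (hG.mul hC), ?_, ?_, e₁, e₂, ?_⟩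
  · rw [sub_eq_add_neg]
    exact hA.add (((hB.mul hG).mul hC).neg.congr (by decide))
  · rw [← a₁, hC2, Matrix.sub_mul, Matrix.mul_neg, sub_eq_add_neg]
    simp only [Matrix.mul_assoc]
  · rw [← b₁, hB2, Matrix.mul_sub, Matrix.neg_mul, sub_eq_add_neg]
    simp only [Matrix.mul_assoc]
  · rw [udl, Matrix.mul_assoc B G D, e₂, Matrix.mul_one, ← Matrix.mul_assoc D, e₁,
      Matrix.one_mul, ← Matrix.mul_assoc B, sub_add_cancel]

lemma even_leibnizDet_comm {m : ℕ} {A : Matrix (Fin m) (Fin m) S}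
    (hA : HomMatrix ε 0 A) (f : S) : leibnizDet A * f = f * leibnizDet A :=
  h.even_comm _ _ (leibnizDet_even h hA)

/-- The Berezinian is multiplicative. -/
theorem berezinian_mul {J J' K K' : Matrix (Fin p ⊕ Fin q) (Fin p ⊕ Fin q) S}
    (hJ : IsEvenMatrix ε J) (hJ' : IsEvenMatrix ε J') (hJJ' : J * J' = 1) (hJ'J : J' * J = 1)
    (hK : IsEvenMatrix ε K) (hK' : IsEvenMatrix ε K') (hKK' : K * K' = 1) (hK'K : K' * K = 1) :
    berezinian (J * K) = berezinian J * berezinian K := by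
  obtain ⟨X₁, P₁, -, D₁, D₁', Y₁, hX₁, hP₁, -, hD₁, hD₁', hY₁, -, -, hD₁D, hD₁D', rfl⟩ :=
    exists_udl h hJ hJ' hJJ' hJ'J
  obtain ⟨X₂, P₂, -, D₂, D₂', Y₂, hX₂, hP₂, -, hD₂, hD₂', hY₂, -, -, hD₂D, hD₂D', rfl⟩ :=
    exists_udl h hK hK' hKK' hK'K
  obtain ⟨Q', hQ', hQ1, hQ2⟩ := exists_inverse_one_add_mul h hY₁ hX₂
  have hR : HomMatrix ε 0 (1 - X₂ * Q' * Y₁) := by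
    rw [sub_eq_add_neg]
    exact HomMatrix.one.add (((hX₂.mul hQ').mul hY₁).neg.congr (by decide))
  have hQ := even_one_add_mul h hY₁ hX₂
  have hR1 : (1 - X₂ * Q' * Y₁) * (1 + X₂ * Y₁) = 1 := by
    have : Q' * Y₁ * (1 + X₂ * Y₁) = Y₁ := by
      have e : Y₁ * (1 + X₂ * Y₁) = (1 + Y₁ * X₂) * Y₁ := by
        rw [Matrix.mul_add, Matrix.add_mul, Matrix.mul_one, Matrix.one_mul, Matrix.mul_assoc]
      rw [Matrix.mul_assoc, e, ← Matrix.mul_assoc, hQ2, Matrix.one_mul]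
    rw [Matrix.sub_mul, Matrix.one_mul, Matrix.mul_assoc X₂, Matrix.mul_assoc X₂, this,
      add_sub_cancel_right]
  have hXY := even_one_add_mul h hX₂ hY₁
  -- `det(1 - X₂Q⁻¹Y₁) = det(1 + X₂Y₁)⁻¹ = det(1 + Y₁X₂) = det Q`: the corrections in the two blocks
  -- cancel in the Berezinian.
  have key : leibnizDet (1 - X₂ * Q' * Y₁) * leibnizDet Q' = 1 := by
    have k1 := leibnizDet_one_add_mul_comm h hX₂ hY₁
    have k2 : leibnizDet (1 - X₂ * Q' * Y₁) * leibnizDet (1 + X₂ * Y₁) = 1 := by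
      rw [← leibnizDet_mul h hR hXY, hR1, leibnizDet_one h]
    have k3 : leibnizDet (1 + Y₁ * X₂) * leibnizDet Q' = 1 := by
      rw [← leibnizDet_mul h hQ hQ', hQ1, leibnizDet_one h]
    calc _ = leibnizDet (1 - X₂ * Q' * Y₁) * (leibnizDet (1 + X₂ * Y₁) *
          leibnizDet (1 + Y₁ * X₂)) * leibnizDet Q' := by rw [k1, mul_one]
      _ = (leibnizDet (1 - X₂ * Q' * Y₁) * leibnizDet (1 + X₂ * Y₁)) *
          (leibnizDet (1 + Y₁ * X₂) * leibnizDet Q') := by simp only [mul_assoc]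
      _ = 1 := by rw [k2, k3, one_mul]
  rw [udl_mul hD₁D' hD₂D rfl hQ1 hQ2, berezinian_udl (D' := D₂' * Q' * D₁'), berezinian_udl _ _ _
    hD₁D hD₁D', berezinian_udl _ _ _ hD₂D hD₂D',
    leibnizDet_mul h (hP₁.mul hR) hP₂, leibnizDet_mul h hP₁ hR,
    leibnizDet_mul h (hD₂'.mul hQ') hD₁', leibnizDet_mul h hD₂' hQ']
  · rw [even_leibnizDet_comm h hD₂' (leibnizDet Q')]
    calc _ = leibnizDet P₁ * leibnizDet (1 - X₂ * Q' * Y₁) *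
          (leibnizDet P₂ * leibnizDet Q') * leibnizDet D₂' * leibnizDet D₁' := by
            simp only [mul_assoc]
      _ = leibnizDet P₁ * (leibnizDet (1 - X₂ * Q' * Y₁) * leibnizDet Q') *
          (leibnizDet P₂ * leibnizDet D₂') * leibnizDet D₁' := by
            rw [even_leibnizDet_comm h hP₂ (leibnizDet Q')]; simp only [mul_assoc]
      _ = _ := by
            rw [key, mul_one, mul_assoc, mul_assoc (leibnizDet P₁),
              even_leibnizDet_comm h hD₁' (leibnizDet P₂ * leibnizDet D₂')]
  · calc D₁ * (1 + Y₁ * X₂) * D₂ * (D₂' * Q' * D₁') =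
          D₁ * ((1 + Y₁ * X₂) * (D₂ * D₂') * Q') * D₁' := by simp only [Matrix.mul_assoc]
      _ = 1 := by rw [hD₂D, Matrix.mul_one, hQ1, Matrix.mul_one, hD₁D]
  · calc D₂' * Q' * D₁' * (D₁ * (1 + Y₁ * X₂) * D₂) =
          D₂' * (Q' * (D₁' * D₁) * (1 + Y₁ * X₂)) * D₂ := by simp only [Matrix.mul_assoc]
      _ = 1 := by rw [hD₁D', Matrix.mul_one, hQ2, Matrix.mul_one, hD₂D']

lemma berezinian_even {J J' : Matrix (Fin p ⊕ Fin q) (Fin p ⊕ Fin q) S}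
    (hJ : IsEvenMatrix ε J) (hJ' : IsEvenMatrix ε J') (hJJ' : J * J' = 1) (hJ'J : J' * J = 1) :
    ε (berezinian J) = berezinian J := by
  obtain ⟨X₁, P₁, -, D₁, D₁', Y₁, hX₁, hP₁, -, hD₁, hD₁', hY₁, -, -, hD₁D, hD₁D', rfl⟩ :=
    exists_udl h hJ hJ' hJJ' hJ'J
  rw [berezinian_udl _ _ _ hD₁D hD₁D', map_mul, leibnizDet_even h hP₁, leibnizDet_even h hD₁']

end Berezinian

/-! ## The logarithmic derivative of the Berezinian -/

section LogDerivative

variable {p q : ℕ} {𝕜 : Type u} [RCLike 𝕜] {S : Type u} [Ring S] [Algebra 𝕜 S]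
  {ε : S →ₐ[𝕜] S}

/-- The supertrace. -/
def str (M : Matrix (Fin p ⊕ Fin q) (Fin p ⊕ Fin q) S) : S := ∑ c, (-1 : ℤ) ^ pe c • M c c

lemma str_add (M N : Matrix (Fin p ⊕ Fin q) (Fin p ⊕ Fin q) S) :
    str (M + N) = str M + str N := by
  simp [str, Finset.sum_add_distrib]

/-- Cyclicity of the trace in the super setting: the signs `(-1)^{pe c}` compensate those of
exchanging entries, up to the twist by `ε ^ k` caused by the parity of `M`. -/
lemma str_mul_comm (h : IsSuperComm ε) {k : ℕ}
    {M N : Matrix (Fin p ⊕ Fin q) (Fin p ⊕ Fin q) S}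
    (hM : ∀ a b, IsHom ε (pe a + pe b + k) (M a b)) (hN : IsEvenMatrix ε N) :
    str (M * N) = str (N.map ⇑(ε ^ k) * M) := by
  simp only [str, Matrix.mul_apply, Finset.smul_sum, Matrix.map_apply]
  rw [Finset.sum_comm]
  refine Finset.sum_congr rfl fun d _ => Finset.sum_congr rfl fun c _ => ?_
  rw [IsSuperComm.hom_pow (hN d c), h.hom_mul_hom_comm (hM c d) (hN d c), smul_mul_assoc, smul_smul,
    smul_smul, ← pow_add, ← pow_add]
  congr 1
  refine sign_congr ?_
  push_cast
  generalize (pe d : ZMod 2) = d, (pe c : ZMod 2) = c, (k : ZMod 2) = k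
  decide +revert

variable (h : IsSuperComm ε) {d : S →ₗ[𝕜] S} {k : ℕ}
    (hd : ∀ f g, d (f * g) = d f * g + (ε ^ k) f * d g)

include hd in
lemma map_mul_derivation {l m n : Type*} [Fintype m] (A : Matrix l m S) (B : Matrix m n S) :
    (A * B).map d = A.map d * B + A.map ⇑(ε ^ k) * B.map d := by
  ext i j
  simp [Matrix.mul_apply, hd, Finset.sum_add_distrib]

lemma map_pow_mul {l m n : Type*} [Fintype m] (A : Matrix l m S) (B : Matrix m n S) :
    (A * B).map ⇑(ε ^ k) = A.map ⇑(ε ^ k) * B.map ⇑(ε ^ k) := by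
  ext i j
  simp only [Matrix.mul_apply, Matrix.map_apply, map_sum, map_mul]

lemma map_pow_one {m : Type*} [DecidableEq m] :
    (1 : Matrix m m S).map ⇑(ε ^ k) = 1 :=
  Matrix.map_one _ (map_zero _) (map_one _)

-- Additivity of the logarithmic derivative, which reduces the formula for the Berezinian to the
-- three factors of `udl`.
include h hd in
lemma str_log_mul (hdε : ∀ f, ε (d f) = (-1 : ℤ) ^ k • d (ε f))
    {J J' K K' : Matrix (Fin p ⊕ Fin q) (Fin p ⊕ Fin q) S}
    (hJ : IsEvenMatrix ε J) (hJ' : IsEvenMatrix ε J') (hJ'J : J' * J = 1)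
    (hK : IsEvenMatrix ε K) (hK' : IsEvenMatrix ε K') (hKK' : K * K' = 1) :
    str ((K' * J').map ⇑(ε ^ k) * (J * K).map d) =
      str (J'.map ⇑(ε ^ k) * J.map d) + str (K'.map ⇑(ε ^ k) * K.map d) := by
  rw [map_mul_derivation hd, map_pow_mul, Matrix.mul_add, str_add]
  have e1 : K'.map ⇑(ε ^ k) * J'.map ⇑(ε ^ k) * (J.map ⇑(ε ^ k) * K.map d) =
      K'.map ⇑(ε ^ k) * K.map d := by
    rw [Matrix.mul_assoc, ← Matrix.mul_assoc (J'.map ⇑(ε ^ k)), ← map_pow_mul, hJ'J, map_pow_one,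
      Matrix.one_mul]
  have hE : ∀ {L : Matrix (Fin p ⊕ Fin q) (Fin p ⊕ Fin q) S}, IsEvenMatrix ε L →
      IsEvenMatrix ε (L.map ⇑(ε ^ k)) := fun {L} hL a b => by
    have := hL a b
    unfold IsHom at *
    rw [Matrix.map_apply, ← map_zsmul, ← this]
    exact pow_comm_apply ε 1 k (L a b)
  have e2 : str (K'.map ⇑(ε ^ k) * J'.map ⇑(ε ^ k) * (J.map d * K)) =
      str (J'.map ⇑(ε ^ k) * J.map d) := by
    rw [← Matrix.mul_assoc, str_mul_comm h (k := k) _ hK]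
    · rw [← Matrix.mul_assoc, ← Matrix.mul_assoc, ← map_pow_mul, hKK', map_pow_one, Matrix.one_mul]
    · intro a b
      rw [Matrix.mul_apply]
      refine IsHom.sum fun c _ => ?_
      have h1 : IsHom ε (k + (pe c + pe b)) (d (J c b)) := by
        have := hJ c b
        unfold IsHom at *
        rw [hdε, this, map_zsmul, smul_smul, ← pow_add]
      rw [Matrix.map_apply]
      refine ((IsEvenMatrix.mul (hE hJ') (hE hK') a c).mul h1).congr ?_
      simp only [Nat.even_add]
      tauto
  rw [e1, e2]

include h hd in
/-- The logarithmic derivative of the Berezinian. -/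
theorem derivation_berezinian (hdε : ∀ f, ε (d f) = (-1 : ℤ) ^ k • d (ε f))
    {J J' : Matrix (Fin p ⊕ Fin q) (Fin p ⊕ Fin q) S}
    (hJ : IsEvenMatrix ε J) (hJ' : IsEvenMatrix ε J') (hJJ' : J * J' = 1) (hJ'J : J' * J = 1) :
    d (berezinian J) = str (J'.map ⇑(ε ^ k) * J.map d) * berezinian J := by
  have hd1 : d 1 = 0 := by
    have := hd 1 1
    simpa using this
  obtain ⟨X, P, P', D, D', Y, hX, hP, hP', hD, hD', hY, hPP, hPP', hDD, hDD', rfl⟩ :=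
    exists_udl h hJ hJ' hJJ' hJ'J
  have hblock : ∀ {A : Matrix (Fin p) (Fin p) S} {B C} {D : Matrix (Fin q) (Fin q) S},
      HomMatrix ε 0 A → HomMatrix ε 1 B → HomMatrix ε 1 C → HomMatrix ε 0 D →
      IsEvenMatrix ε (Matrix.fromBlocks A B C D) := by
    intro A B C D hA hB hC hD a b
    rcases a with i | α <;> rcases b with j | β
    · exact hA i j
    · exact hB i β
    · exact hC α j
    · exact (hD α β).congr (by simp only [pe_inr]; decide)
  have h0 : ∀ {m n : Type}, HomMatrix ε 1 (0 : Matrix m n S) := fun i j => by simp [IsHom]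
  have h1 : ∀ {m : Type} [DecidableEq m], HomMatrix ε 0 (1 : Matrix m m S) := HomMatrix.one
  have hU := hblock h1 hX h0 h1
  have hU' := hblock h1 hX.neg h0 h1
  have hE := hblock hP h0 h0 hD
  have hE' := hblock hP' h0 h0 hD'
  have hL := hblock h1 h0 hY h1
  have hL' := hblock h1 h0 hY.neg h1
  set U : Matrix (Fin p ⊕ Fin q) (Fin p ⊕ Fin q) S := Matrix.fromBlocks 1 X 0 1
  set U' : Matrix (Fin p ⊕ Fin q) (Fin p ⊕ Fin q) S := Matrix.fromBlocks 1 (-X) 0 1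
  set E := Matrix.fromBlocks P 0 0 D
  set E' := Matrix.fromBlocks P' 0 0 D'
  set L : Matrix (Fin p ⊕ Fin q) (Fin p ⊕ Fin q) S := Matrix.fromBlocks 1 0 Y 1
  set L' : Matrix (Fin p ⊕ Fin q) (Fin p ⊕ Fin q) S := Matrix.fromBlocks 1 0 (-Y) 1
  have hUU : U' * U = 1 := by
    simp [U, U', Matrix.fromBlocks_multiply, ← Matrix.fromBlocks_one]
  have hEE : E * E' = 1 := by
    simp [E, E', Matrix.fromBlocks_multiply, ← Matrix.fromBlocks_one, hPP, hDD]
  have hEE' : E' * E = 1 := by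
    simp [E, E', Matrix.fromBlocks_multiply, ← Matrix.fromBlocks_one, hPP', hDD']
  have hLL : L * L' = 1 := by
    simp [L, L', Matrix.fromBlocks_multiply, ← Matrix.fromBlocks_one]
  have hLL' : L' * L = 1 := by
    simp [L, L', Matrix.fromBlocks_multiply, ← Matrix.fromBlocks_one]
  have e : udl X P D Y = U * (E * L) := by
    simp [U, E, L, udl, Matrix.fromBlocks_multiply, Matrix.mul_assoc]
  have e' : J' = L' * E' * U' := by
    have : L' * E' * U' * udl X P D Y = 1 := by
      rw [e, Matrix.mul_assoc (L' * E'), ← Matrix.mul_assoc U', hUU, Matrix.one_mul,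
        Matrix.mul_assoc, ← Matrix.mul_assoc E', hEE', Matrix.one_mul, hLL']
    calc J' = L' * E' * U' * udl X P D Y * J' := by rw [this, Matrix.one_mul]
      _ = L' * E' * U' := by rw [Matrix.mul_assoc, hJJ', Matrix.mul_one]
  have hEL : E * L * (L' * E') = 1 := by
    rw [Matrix.mul_assoc, ← Matrix.mul_assoc L, hLL, Matrix.one_mul, hEE]
  -- For a unitriangular factor the logarithmic derivative has only an off-diagonal block, so its
  -- supertrace vanishes.
  have s1 : str (U'.map ⇑(ε ^ k) * U.map d) = 0 := by
    have z : ∀ {m : Type} [DecidableEq m], (1 : Matrix m m S).map d = 0 := fun {m} _ => by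
      ext i j
      rcases eq_or_ne i j with rfl | hij
      · simp [hd1]
      · simp [hij]
    simp [U, U', Matrix.fromBlocks_map, Matrix.fromBlocks_multiply, str, z]
  have s3 : str (L'.map ⇑(ε ^ k) * L.map d) = 0 := by
    have z : ∀ {m : Type} [DecidableEq m], (1 : Matrix m m S).map d = 0 := fun {m} _ => by
      ext i j
      rcases eq_or_ne i j with rfl | hij
      · simp [hd1]
      · simp [hij]
    simp [L, L', Matrix.fromBlocks_map, Matrix.fromBlocks_multiply, str, z]
  have s2 : str (E'.map ⇑(ε ^ k) * E.map d) =
      ∑ i, ∑ j, P' i j * d (P j i) - ∑ i, ∑ j, D' i j * d (D j i) := by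
    have y : ∀ {m n : Type} {A : Matrix m n S}, HomMatrix ε 0 A → A.map ⇑(ε ^ k) = A :=
      fun {m n A} hA => by
        ext i j
        exact pow_apply_even (isHom_zero_iff.1 (hA i j)) k
    simp [E, E', Matrix.fromBlocks_map, str, y hP', y hD',
      Matrix.mul_apply, sub_eq_add_neg, -AlgHom.coe_pow]
  have hdet := leibnizDet_even h hP
  -- Jacobi's formula for `D' = D⁻¹`; differentiating `DD' = 1` trades the derivative of `D'` for
  -- that of `D` and yields the minus sign of the supertrace.
  have s4 : d (leibnizDet D') = -(∑ i, ∑ j, D' i j * d (D j i)) * leibnizDet D' := by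
    rw [derivation_leibnizDet h hd hD' hD hDD']
    congr 1
    have : ∀ i, ∑ j, (d (D i j) * D' j i + D i j * d (D' j i)) = 0 := by
      intro i
      have h3 := congrFun (congrFun (map_mul_derivation hd D D') i) i
      rw [hDD, Matrix.map_apply, Matrix.one_apply_eq, hd1, Matrix.add_apply, Matrix.mul_apply,
        Matrix.mul_apply, ← Finset.sum_add_distrib] at h3
      rw [h3]
      refine Finset.sum_congr rfl fun j _ => ?_
      rw [Matrix.map_apply, Matrix.map_apply, Matrix.map_apply,
        pow_apply_even (isHom_zero_iff.1 (hD i j))]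
    rw [eq_neg_iff_add_eq_zero]
    conv_lhs => arg 2; rw [Finset.sum_comm]
    rw [← Finset.sum_add_distrib]
    refine Finset.sum_eq_zero fun i _ => ?_
    rw [← Finset.sum_add_distrib, ← this i]
    refine Finset.sum_congr rfl fun j _ => ?_
    rw [h.even_comm (D' j i) _ (isHom_zero_iff.1 (hD' j i)), add_comm]
  rw [berezinian_udl _ _ _ hDD hDD', e', e, str_log_mul h hd hdε hU hU' hUU
    (IsEvenMatrix.mul hL hE) (IsEvenMatrix.mul hE' hL') hEL,
    str_log_mul h hd hdε hE hE' hEE' hL hL' hLL, s1, s2, s3, hd, s4,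
    derivation_leibnizDet h hd hP hP' hPP, pow_apply_even hdet, zero_add, add_zero, sub_mul,
    neg_mul, mul_neg, ← sub_eq_add_neg, mul_assoc]
  congr 1
  rw [← mul_assoc, ← mul_assoc, h.even_comm _ _ hdet]

end LogDerivative

/-! ## The Piola identity -/

section Piola

variable {p q : ℕ} {𝕜 : Type u} [RCLike 𝕜] {S : Type u} [Ring S] [Algebra 𝕜 S]
  {ε : S →ₐ[𝕜] S} {pd pd' : Fin p ⊕ Fin q → (S →ₗ[𝕜] S)} {x x' : Fin p ⊕ Fin q → S}
  {J J' : Matrix (Fin p ⊕ Fin q) (Fin p ⊕ Fin q) S}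

lemma IsCoordSystem.isEvenMatrix (h : IsCoordSystem ε pd x) (h' : IsCoordSystem ε pd' x')
    (hJx : ∀ a b, J a b = pd a (x' b)) : IsEvenMatrix ε J := fun a b => by
  rw [hJx]
  exact h.hom_pd a (h'.hom_x b)

/-- The logarithmic derivative of `Ber J'` along `∂_b` is `str(J ∂_b J')`. Differentiating `JJ' = 1`
moves `∂_b` onto `J`; then `∂_b J_{cd} = ± ∂_c J_{bd}` by the symmetry of second derivatives, and
summing over `c` against `J'` turns `∂_c` into a derivative in the other coordinates, leaving the
divergence of `∂_b`. -/
theorem piola (h : IsCoordSystem ε pd x) (h' : IsCoordSystem ε pd' x')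
    (hJx : ∀ a b, J a b = pd a (x' b)) (hJ'x : ∀ a b, J' a b = pd' a (x b))
    (hch' : ∀ a f, pd' a f = ∑ b, J' a b * pd b f)
    (hJJ' : J * J' = 1) (hJ'J : J' * J = 1) (b : Fin p ⊕ Fin q) :
    pd b (berezinian J') =
      -∑ c, (-1 : ℤ) ^ (pe c * (pe b + 1)) • (pd' c (J b c) * berezinian J') := by
  have hs := h.toIsSuperComm
  have hJ := h.isEvenMatrix h' hJx
  have hJ' := h'.isEvenMatrix h hJ'x
  rw [derivation_berezinian hs (h.leibniz b) (h.par_pd b) hJ' hJ hJ'J hJJ']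
  simp only [← smul_mul_assoc]
  rw [← Finset.sum_mul, ← neg_mul]
  congr 1
  have e : J.map (pd b) * J' + J.map ⇑(ε ^ pe b) * J'.map (pd b) = 0 := by
    rw [← map_mul_derivation (h.leibniz b), hJJ']
    ext i j
    rw [Matrix.map_apply, Matrix.one_apply]
    split_ifs
    · simp [h.pd_one]
    · simp
  have e2 : str (J.map ⇑(ε ^ pe b) * J'.map (pd b)) = -str (J.map (pd b) * J') := by
    rw [eq_neg_iff_add_eq_zero, ← str_add, add_comm, e]
    simp [str]
  rw [e2]
  congr 1
  simp only [str, Matrix.mul_apply, Finset.smul_sum, hch']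
  rw [Finset.sum_comm]
  refine Finset.sum_congr rfl fun d _ => Finset.sum_congr rfl fun c _ => ?_
  have h1 : IsHom ε (pe b + (pe c + pe d)) (pd b (J c d)) := h.hom_pd b (hJ c d)
  rw [Matrix.map_apply, hs.hom_mul_hom_comm h1 (hJ' d c), hJx c d, hJx b d, h.pd_comm b c,
    mul_smul_comm, smul_smul, smul_smul, ← pow_add, ← pow_add]
  congr 1
  refine sign_congr ?_
  push_cast
  generalize (pe b : ZMod 2) = b, (pe c : ZMod 2) = c, (pe d : ZMod 2) = d
  decide +revert

end Piola

/-! ## The generator -/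

section Alternating

/-- Such an `L` extends to the exterior algebra, so the product is an alternating function of the
rows and hence a multiple of the determinant. It is applied to odd functions and to the operators
`π∂_{z_j}`. -/
lemma prod_ofFn_of_sq_eq_zero {A B : Type*} [CommRing A] [Ring B] [Algebra A B] {n : ℕ}
    (L : (Fin n → A) →ₗ[A] B) (hL : ∀ v, L v * L v = 0) (a : Fin n → Fin n → A) :
    (List.ofFn fun i => L (a i)).prod =
      (Matrix.of a).det • (List.ofFn fun i => L (Pi.single i 1)).prod := by
  let F : (Fin n → A) [⋀^Fin n]→ₗ[A] B :=
    (ExteriorAlgebra.lift A ⟨L, hL⟩).toLinearMap.compAlternatingMap (ExteriorAlgebra.ιMulti A n)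
  have hF : ∀ v, F v = (List.ofFn fun i => L (v i)).prod := fun v => by
    simp only [F, LinearMap.compAlternatingMap_apply, ExteriorAlgebra.ιMulti_apply,
      AlgHom.toLinearMap_apply, map_list_prod, List.map_ofFn, Function.comp_def,
      ExteriorAlgebra.lift_ι_apply]
  let G : (Fin n → A) [⋀^Fin n]→ₗ[A] B :=
    (LinearMap.toSpanSingleton A B (F fun i => Pi.single i 1)).compAlternatingMap
      Matrix.detRowAlternating
  have hFG : F = G := by
    -- Alternating maps need only be compared on injective families of basis vectors, that is, on
    -- permutations of the basis.
    refine Module.Basis.ext_alternating (Pi.basisFun A (Fin n)) fun v hv => ?_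
    let σ : Equiv.Perm (Fin n) := Equiv.ofBijective v (Finite.injective_iff_bijective.1 hv)
    have h1 : F (fun i => Pi.basisFun A (Fin n) (v i)) =
        Equiv.Perm.sign σ • F (fun i => Pi.single i 1) := by
      rw [← F.map_perm (fun i => Pi.single i 1) σ]
      simp only [Pi.basisFun_apply]
      rfl
    have h2 : G (fun i => Pi.basisFun A (Fin n) (v i)) =
        Equiv.Perm.sign σ • G (fun i => Pi.single i 1) := by
      rw [← G.map_perm (fun i => Pi.single i 1) σ]
      simp only [Pi.basisFun_apply]
      rfl
    rw [h1, h2]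
    congr 1
    have h3 : (Matrix.detRowAlternating fun i : Fin n => (Pi.single i 1 : Fin n → A)) = 1 := by
      have : (fun i : Fin n => (Pi.single i 1 : Fin n → A)) = (1 : Matrix (Fin n) (Fin n) A) := by
        ext i j
        rw [Matrix.one_apply, Pi.single_apply]
        simp only [eq_comm]
      rw [this]
      exact Matrix.det_one
    simp only [G, LinearMap.compAlternatingMap_apply, h3, LinearMap.toSpanSingleton_apply,
      one_smul]
  rw [← hF, ← hF]
  exact congrArg (fun T : (Fin n → A) [⋀^Fin n]→ₗ[A] B => T a) hFG

end Alternating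

/-! ### Invariance of the generator under coordinate changes -/

section Generator

variable {p q : ℕ} {𝕜 : Type u} [RCLike 𝕜] {S : Type u} [Ring S] [Algebra 𝕜 S]
  {ε : S →ₐ[𝕜] S}

lemma isHom_one_iff {f : S} : IsHom ε 1 f ↔ ε f = -f := by
  simp [IsHom]

/-- The even elements act linearly over the commutative algebra of even elements. -/
abbrev evenAlgebra (h : IsSuperComm ε) :
    letI := evenCommRing h
    Algebra (evenPart ε) S :=
  letI := evenCommRing h
  (evenPart ε).val.toRingHom.toAlgebra' fun c x => h.even_comm c.1 x c.2

/-- The even elements annihilated by `t` form an ideal; the two matrices agree modulo it, and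
determinants commute with passing to the quotient. -/
lemma leibnizDet_congr (h : IsSuperComm ε) {n : ℕ} {A B : Matrix (Fin n) (Fin n) S}
    (hA : HomMatrix ε 0 A) (hB : HomMatrix ε 0 B) {t : S} (ht : ∀ i j, t * A i j = t * B i j) :
    t * leibnizDet A = t * leibnizDet B := by
  let := evenCommRing h
  obtain ⟨A, rfl⟩ := hA.exists_lift
  obtain ⟨B, rfl⟩ := hB.exists_lift
  rw [leibnizDet_map h, leibnizDet_map h]
  let I : Ideal (evenPart ε) :=
    { carrier := {a | t * a.1 = 0}
      add_mem' := fun {a b} ha hb => by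
        change t * (a.1 + b.1) = 0
        rw [mul_add, ha, hb, add_zero]
      zero_mem' := mul_zero t
      smul_mem' := fun c a ha => by
        change t * (c.1 * a.1) = 0
        rw [← mul_assoc, ← h.even_comm c.1 t c.2, mul_assoc, ha, mul_zero] }
  have h1 : Ideal.Quotient.mk I A.det = Ideal.Quotient.mk I B.det := by
    rw [RingHom.map_det, RingHom.map_det]
    congr 1
    ext i j
    refine Ideal.Quotient.eq.2 ?_
    change t * ((A i j).1 - (B i j).1) = 0
    rw [mul_sub, sub_eq_zero]
    exact ht i j
  have h2 : t * (A.det.1 - B.det.1) = 0 := Ideal.Quotient.eq.1 h1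
  rwa [mul_sub, sub_eq_zero] at h2

lemma leibnizDet_transpose (h : IsSuperComm ε) {n : ℕ} {A : Matrix (Fin n) (Fin n) S}
    (hA : HomMatrix ε 0 A) : leibnizDet A.transpose = leibnizDet A := by
  let := evenCommRing h
  obtain ⟨A, rfl⟩ := hA.exists_lift
  change leibnizDet (A.transpose.map Subtype.val) = _
  rw [leibnizDet_map h, leibnizDet_map h, Matrix.det_transpose]

/-- A product of combinations of odd elements with even coefficients. -/
lemma prod_odd_combination (h : IsSuperComm ε) {n : ℕ} {θ : Fin n → S} (hθ : ∀ i, ε (θ i) = -θ i)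
    {A : Matrix (Fin n) (Fin n) S} (hA : HomMatrix ε 0 A) :
    (List.ofFn fun i => ∑ j, θ j * A i j).prod = leibnizDet A * (List.ofFn θ).prod := by
  let := evenCommRing h
  let := evenAlgebra h
  obtain ⟨A, rfl⟩ := hA.exists_lift
  let L : (Fin n → evenPart ε) →ₗ[evenPart ε] S :=
    { toFun := fun v => ∑ j, θ j * (v j).1
      map_add' := fun v w => by
        simp only [Pi.add_apply, ← Finset.sum_add_distrib, ← mul_add]
        rfl
      map_smul' := fun c v => by
        rw [RingHom.id_apply, Finset.smul_sum]
        refine Finset.sum_congr rfl fun j _ => ?_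
        change θ j * (c.1 * (v j).1) = c.1 * (θ j * (v j).1)
        rw [← mul_assoc, ← h.even_comm c.1 _ c.2, mul_assoc] }
  have hL : ∀ v, L v * L v = 0 := fun v => by
    refine odd_mul_self h (isHom_one_iff.2 ?_)
    change ε (∑ j, θ j * (v j).1) = -∑ j, θ j * (v j).1
    rw [map_sum, ← Finset.sum_neg_distrib]
    refine Finset.sum_congr rfl fun j _ => ?_
    rw [map_mul, hθ, neg_mul, show ε (v j).1 = (v j).1 from (v j).2]
  have h1 : ∀ j, L (Pi.single j 1) = θ j := fun j => by
    change ∑ i, θ i * ((Pi.single j 1 : Fin n → evenPart ε) i).1 = θ j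
    rw [Finset.sum_eq_single j]
    · rw [Pi.single_eq_same]
      exact mul_one _
    · intro i _ hi
      rw [Pi.single_eq_of_ne hi]
      exact mul_zero _
    · simp
  have := prod_ofFn_of_sq_eq_zero L hL fun i j => A i j
  rw [leibnizDet_map h]
  refine this.trans ?_
  exact congrArg (fun t : Fin n → S => A.det.1 * (List.ofFn t).prod) (funext h1)

/-- The product of the odd coordinates. -/
def thetaTop (x : Fin p ⊕ Fin q → S) : S := (List.ofFn fun α => x (.inr α)).prod

/-- The factor `a` can be commuted to its other copy in the product, and odd elements have square
zero. -/
lemma prod_mul_of_mem (h : IsSuperComm ε) {l : List S} {a : S} (ha : ε a = -a) (hl : a ∈ l) :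
    l.prod * a = 0 := by
  induction l with
  | nil => simp at hl
  | cons b l ih =>
    rcases List.mem_cons.1 hl with rfl | hl
    · have h1 := h.hom_mul_comm (isHom_one_iff.2 ha) (ε l.prod)
      rw [pow_one, h.invol] at h1
      rw [List.prod_cons, mul_assoc, ← h1, ← mul_assoc, odd_mul_self h (isHom_one_iff.2 ha),
        zero_mul]
    · rw [List.prod_cons, mul_assoc, ih hl, mul_zero]

namespace IsCoordSystem

variable {pd pd' : Fin p ⊕ Fin q → (S →ₗ[𝕜] S)} {x x' : Fin p ⊕ Fin q → S}
  (h : IsCoordSystem ε pd x) (h' : IsCoordSystem ε pd' x')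
include h

lemma odd_x (α : Fin q) : ε (x (.inr α)) = -x (.inr α) := isHom_one_iff.1 (h.hom_x (.inr α))

lemma thetaTop_mul_x (α : Fin q) : thetaTop x * x (.inr α) = 0 :=
  prod_mul_of_mem h.toIsSuperComm (h.odd_x α) (List.mem_ofFn.2 ⟨α, rfl⟩)

lemma thetaTop_mul_odd {f : S} (hf : ε f = -f) : thetaTop x * f = 0 := by
  obtain ⟨k, -, rfl⟩ := h.odd_gen f hf
  rw [Finset.mul_sum]
  refine Finset.sum_eq_zero fun α _ => ?_
  rw [← mul_assoc, h.thetaTop_mul_x, zero_mul]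

include h' in
-- Writing `x'_β = ∑ x_α k_{βα}` with even `k`, the product of the `x'_β` is `det k` times that of
-- the `x_α`. Modulo the annihilator of the latter, `k_{βα}` equals `∂x'_β/∂x_α`.
lemma thetaTop_eq : thetaTop x' =
    thetaTop x * leibnizDet (Matrix.of fun α β => pd (.inr α) (x' (.inr β))) := by
  have hs := h.toIsSuperComm
  choose k hk hx using fun β => h.odd_gen (x' (.inr β)) (h'.odd_x β)
  have hk' : HomMatrix ε 0 (Matrix.of k) := fun i j => isHom_zero_iff.2 (hk i j)
  have h1 : thetaTop x' = leibnizDet (Matrix.of k) * thetaTop x := by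
    rw [thetaTop, thetaTop, ← prod_odd_combination hs h.odd_x hk']
    simp only [hx, Matrix.of_apply]
  rw [h1, hs.even_comm _ _ (leibnizDet_even hs hk'), ← leibnizDet_transpose hs hk']
  refine leibnizDet_congr hs (fun i j => hk' j i) (fun i j => ?_) fun α β => ?_
  · exact (h.hom_pd (.inr i) (h'.hom_x (.inr j))).congr (by simp only [pe_inr]; decide)
  · change thetaTop x * k β α = thetaTop x * pd (.inr α) (x' (.inr β))
    rw [hx, map_sum, Finset.mul_sum,
      Finset.sum_eq_single α]
    · rw [h.leibniz, h.pd_x, if_pos rfl, one_mul, mul_add, pe_inr, pow_one, h.odd_x, neg_mul,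
        mul_neg, ← mul_assoc _ (x _), h.thetaTop_mul_x, zero_mul, neg_zero, add_zero]
    · intro γ _ hγ
      rw [h.leibniz, h.pd_x, if_neg (by simpa using hγ.symm), zero_mul, zero_add, pe_inr, pow_one,
        h.odd_x, neg_mul, mul_neg, ← mul_assoc _ (x _), h.thetaTop_mul_x, zero_mul, neg_zero]
    · simp

end IsCoordSystem

/-- The coefficients of the `π∂_θ` in an even row are odd and die against `t`. Passing one row
replaces `t` by `ε t`, which still annihilates odd elements, so the argument can be repeated. -/
lemma foldr_leftMulRow_inl (h : IsSuperComm ε) {J : Matrix (Fin p ⊕ Fin q) (Fin p ⊕ Fin q) S}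
    (hJ : IsEvenMatrix ε J) (l : List (Fin p)) {t : S} (ht : ∀ f, ε f = -f → t * f = 0)
    (s : Mon p q →₀ S) :
    t • l.foldr (fun i s => leftMulRow ε J (.inl i) s) s =
      t • l.foldr (fun i s => ∑ j, J (.inl i) (.inl j) • leftMul ε.toLinearMap (.inl j) s) s := by
  induction l generalizing t with
  | nil => rfl
  | cons i l ih =>
    have h1 : ∀ s, t • leftMulRow ε J (.inl i) s =
        t • ∑ j, J (.inl i) (.inl j) • leftMul ε.toLinearMap (.inl j) s := by
      intro s
      rw [leftMulRow_apply, Fintype.sum_sum_type, smul_add, add_eq_left, Finset.smul_sum]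
      refine Finset.sum_eq_zero fun α _ => ?_
      rw [smul_smul, ht _ (isHom_one_iff.1 (hJ (.inl i) (.inr α))), zero_smul]
    have h2 : ∀ s, t • leftMulRow ε J (.inl i) s = leftMulRow ε J (.inl i) (ε t • s) := by
      intro s
      rw [leftMulRow_smul h hJ, pe_inl, zero_add, pow_one, h.invol]
    rw [List.foldr_cons, List.foldr_cons, ← h1, h2, h2, ih]
    intro f hf
    have := congrArg ε (ht (ε f) (by rw [hf, map_neg, hf]))
    rwa [map_mul, h.invol, map_zero] at this

/-- The operators `π∂_{z_j}` anticommute, so a product of even combinations of them is a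
determinant, by `prod_ofFn_of_sq_eq_zero` in the endomorphism algebra over the even elements. -/
lemma foldr_leftMul_inl (h : IsSuperComm ε) {A : Matrix (Fin p) (Fin p) S} (hA : HomMatrix ε 0 A) :
    (List.finRange p).foldr (fun i s => ∑ j, A i j • leftMul ε.toLinearMap (.inl j) s)
      (Finsupp.single ((∅, 0) : Mon p q) 1) =
      leibnizDet A • Finsupp.single (Finset.univ, 0) (1 : S) := by
  let := evenCommRing h
  let X : Fin p → Module.End (evenPart ε) (Mon p q →₀ S) := fun j =>
    { toFun := leftMul ε.toLinearMap (.inl j)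
      map_add' := map_add _
      map_smul' := fun c s => by
        change leftMul ε.toLinearMap (.inl j) (c.1 • s) = c.1 • leftMul ε.toLinearMap (.inl j) s
        rw [leftMul_smul h, pow_apply_even c.2] }
  let L : (Fin p → evenPart ε) →ₗ[evenPart ε] Module.End (evenPart ε) (Mon p q →₀ S) :=
    { toFun := fun v => ∑ j, v j • X j
      map_add' := fun v w => by simp only [Pi.add_apply, add_smul, Finset.sum_add_distrib]
      map_smul' := fun c v => by simp only [Pi.smul_apply, Finset.smul_sum, smul_smul, smul_eq_mul,
        RingHom.id_apply] }
  have hLa : ∀ v s, L v s = ∑ j, (v j).1 • leftMul ε.toLinearMap (.inl j) s := fun v s =>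
    LinearMap.sum_apply Finset.univ (fun j => v j • X j) s
  have hL : ∀ v, L v * L v = 0 := fun v => by
    -- All even rows of this auxiliary supermatrix are equal to `v`, so that `L v` becomes a row
    -- operator, known to square to zero.
    let J : Matrix (Fin p ⊕ Fin q) (Fin p ⊕ Fin q) S :=
      Matrix.fromBlocks (Matrix.of fun _ j => (v j).1) 0 0 0
    have hJ : IsEvenMatrix ε J := by
      rintro (i | i) (j | j)
      · exact isHom_zero_iff.2 (v j).2
      all_goals simp [J, IsHom, Matrix.fromBlocks]
    have e : ∀ i s, L v s = leftMulRow ε J (.inl i) s := fun i s => by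
      rw [leftMulRow_apply, Fintype.sum_sum_type, hLa]
      simp only [J, Matrix.fromBlocks_apply₁₁, Matrix.fromBlocks_apply₁₂, Matrix.zero_apply,
        zero_smul, Finset.sum_const_zero, add_zero, Matrix.of_apply]
    refine LinearMap.ext fun s => ?_
    rcases isEmpty_or_nonempty (Fin p) with hp | ⟨⟨i⟩⟩
    · change L v (L v s) = 0
      simp [L]
    · change L v (L v s) = 0
      rw [e i, e i, leftMulRow_inl_self h hJ]
  have key : ∀ A : Matrix (Fin p) (Fin p) (evenPart ε), ∀ s,
      (List.finRange p).foldr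
        (fun i s => ∑ j, (A i j).1 • leftMul ε.toLinearMap (.inl j) s) s =
      (List.ofFn fun i => L fun j => A i j).prod s := by
    intro A s
    have : ∀ l : List (Fin p), l.foldr
        (fun i s => ∑ j, (A i j).1 • leftMul ε.toLinearMap (.inl j) s) s =
        (l.map fun i => L fun j => A i j).prod s := by
      intro l
      induction l with
      | nil => rfl
      | cons i l ih =>
        rw [List.foldr_cons, ih, List.map_cons, List.prod_cons]
        exact (hLa _ _).symm
    rw [this, List.ofFn_eq_map]
  obtain ⟨A, rfl⟩ := hA.exists_lift
  -- Substituting the identity shows that the product of all `π∂_{z_j}` in increasing order is the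
  -- top monomial, without a sign.
  have h1 := subst_one h (Finsupp.single ((Finset.univ, 0) : Mon p q) (1 : S))
  have hw : Mon.word ((Finset.univ, 0) : Mon p q) = (List.finRange p).map Sum.inl := by
    simp [Mon.word, Fin.sort_univ]
  have hone : IsEvenMatrix (p := p) (q := q) ε (1 : Matrix _ _ S) := fun a b => by
    unfold IsHom
    rcases eq_or_ne a b with rfl | hab
    · simp [← two_mul]
    · simp [hab]
  have h2 : (List.finRange p).foldr (fun i s => ∑ j,
      ((1 : Matrix (Fin p) (Fin p) (evenPart ε)) i j).1 • leftMul ε.toLinearMap (.inl j) s)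
      (Finsupp.single ((∅, 0) : Mon p q) (1 : S)) = Finsupp.single (Finset.univ, 0) 1 := by
    rw [subst_single, one_smul, substMon_eq, hw, List.foldr_map] at h1
    conv_rhs => rw [← h1]
    congr 1
    ext i s : 2
    rw [leftMulRow_apply, Fintype.sum_sum_type]
    simp only [Matrix.one_apply, Sum.inl.injEq, reduceCtorEq, if_false, zero_smul,
      Finset.sum_const_zero, add_zero]
    refine Finset.sum_congr rfl fun j _ => ?_
    split_ifs <;> rfl
  have h3 := prod_ofFn_of_sq_eq_zero (A := evenPart ε)
    (B := Module.End (evenPart ε) (Mon p q →₀ S)) L hL fun i j => A i j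
  have h4 := prod_ofFn_of_sq_eq_zero (A := evenPart ε)
    (B := Module.End (evenPart ε) (Mon p q →₀ S)) L hL fun i j => (1 : Matrix _ _ (evenPart ε)) i j
  rw [show Matrix.of (fun i j => (1 : Matrix (Fin p) (Fin p) (evenPart ε)) i j) = 1 from rfl,
    Matrix.det_one, one_smul] at h4
  rw [leibnizDet_map h]
  refine (key A _).trans ?_
  rw [h3, ← h4]
  change A.det.1 • ((List.ofFn fun i => L fun j => (1 : Matrix _ _ (evenPart ε)) i j).prod _) = _
  rw [← key, h2]

variable {pd pd' : Fin p ⊕ Fin q → (S →ₗ[𝕜] S)} {x x' : Fin p ⊕ Fin q → S}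
  {J J' : Matrix (Fin p ⊕ Fin q) (Fin p ⊕ Fin q) S}

/-- The generator does not depend on the coordinates. -/
theorem generator_transition (h : IsCoordSystem ε pd x) (h' : IsCoordSystem ε pd' x')
    (hJx : ∀ a b, J a b = pd a (x' b)) (hJ'x : ∀ a b, J' a b = pd' a (x b))
    (hJJ' : J * J' = 1) (hJ'J : J' * J = 1) :
    berezinian J' • subst ε.toLinearMap J (Finsupp.single (Finset.univ, 0) (thetaTop x)) =
      Finsupp.single (Finset.univ, 0) (thetaTop x') := by
  have hs := h.toIsSuperComm
  have hJ := h.isEvenMatrix h' hJx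
  have hJ' := h'.isEvenMatrix h hJ'x
  have hodd : ∀ f, ε f = -f → thetaTop x * f = 0 := fun f => h.thetaTop_mul_odd
  have hw : Mon.word ((Finset.univ, 0) : Mon p q) = (List.finRange p).map Sum.inl := by
    simp [Mon.word, Fin.sort_univ]
  have hA : HomMatrix ε 0 J.toBlocks₁₁ := fun i j => hJ (.inl i) (.inl j)
  have hD₂ : HomMatrix ε 0 J.toBlocks₂₂ :=
    fun i j => (hJ (.inr i) (.inr j)).congr (by simp only [pe_inr]; decide)
  -- Once multiplied by the product of the odd coordinates, a matrix product with an odd left factor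
  -- disappears.
  have hzero : ∀ {l m n : ℕ} {M : Matrix (Fin l) (Fin m) S} (N : Matrix (Fin m) (Fin n) S),
      HomMatrix ε 1 M → ∀ i j, thetaTop x * (M * N) i j = 0 := by
    intro l m n M N hM i j
    rw [Matrix.mul_apply, Finset.mul_sum]
    refine Finset.sum_eq_zero fun k _ => ?_
    rw [← mul_assoc, hodd _ (isHom_one_iff.1 (hM i k)), zero_mul]
  rw [subst_single, substMon_eq, hw, List.foldr_map, foldr_leftMulRow_inl hs hJ _ hodd]
  refine (congrArg (fun y => berezinian J' • thetaTop x • y) (foldr_leftMul_inl hs hA)).trans ?_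
  rw [smul_smul, smul_smul, Finsupp.smul_single, smul_eq_mul, mul_one]
  congr 1
  have hber := berezinian_even hs hJ' hJ hJ'J hJJ'
  obtain ⟨X, P, P', D, D', Y, hX, hP, hP', hD, hD', hY, hPP, hPP', hDD, hDD', rfl⟩ :=
    exists_udl hs hJ' hJ hJ'J hJJ'
  have hB : HomMatrix ε 1 J.toBlocks₁₂ := fun i j => hJ (.inl i) (.inr j)
  have hC : HomMatrix ε 1 J.toBlocks₂₁ := fun i j => hJ (.inr i) (.inl j)
  have hblocks := hJJ'
  rw [← Matrix.fromBlocks_toBlocks J, udl, Matrix.fromBlocks_multiply, ← Matrix.fromBlocks_one,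
    Matrix.fromBlocks_inj] at hblocks
  obtain ⟨b₁, -, -, b₂⟩ := hblocks
  rw [hs.even_comm _ _ hber, mul_assoc, hs.even_comm _ (leibnizDet _) hber,
    berezinian_udl _ _ _ hDD hDD', h.thetaTop_eq h', ← mul_assoc (leibnizDet _),
    ← leibnizDet_mul hs hA hP, ← mul_assoc (thetaTop x)]
  -- Modulo such terms the diagonal blocks of `J J' = 1` read `J₁₁ P ≡ 1` and `J₂₂ ≡ D⁻¹`: the
  -- Berezinian cancels the even determinant and leaves the odd one, which is the factor in
  -- `thetaTop_eq`.
  have e1 : thetaTop x * leibnizDet (J.toBlocks₁₁ * P) = thetaTop x := by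
    rw [leibnizDet_congr hs (hA.mul hP) HomMatrix.one, leibnizDet_one hs, mul_one]
    intro i j
    rw [← b₁, Matrix.mul_add, Matrix.mul_assoc X, ← Matrix.mul_assoc _ X, Matrix.add_apply,
      Matrix.add_apply, mul_add, mul_add, hzero _ (hA.mul hX), hzero _ hB, add_zero, add_zero]
  have e2 : thetaTop x * leibnizDet D' = thetaTop x * leibnizDet J.toBlocks₂₂ := by
    refine leibnizDet_congr hs hD' hD₂ fun i j => ?_
    have : D' = J.toBlocks₂₁ * X + J.toBlocks₂₂ := by
      calc D' = (J.toBlocks₂₁ * (X * D) + J.toBlocks₂₂ * D) * D' := by rw [b₂, Matrix.one_mul]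
        _ = _ := by
          rw [Matrix.add_mul, Matrix.mul_assoc, Matrix.mul_assoc, Matrix.mul_assoc, hDD,
            Matrix.mul_one, Matrix.mul_one]
    rw [this, Matrix.add_apply, mul_add, hzero _ hC, zero_add]
  rw [e1, e2]
  congr 2
  ext i j
  exact hJx _ _

end Generator

/-! ## The coordinate vector fields of the model -/

section ModelCalculus

variable {𝕜 : Type u} [RCLike 𝕜] {p q : ℕ}

lemma smoothPd_apply {U : Opens (Fin p → 𝕜)} (i : Fin p) (f : smoothFun U) (x : U) :
    (smoothPd U i f).1 x = fderiv 𝕜 (extendZero f.1) x (Pi.single i 1) := rfl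

lemma extendZero_eventuallyEq {U : Opens (Fin p → 𝕜)} {f : U → 𝕜} {g : (Fin p → 𝕜) → 𝕜}
    (h : ∀ y : U, f y = g y) (x : U) : extendZero f =ᶠ[nhds x.1] g := by
  filter_upwards [U.isOpen.mem_nhds x.2] with y hy
  rw [← h ⟨y, hy⟩]
  exact extendZero_apply f ⟨y, hy⟩

lemma smoothPd_mul {U : Opens (Fin p → 𝕜)} (i : Fin p) (f g : smoothFun U) :
    smoothPd U i (f * g) = smoothPd U i f * g + f * smoothPd U i g := by
  ext x
  have e : extendZero (f * g).1 =ᶠ[nhds x.1] extendZero f.1 * extendZero g.1 :=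
    extendZero_eventuallyEq (fun y => by
      rw [Pi.mul_apply, extendZero_apply, extendZero_apply]
      rfl) x
  change fderiv 𝕜 (extendZero (f * g).1) x _ = fderiv 𝕜 (extendZero f.1) x _ * g.1 x +
    f.1 x * fderiv 𝕜 (extendZero g.1) x _
  rw [e.fderiv_eq, fderiv_mul (differentiableAt_extendZero f x) (differentiableAt_extendZero g x),
    extendZero_apply, extendZero_apply]
  simp only [add_apply, smul_apply, smul_eq_mul]
  ring

lemma smoothPd_comm {U : Opens (Fin p → 𝕜)} (i j : Fin p) (f : smoothFun U) :
    smoothPd U i (smoothPd U j f) = smoothPd U j (smoothPd U i f) := by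
  ext x
  have e : ∀ k, extendZero (smoothPd U k f).1 =ᶠ[nhds x.1]
      fun y => fderiv 𝕜 (extendZero f.1) y (Pi.single k 1) := fun k =>
    extendZero_eventuallyEq (g := fun y => fderiv 𝕜 (extendZero f.1) y (Pi.single k 1))
      (fun y => rfl) x
  have hd : DifferentiableAt 𝕜 (fderiv 𝕜 (extendZero f.1)) x :=
    ((ContDiffOn.fderiv_of_isOpen (m := ∞) f.2 U.isOpen (by simp)).differentiableOn
      (by simp)).differentiableAt (U.isOpen.mem_nhds x.2)
  have hs : IsSymmSndFDerivAt 𝕜 (extendZero f.1) x := by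
    refine (f.2.contDiffAt (U.isOpen.mem_nhds x.2)).isSymmSndFDerivAt ?_
    rw [minSmoothness_of_isRCLikeNormedField]
    exact WithTop.coe_le_coe.2 (le_top : (2 : ℕ∞) ≤ ⊤)
  rw [smoothPd_apply, smoothPd_apply, (e i).fderiv_eq, (e j).fderiv_eq,
    fderiv_clm_apply hd (differentiableAt_const _), fderiv_clm_apply hd (differentiableAt_const _)]
  simpa using hs _ _

lemma smoothPd_coord {U : Opens (Fin p → 𝕜)} (i j : Fin p) {h} :
    smoothPd U i (⟨fun x => x.1 j, h⟩ : smoothFun U) = if i = j then 1 else 0 := by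
  ext x
  have e : extendZero (fun x : U => x.1 j) =ᶠ[nhds x.1] fun y => y j :=
    extendZero_eventuallyEq (g := fun y => y j) (fun y => rfl) x
  rw [smoothPd_apply, e.fderiv_eq]
  have : fderiv 𝕜 (fun y : Fin p → 𝕜 => y j) x.1 = ContinuousLinearMap.proj j :=
    (ContinuousLinearMap.proj (R := 𝕜) (φ := fun _ : Fin p => 𝕜) j).fderiv
  rw [this, ContinuousLinearMap.proj_apply]
  rcases eq_or_ne i j with rfl | hij
  · simp
  · rw [Pi.single_eq_of_ne hij.symm, if_neg hij]
    rfl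

lemma involute_contractLeft {M : Type*} [AddCommGroup M] [Module 𝕜 M]
    (d : Module.Dual 𝕜 M) (w : ExteriorAlgebra 𝕜 M) :
    CliffordAlgebra.involute (CliffordAlgebra.contractLeft d w) =
      -CliffordAlgebra.contractLeft d (CliffordAlgebra.involute w) := by
  induction w using CliffordAlgebra.left_induction with
  | algebraMap r => simp [CliffordAlgebra.contractLeft_algebraMap]
  | add x y hx hy => simp only [map_add, hx, hy, neg_add]
  | ι_mul x m hx =>
    simp only [CliffordAlgebra.contractLeft_ι_mul, map_sub, map_smul, map_mul, hx,
      CliffordAlgebra.involute_ι, neg_mul, map_neg]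
    simp only [mul_neg, neg_sub, neg_neg]

lemma contractLeft_mul {M : Type*} [AddCommGroup M] [Module 𝕜 M]
    (d : Module.Dual 𝕜 M) (v w : ExteriorAlgebra 𝕜 M) :
    CliffordAlgebra.contractLeft d (v * w) = CliffordAlgebra.contractLeft d v * w +
      CliffordAlgebra.involute v * CliffordAlgebra.contractLeft d w := by
  induction v using CliffordAlgebra.left_induction with
  | algebraMap r =>
    rw [CliffordAlgebra.contractLeft_algebraMap_mul, CliffordAlgebra.contractLeft_algebraMap,
      zero_mul, zero_add, AlgHom.commutes]
  | add x y hx hy => simp only [map_add, add_mul, hx, hy]; abel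
  | ι_mul x m hx =>
    rw [mul_assoc, CliffordAlgebra.contractLeft_ι_mul, hx, CliffordAlgebra.contractLeft_ι_mul,
      map_mul, CliffordAlgebra.involute_ι]
    simp only [sub_mul, mul_add, smul_mul_assoc, neg_mul, mul_assoc]
    abel

variable {U : Opens (Fin p → 𝕜)}

namespace Model

instance : Ring (Model q U) := Algebra.TensorProduct.instRing
instance : AddCommGroup (Model q U) := Ring.toAddCommGroup

lemma parity_tmul (f : smoothFun U) (w : ExteriorAlgebra 𝕜 (Fin q → 𝕜)) :
    Model.parity q U (f ⊗ₜ w) = f ⊗ₜ CliffordAlgebra.involute w := rfl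

lemma pd_inl_tmul (i : Fin p) (f : smoothFun U) (w : ExteriorAlgebra 𝕜 (Fin q → 𝕜)) :
    Model.pd U (.inl i) (f ⊗ₜ w) = smoothPd U i f ⊗ₜ w := rfl

lemma pd_inr_tmul (α : Fin q) (f : smoothFun U) (w : ExteriorAlgebra 𝕜 (Fin q → 𝕜)) :
    Model.pd U (.inr α) (f ⊗ₜ w) =
      f ⊗ₜ CliffordAlgebra.contractLeft (LinearMap.proj α : (Fin q → 𝕜) →ₗ[𝕜] 𝕜) w := rfl

lemma leibniz (a : Fin p ⊕ Fin q) (f g : Model q U) :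
    Model.pd U a (f * g) =
      Model.pd U a f * g + (Model.parity q U ^ pe a) f * Model.pd U a g := by
  induction f using TensorProduct.induction_on with
  | zero => simp
  | add f₁ f₂ h₁ h₂ => simp only [add_mul, map_add, h₁, h₂]; abel
  | tmul f v =>
    induction g using TensorProduct.induction_on with
    | zero => simp
    | add g₁ g₂ h₁ h₂ => simp only [mul_add, map_add, h₁, h₂]; abel
    | tmul g w =>
      rcases a with i | α
      · rw [pe_inl, pow_zero, AlgHom.one_apply, Algebra.TensorProduct.tmul_mul_tmul, pd_inl_tmul,
          pd_inl_tmul, pd_inl_tmul, Algebra.TensorProduct.tmul_mul_tmul,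
          Algebra.TensorProduct.tmul_mul_tmul, smoothPd_mul, TensorProduct.add_tmul]
      · rw [pe_inr, pow_one, Algebra.TensorProduct.tmul_mul_tmul, pd_inr_tmul, pd_inr_tmul,
          pd_inr_tmul, parity_tmul, Algebra.TensorProduct.tmul_mul_tmul,
          Algebra.TensorProduct.tmul_mul_tmul, contractLeft_mul, TensorProduct.tmul_add]

lemma parity_pd_inl (i : Fin p) (f : Model q U) :
    Model.parity q U (Model.pd U (.inl i) f) = Model.pd U (.inl i) (Model.parity q U f) := by
  induction f using TensorProduct.induction_on with
  | zero => simp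
  | add f₁ f₂ h₁ h₂ => simp only [map_add, h₁, h₂]
  | tmul f w => rfl

lemma parity_pd_inr (α : Fin q) (f : Model q U) :
    Model.parity q U (Model.pd U (.inr α) f) = -Model.pd U (.inr α) (Model.parity q U f) := by
  induction f using TensorProduct.induction_on with
  | zero => simp
  | add f₁ f₂ h₁ h₂ => simp only [map_add, h₁, h₂, neg_add]
  | tmul f w =>
    rw [parity_tmul, pd_inr_tmul, pd_inr_tmul, parity_tmul, involute_contractLeft,
      TensorProduct.tmul_neg]

lemma pd_inl_comm (i : Fin p) (b : Fin p ⊕ Fin q) (f : Model q U) :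
    Model.pd U (.inl i) (Model.pd U b f) = Model.pd U b (Model.pd U (.inl i) f) := by
  induction f using TensorProduct.induction_on with
  | zero => simp
  | add f₁ f₂ h₁ h₂ => simp only [map_add, h₁, h₂]
  | tmul f w =>
    rcases b with j | β
    · rw [pd_inl_tmul, pd_inl_tmul, pd_inl_tmul, pd_inl_tmul, smoothPd_comm i j]
    · rfl

lemma pd_inr_comm (α β : Fin q) (f : Model q U) :
    Model.pd U (.inr α) (Model.pd U (.inr β) f) =
      -Model.pd U (.inr β) (Model.pd U (.inr α) f) := by
  induction f using TensorProduct.induction_on with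
  | zero => simp
  | add f₁ f₂ h₁ h₂ => simp only [map_add, h₁, h₂, neg_add]
  | tmul f w =>
    rw [pd_inr_tmul, pd_inr_tmul, pd_inr_tmul, pd_inr_tmul, CliffordAlgebra.contractLeft_comm,
      TensorProduct.tmul_neg]

lemma coord_inr (α : Fin q) : Model.coord U (.inr α : Fin p ⊕ Fin q) =
    1 ⊗ₜ ExteriorAlgebra.ι 𝕜 (Pi.single α 1) := rfl

lemma parity_coord_inl (i : Fin p) :
    Model.parity q U (Model.coord U (.inl i)) = Model.coord U (.inl i) := by
  rw [Model.coord, parity_tmul, map_one]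

lemma parity_coord_inr (α : Fin q) :
    Model.parity q U (Model.coord U (.inr α : Fin p ⊕ Fin q)) = -Model.coord U (.inr α) := by
  rw [coord_inr, parity_tmul, ← TensorProduct.tmul_neg]
  exact congrArg _ (CliffordAlgebra.involute_ι _)

lemma smoothPd_one (i : Fin p) : smoothPd U i 1 = 0 := by
  have := smoothPd_mul i (1 : smoothFun U) 1
  simpa using this

lemma pd_coord (a b : Fin p ⊕ Fin q) :
    Model.pd U a (Model.coord U b) = if a = b then 1 else 0 := by
  rcases a with i | α <;> rcases b with j | β
  · refine (congrArg (· ⊗ₜ 1) (smoothPd_coord i j)).trans ?_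
    rcases eq_or_ne i j with rfl | hij
    · rw [if_pos rfl, if_pos rfl]
      rfl
    · simp only [if_neg hij, Sum.inl.injEq, TensorProduct.zero_tmul]
  · rw [Model.coord, pd_inl_tmul, smoothPd_one, TensorProduct.zero_tmul]
    rfl
  · rw [Model.coord, pd_inr_tmul, CliffordAlgebra.contractLeft_one, TensorProduct.tmul_zero]
    rfl
  · have h1 : CliffordAlgebra.contractLeft (LinearMap.proj α : (Fin q → 𝕜) →ₗ[𝕜] 𝕜)
        (ExteriorAlgebra.ι 𝕜 (Pi.single β 1)) = algebraMap 𝕜 _ (if α = β then 1 else 0) := by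
      refine (CliffordAlgebra.contractLeft_ι _ _ _).trans ?_
      rw [LinearMap.proj_apply, Pi.single_apply]
    rw [coord_inr, pd_inr_tmul, h1]
    rcases eq_or_ne α β with rfl | hij
    · rw [if_pos rfl, if_pos rfl, map_one]
      rfl
    · rw [if_neg hij, if_neg (by simpa using hij), map_zero, TensorProduct.tmul_zero]

lemma exteriorAlgebra_decomp (w : ExteriorAlgebra 𝕜 (Fin q → 𝕜)) :
    ∃ (c : 𝕜) (v : Fin q → ExteriorAlgebra 𝕜 (Fin q → 𝕜)),
      w = algebraMap 𝕜 _ c + ∑ α, ExteriorAlgebra.ι 𝕜 (Pi.single α 1) * v α := by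
  induction w using CliffordAlgebra.left_induction with
  | algebraMap r => exact ⟨r, 0, by simp⟩
  | add x y hx hy =>
    obtain ⟨c, v, rfl⟩ := hx
    obtain ⟨d, w, rfl⟩ := hy
    exact ⟨c + d, v + w, by simp only [Pi.add_apply, mul_add, Finset.sum_add_distrib, map_add]; abel⟩
  | ι_mul x m _ =>
    refine ⟨0, fun α => m α • x, ?_⟩
    rw [map_zero, zero_add]
    simp only [mul_smul_comm, ← smul_mul_assoc]
    rw [← Finset.sum_mul]
    congr 1
    simp only [← map_smul]
    rw [← map_sum]
    refine congrArg (ExteriorAlgebra.ι 𝕜) ?_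
    ext α
    simp [Finset.sum_apply, Pi.single_apply]

lemma exists_decomp (f : Model q U) : ∃ (g : smoothFun U) (k : Fin q → Model q U),
    f = g ⊗ₜ 1 + ∑ α, Model.coord U (.inr α) * k α := by
  induction f using TensorProduct.induction_on with
  | zero => exact ⟨0, 0, by simp⟩
  | add x y hx hy =>
    obtain ⟨c, v, rfl⟩ := hx
    obtain ⟨d, w, rfl⟩ := hy
    exact ⟨c + d, v + w, by
      simp only [Pi.add_apply, mul_add, Finset.sum_add_distrib, TensorProduct.add_tmul]; abel⟩
  | tmul f w =>
    obtain ⟨c, v, hw⟩ := exteriorAlgebra_decomp w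
    refine ⟨c • f, fun α => f ⊗ₜ v α, ?_⟩
    rw [hw, TensorProduct.tmul_add, TensorProduct.tmul_sum, Algebra.algebraMap_eq_smul_one,
      TensorProduct.tmul_smul, TensorProduct.smul_tmul']
    simp only [coord_inr, Algebra.TensorProduct.tmul_mul_tmul, one_mul]

/-- Subtracting `ε f = -f` removes the part free of odd coordinates and replaces the coefficients by
their even parts. -/
lemma odd_gen (f : Model q U) (hf : Model.parity q U f = -f) : ∃ k : Fin q → Model q U,
    (∀ α, Model.parity q U (k α) = k α) ∧ f = ∑ α, Model.coord U (.inr α) * k α := by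
  obtain ⟨g, k, hk⟩ := exists_decomp f
  have hinv : ∀ y : Model q U, Model.parity q U (Model.parity q U y) = y := fun y => by
    induction y using TensorProduct.induction_on with
    | zero => simp
    | add x y hx hy => simp only [map_add, hx, hy]
    | tmul f w => simp only [parity_tmul, CliffordAlgebra.involute_involute]
  refine ⟨fun α => (2⁻¹ : 𝕜) • (k α + Model.parity q U (k α)), fun α => ?_, ?_⟩
  · rw [map_smul, map_add, hinv, add_comm]
  · have h1 : f - Model.parity q U f = ∑ α, Model.coord U (.inr α) * k α +
        ∑ α, Model.coord U (.inr α) * Model.parity q U (k α) := by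
      rw [hk, map_add, parity_tmul, map_one, map_sum]
      simp only [map_mul, parity_coord_inr, neg_mul, Finset.sum_neg_distrib]
      rw [sub_add_eq_sub_sub, add_sub_cancel_left, sub_neg_eq_add]
    rw [hf, sub_neg_eq_add, ← two_smul 𝕜, ← Finset.sum_add_distrib] at h1
    simp only [mul_smul_comm, ← Finset.smul_sum, mul_add, ← h1, smul_smul]
    rw [inv_mul_cancel₀ two_ne_zero, one_smul]

/-- The coefficient functions of a superfunction with respect to a linear functional. -/
def coeff (U : Opens (Fin p → 𝕜)) (ξ : ExteriorAlgebra 𝕜 (Fin q → 𝕜) →ₗ[𝕜] 𝕜) :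
    Model q U →ₗ[𝕜] smoothFun U :=
  (TensorProduct.rid 𝕜 (smoothFun U)).toLinearMap ∘ₗ LinearMap.lTensor _ ξ

lemma coeff_tmul (ξ : ExteriorAlgebra 𝕜 (Fin q → 𝕜) →ₗ[𝕜] 𝕜) (f : smoothFun U)
    (w : ExteriorAlgebra 𝕜 (Fin q → 𝕜)) : coeff U ξ (f ⊗ₜ w) = ξ w • f := by
  simp [coeff]

lemma eq_zero_of_coeff {f : Model q U} (h : ∀ ξ, coeff U ξ f = 0) : f = 0 := by
  classical
  let b := Module.Basis.ofVectorSpace 𝕜 (ExteriorAlgebra 𝕜 (Fin q → 𝕜))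
  apply (TensorProduct.equivFinsuppOfBasisRight (M := smoothFun U) b).injective
  ext1 i
  rw [TensorProduct.equivFinsuppOfBasisRight_apply, map_zero, Finsupp.zero_apply]
  exact h (b.coord i)

lemma coeff_pd (ξ : ExteriorAlgebra 𝕜 (Fin q → 𝕜) →ₗ[𝕜] 𝕜) (i : Fin p) (f : Model q U) :
    coeff U ξ (Model.pd U (.inl i) f) = smoothPd U i (coeff U ξ f) := by
  induction f using TensorProduct.induction_on with
  | zero => simp
  | add x y hx hy => simp only [map_add, hx, hy]
  | tmul f w => rw [pd_inl_tmul, coeff_tmul, coeff_tmul, map_smul]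

/-- The value of a superfunction at a point, an element of the exterior algebra. -/
def eval (x : U) : Model q U →ₐ[𝕜] ExteriorAlgebra 𝕜 (Fin q → 𝕜) :=
  Algebra.TensorProduct.lift
    ((Algebra.ofId 𝕜 _).comp ((Pi.evalAlgHom 𝕜 (fun _ : U => 𝕜) x).comp (smoothFun U).val))
    (AlgHom.id 𝕜 _) fun f w => Algebra.commutes (R := 𝕜) (f.1 x) w

lemma eval_tmul (x : U) (f : smoothFun U) (w : ExteriorAlgebra 𝕜 (Fin q → 𝕜)) :
    eval x (f ⊗ₜ w) = f.1 x • w := by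
  rw [Algebra.smul_def]
  exact Algebra.TensorProduct.lift_tmul _ _ _ _ _

lemma coeff_apply (ξ : ExteriorAlgebra 𝕜 (Fin q → 𝕜) →ₗ[𝕜] 𝕜) (f : Model q U) (x : U) :
    (coeff U ξ f).1 x = ξ (eval x f) := by
  induction f using TensorProduct.induction_on with
  | zero => simp
  | add f g hf hg =>
    simp only [map_add, ← hf, ← hg]
    rfl
  | tmul f w =>
    rw [coeff_tmul, eval_tmul, map_smul, smul_eq_mul, mul_comm]
    rfl

/-- The value at a point lies in the exterior algebra and keeps all `θ`-components, so no nilpotent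
information is lost. -/
lemma eq_zero_of_eval {f : Model q U} (h : ∀ x : U, eval x f = 0) : f = 0 := by
  refine eq_zero_of_coeff fun ξ => ?_
  ext x
  rw [coeff_apply, h, map_zero]
  rfl

lemma eval_res {V : Opens (Fin p → 𝕜)} (h : V ≤ U) (x : V) (f : Model q U) :
    eval x (Model.res h f) = eval ⟨x.1, h x.2⟩ f := by
  induction f using TensorProduct.induction_on with
  | zero => simp
  | add f g hf hg => simp only [map_add, hf, hg]
  | tmul f w =>
    rw [eval_tmul]
    exact eval_tmul _ _ _

end Model

end ModelCalculus

/-! ## Primitives with respect to one coordinate -/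

section Analysis

open MeasureTheory

variable {𝕜 : Type u} [RCLike 𝕜] {p : ℕ}

/-- The projection to the `i`-th coordinate axis. -/
def axisProj (𝕜 : Type u) [RCLike 𝕜] (i : Fin p) : (Fin p → 𝕜) →L[𝕜] (Fin p → 𝕜) :=
  (ContinuousLinearMap.single 𝕜 (fun _ : Fin p => 𝕜) i).comp (ContinuousLinearMap.proj i)

lemma axisProj_apply (i : Fin p) (x : Fin p → 𝕜) : axisProj 𝕜 i x = Pi.single i (x i) := rfl

/-- The linear part of `slide`. -/
def slideLin (𝕜 : Type u) [RCLike 𝕜] (i : Fin p) (t : ℝ) : (Fin p → 𝕜) →L[𝕜] (Fin p → 𝕜) :=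
  (ContinuousLinearMap.id 𝕜 _ - axisProj 𝕜 i) + (t : 𝕜) • axisProj 𝕜 i

lemma slideLin_apply (i j : Fin p) (t : ℝ) (x : Fin p → 𝕜) :
    slideLin 𝕜 i t x j = if j = i then t * x i else x j := by
  rcases eq_or_ne j i with rfl | hj
  · simp [slideLin, axisProj_apply, RCLike.real_smul_eq_coe_mul]
  · simp [slideLin, axisProj_apply, hj]

/-- The point `x` with its `i`-th coordinate moved towards that of `x₀`. -/
def slide (i : Fin p) (x₀ : Fin p → 𝕜) (t : ℝ) (x : Fin p → 𝕜) : Fin p → 𝕜 :=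
  x₀ + slideLin 𝕜 i t (x - x₀)

lemma slide_one (i : Fin p) (x₀ x : Fin p → 𝕜) : slide i x₀ 1 x = x := by
  simp [slide, slideLin]

/-- In the sup norm a ball is a product of discs, so one coordinate can be contracted alone. -/
lemma slide_mem {i : Fin p} {x₀ x : Fin p → 𝕜} {r t : ℝ} (hx : x ∈ Metric.ball x₀ r)
    (ht : t ∈ Set.Icc (0 : ℝ) 1) : slide i x₀ t x ∈ Metric.ball x₀ r := by
  have hr := Metric.pos_of_mem_ball hx
  rw [Metric.mem_ball, dist_pi_lt_iff hr] at hx ⊢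
  intro j
  have hxj := hx j
  rw [dist_eq_norm] at hxj ⊢
  rw [slide, Pi.add_apply, add_sub_cancel_left, slideLin_apply]
  split_ifs with h
  · subst h
    rw [norm_mul, RCLike.norm_ofReal, abs_of_nonneg ht.1]
    exact (mul_le_of_le_one_left (norm_nonneg _) ht.2).trans_lt hxj
  · exact hxj

lemma continuous_slideLin (i : Fin p) : Continuous (slideLin 𝕜 i) :=
  continuous_const.add
    (Continuous.smul (f := fun t : ℝ => (t : 𝕜)) RCLike.continuous_ofReal continuous_const)

lemma continuous_slide (i : Fin p) (x₀ : Fin p → 𝕜) :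
    Continuous fun y : (Fin p → 𝕜) × ℝ => slide i x₀ y.2 y.1 :=
  continuous_const.add (((continuous_slideLin i).comp continuous_snd).clm_apply
    (continuous_fst.sub continuous_const))

lemma hasFDerivAt_slide (i : Fin p) (x₀ : Fin p → 𝕜) (t : ℝ) (x : Fin p → 𝕜) :
    HasFDerivAt (slide i x₀ t) (slideLin 𝕜 i t) x := by
  have h1 : HasFDerivAt (fun y => y - x₀) (ContinuousLinearMap.id 𝕜 (Fin p → 𝕜)) x :=
    (hasFDerivAt_id x).sub_const x₀
  exact (((slideLin 𝕜 i t).hasFDerivAt (x := x - x₀)).comp x h1).const_add x₀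

section Smooth

variable {G : Type u} [NormedAddCommGroup G] [NormedSpace ℝ G] [NormedSpace 𝕜 G]

/-- The weighted mean of `f` along the segment from `x` in the direction of the `i`-th axis. -/
def slideInt (𝕜 : Type u) [RCLike 𝕜] {p : ℕ} {G : Type u} [NormedAddCommGroup G] [NormedSpace ℝ G]
    [NormedSpace 𝕜 G] (i : Fin p) (x₀ : Fin p → 𝕜) (k : ℕ) (f : (Fin p → 𝕜) → G)
    (x : Fin p → 𝕜) : G :=
  ∫ t in (0 : ℝ)..1, (t : 𝕜) ^ k • f (slide i x₀ t x)

variable {x₀ : Fin p → 𝕜} {r : ℝ} {f : (Fin p → 𝕜) → G}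

lemma continuousOn_slide (i : Fin p) (k : ℕ) {H : Type*} [NormedAddCommGroup H] [NormedSpace 𝕜 H]
    {f : (Fin p → 𝕜) → H} (hf : ContinuousOn f (Metric.ball x₀ r)) :
    ContinuousOn (fun y : (Fin p → 𝕜) × ℝ => (y.2 : 𝕜) ^ k • f (slide i x₀ y.2 y.1))
      (Metric.ball x₀ r ×ˢ Set.Icc 0 1) :=
  ((RCLike.continuous_ofReal.comp continuous_snd).pow k).continuousOn.smul
    (hf.comp (continuous_slide i x₀).continuousOn fun _ hy => slide_mem hy.1 hy.2)

lemma continuousOn_slide_right (i : Fin p) (k : ℕ) {H : Type*} [NormedAddCommGroup H]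
    [NormedSpace 𝕜 H] {f : (Fin p → 𝕜) → H} (hf : ContinuousOn f (Metric.ball x₀ r))
    {x : Fin p → 𝕜} (hx : x ∈ Metric.ball x₀ r) :
    ContinuousOn (fun t : ℝ => (t : 𝕜) ^ k • f (slide i x₀ t x)) (Set.Icc 0 1) :=
  (continuousOn_slide i k hf).comp (Continuous.prodMk_right x).continuousOn fun _ ht => ⟨hx, ht⟩

lemma intervalIntegrable_slide (i : Fin p) (k : ℕ) (hf : ContinuousOn f (Metric.ball x₀ r))
    {x : Fin p → 𝕜} (hx : x ∈ Metric.ball x₀ r) :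
    IntervalIntegrable (fun t : ℝ => (t : 𝕜) ^ k • f (slide i x₀ t x)) volume 0 1 := by
  apply ContinuousOn.intervalIntegrable
  rw [Set.uIcc_of_le zero_le_one]
  exact continuousOn_slide_right i k hf hx

/-- Differentiation under the integral sign; the derivative of the integrand is bounded on the
compact set of a closed ball around `x` times `[0, 1]`. -/
lemma hasFDerivAt_slideInt (i : Fin p) (k : ℕ) (hf : ContDiffOn 𝕜 ∞ f (Metric.ball x₀ r))
    {x : Fin p → 𝕜} (hx : x ∈ Metric.ball x₀ r) :
    IntervalIntegrable (fun t : ℝ => (t : 𝕜) ^ k •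
        (fderiv 𝕜 f (slide i x₀ t x)).comp (slideLin 𝕜 i t)) volume 0 1 ∧
    HasFDerivAt (slideInt 𝕜 i x₀ k f)
      (∫ t in (0 : ℝ)..1, (t : 𝕜) ^ k • (fderiv 𝕜 f (slide i x₀ t x)).comp (slideLin 𝕜 i t)) x := by
  have hsub : Set.uIoc (0 : ℝ) 1 ⊆ Set.Icc 0 1 := by
    rw [Set.uIoc_of_le zero_le_one]
    exact Set.Ioc_subset_Icc_self
  have hf' : ContinuousOn (fderiv 𝕜 f) (Metric.ball x₀ r) :=
    hf.continuousOn_fderiv_of_isOpen Metric.isOpen_ball (by simp)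
  have hF' : ContinuousOn (fun y : (Fin p → 𝕜) × ℝ =>
      (y.2 : 𝕜) ^ k • (fderiv 𝕜 f (slide i x₀ y.2 y.1)).comp (slideLin 𝕜 i y.2))
      (Metric.ball x₀ r ×ˢ Set.Icc 0 1) := by
    have hk : Continuous fun y : (Fin p → 𝕜) × ℝ => (y.2 : 𝕜) ^ k :=
      (RCLike.continuous_ofReal.comp continuous_snd).pow k
    refine hk.continuousOn.smul ?_
    exact (hf'.comp (continuous_slide i x₀).continuousOn fun y hy => slide_mem hy.1 hy.2).clm_comp
      ((continuous_slideLin i).comp continuous_snd).continuousOn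
  obtain ⟨ρ, hρ, hball⟩ := Metric.nhds_basis_closedBall.mem_iff.1 (Metric.isOpen_ball.mem_nhds hx)
  obtain ⟨C, hC⟩ := ((isCompact_closedBall x ρ).prod
    (isCompact_Icc (a := (0 : ℝ)) (b := 1))).exists_bound_of_continuousOn
      (hF'.mono (Set.prod_mono hball subset_rfl))
  have hF'x : ContinuousOn (fun t : ℝ => (t : 𝕜) ^ k •
      (fderiv 𝕜 f (slide i x₀ t x)).comp (slideLin 𝕜 i t)) (Set.Icc 0 1) :=
    hF'.comp (Continuous.prodMk_right x).continuousOn fun _ ht => ⟨hx, ht⟩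
  refine ⟨?_, intervalIntegral.hasFDerivAt_integral_of_dominated_of_fderiv_le
    (F := fun x t => (t : 𝕜) ^ k • f (slide i x₀ t x))
    (F' := fun x t => (t : 𝕜) ^ k • (fderiv 𝕜 f (slide i x₀ t x)).comp (slideLin 𝕜 i t))
    (bound := fun _ => C) (Metric.closedBall_mem_nhds x hρ) ?_
    (intervalIntegrable_slide i k hf.continuousOn hx) ?_ ?_ intervalIntegrable_const ?_⟩
  · apply ContinuousOn.intervalIntegrable
    rwa [Set.uIcc_of_le zero_le_one]
  · filter_upwards [Metric.isOpen_ball.mem_nhds hx] with y hy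
    exact ((continuousOn_slide_right i k hf.continuousOn hy).mono hsub).aestronglyMeasurable
      measurableSet_uIoc
  · exact (hF'x.mono hsub).aestronglyMeasurable measurableSet_uIoc
  · exact Filter.Eventually.of_forall fun t ht y hy => hC (y, t) ⟨hy, hsub ht⟩
  · refine Filter.Eventually.of_forall fun t ht y hy => ?_
    have hd : HasFDerivAt f (fderiv 𝕜 f (slide i x₀ t y)) (slide i x₀ t y) :=
      ((hf.differentiableOn (by simp)).differentiableAt
        (Metric.isOpen_ball.mem_nhds (slide_mem (hball hy) (hsub ht)))).hasFDerivAt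
    exact (hd.comp y (hasFDerivAt_slide i x₀ t y)).const_smul _

lemma contDiffOn_slideInt (i : Fin p) (k : ℕ) (hf : ContDiffOn 𝕜 ∞ f (Metric.ball x₀ r)) :
    ContDiffOn 𝕜 ∞ (slideInt 𝕜 i x₀ k f) (Metric.ball x₀ r) := by
  rw [contDiffOn_infty]
  intro n
  -- The derivative of a mean is a sum of two means of functions with values in another space, one
  -- of them with weight `k + 1`; hence both the target and the weight vary in the induction.
  induction n generalizing G k with
  | zero =>
    rw [Nat.cast_zero, contDiffOn_zero]
    exact fun x hx => (hasFDerivAt_slideInt i k hf hx).2.continuousAt.continuousWithinAt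
  | succ n ih =>
    rw [Nat.cast_succ, contDiffOn_succ_iff_fderiv_of_isOpen Metric.isOpen_ball]
    refine ⟨fun x hx => (hasFDerivAt_slideInt i k hf hx).2.differentiableAt.differentiableWithinAt,
      fun h => absurd h (by simp), ?_⟩
    have hf' : ContDiffOn 𝕜 ∞ (fderiv 𝕜 f) (Metric.ball x₀ r) :=
      ContDiffOn.fderiv_of_isOpen hf Metric.isOpen_ball (by simp)
    have h1 : ContDiffOn 𝕜 ∞ (fun x => (fderiv 𝕜 f x).comp
        (ContinuousLinearMap.id 𝕜 _ - axisProj 𝕜 i)) (Metric.ball x₀ r) :=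
      hf'.clm_comp contDiffOn_const
    have h2 : ContDiffOn 𝕜 ∞ (fun x => (fderiv 𝕜 f x).comp (axisProj 𝕜 i)) (Metric.ball x₀ r) :=
      hf'.clm_comp contDiffOn_const
    refine ((ih k h1).add (ih (k + 1) h2)).congr fun x hx => ?_
    rw [(hasFDerivAt_slideInt i k hf hx).2.fderiv, slideInt, slideInt,
      ← intervalIntegral.integral_add (intervalIntegrable_slide i k h1.continuousOn hx)
        (intervalIntegrable_slide i (k + 1) h2.continuousOn hx)]
    refine intervalIntegral.integral_congr fun t _ => ?_
    beta_reduce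
    rw [slideLin, ContinuousLinearMap.comp_add, smul_add, ContinuousLinearMap.comp_smul, smul_smul,
      pow_succ]

lemma fderiv_slideInt_apply (i : Fin p) (k : ℕ) (hf : ContDiffOn 𝕜 ∞ f (Metric.ball x₀ r))
    {x : Fin p → 𝕜} (hx : x ∈ Metric.ball x₀ r) (v : Fin p → 𝕜) :
    fderiv 𝕜 (slideInt 𝕜 i x₀ k f) x v =
      ∫ t in (0 : ℝ)..1, (t : 𝕜) ^ k • fderiv 𝕜 f (slide i x₀ t x) (slideLin 𝕜 i t v) := by
  rw [(hasFDerivAt_slideInt i k hf hx).2.fderiv,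
    ContinuousLinearMap.intervalIntegral_apply (hasFDerivAt_slideInt i k hf hx).1]
  rfl

end Smooth

variable {x₀ : Fin p → 𝕜} {r : ℝ} {f : (Fin p → 𝕜) → 𝕜}

/-- Integrate over `[0, 1]` the `t`-derivative of `t ↦ t f(slide i x₀ t x)`. The resulting identity
says that `(x_i - x₀_i)` times the mean is a primitive of `f` in the `i`-th direction. -/
lemma slideInt_add_eq (i : Fin p) (hf : ContDiffOn 𝕜 ∞ f (Metric.ball x₀ r))
    {x : Fin p → 𝕜} (hx : x ∈ Metric.ball x₀ r) :
    slideInt 𝕜 i x₀ 0 f x + (x i - x₀ i) * fderiv 𝕜 (slideInt 𝕜 i x₀ 0 f) x (Pi.single i 1) =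
      f x := by
  have hlin : ∀ t : ℝ, slideLin 𝕜 i t (Pi.single i 1) = (t : 𝕜) • Pi.single i 1 := fun t => by
    ext j
    rw [slideLin_apply]
    rcases eq_or_ne j i with rfl | hj
    · simp
    · simp [hj]
  have hcurve : ∀ t : ℝ, HasDerivAt (fun t : ℝ => slide i x₀ t x)
      ((x i - x₀ i) • (Pi.single i 1 : Fin p → 𝕜)) t := fun t => by
    have h1 : HasDerivAt (fun t : ℝ => (t : 𝕜)) 1 t := by
      simpa using (RCLike.ofRealCLM (K := 𝕜)).hasDerivAt (x := t)
    have h2 := ((h1.smul_const (axisProj 𝕜 i (x - x₀))).const_add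
      ((ContinuousLinearMap.id 𝕜 (Fin p → 𝕜) - axisProj 𝕜 i) (x - x₀))).const_add x₀
    refine h2.congr_deriv ?_
    rw [one_smul, axisProj_apply, Pi.sub_apply, ← Pi.single_smul, smul_eq_mul, mul_one]
  have hderiv : ∀ t ∈ Set.uIcc (0 : ℝ) 1, HasDerivAt (fun t : ℝ => (t : 𝕜) * f (slide i x₀ t x))
      (f (slide i x₀ t x) +
        (x i - x₀ i) * ((t : 𝕜) * fderiv 𝕜 f (slide i x₀ t x) (Pi.single i 1))) t := by
    intro t ht
    rw [Set.uIcc_of_le zero_le_one] at ht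
    have h1 : HasDerivAt (fun t : ℝ => (t : 𝕜)) 1 t := by
      simpa using (RCLike.ofRealCLM (K := 𝕜)).hasDerivAt (x := t)
    have hd : HasFDerivAt f (fderiv 𝕜 f (slide i x₀ t x)) (slide i x₀ t x) :=
      ((hf.differentiableOn (by simp)).differentiableAt
        (Metric.isOpen_ball.mem_nhds (slide_mem hx ht))).hasFDerivAt
    have h2 := (hd.restrictScalars ℝ).comp_hasDerivAt t (hcurve t)
    refine (h1.mul h2).congr_deriv ?_
    simp only [ContinuousLinearMap.coe_restrictScalars', map_smul, smul_eq_mul, Function.comp]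
    ring
  have hf' : ContDiffOn 𝕜 ∞ (fun y => fderiv 𝕜 f y (Pi.single i 1)) (Metric.ball x₀ r) :=
    (ContDiffOn.fderiv_of_isOpen hf Metric.isOpen_ball (by simp)).clm_apply contDiffOn_const
  have i0 := intervalIntegrable_slide i 0 hf.continuousOn hx
  have i1 := intervalIntegrable_slide i 1 hf'.continuousOn hx
  simp only [pow_zero, pow_one, smul_eq_mul, one_mul] at i0 i1
  have key := intervalIntegral.integral_eq_sub_of_hasDerivAt hderiv (i0.add (i1.const_mul _))
  rw [intervalIntegral.integral_add i0 (i1.const_mul _), intervalIntegral.integral_const_mul,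
    slide_one] at key
  rw [fderiv_slideInt_apply i 0 hf hx, slideInt]
  simp only [hlin, map_smul, pow_zero, smul_eq_mul]
  simpa using key

lemma fderiv_slideInt_of_ne {i j : Fin p} (hij : j ≠ i)
    (hf : ContDiffOn 𝕜 ∞ f (Metric.ball x₀ r)) {x : Fin p → 𝕜} (hx : x ∈ Metric.ball x₀ r) :
    fderiv 𝕜 (slideInt 𝕜 i x₀ 0 f) x (Pi.single j 1) =
      slideInt 𝕜 i x₀ 0 (fun y => fderiv 𝕜 f y (Pi.single j 1)) x := by
  have hlin : ∀ t : ℝ, slideLin 𝕜 i t (Pi.single j 1) = Pi.single j 1 := fun t => by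
    ext l
    rw [slideLin_apply]
    rcases eq_or_ne l i with rfl | hl
    · simp [hij.symm]
    · simp [hl]
  rw [fderiv_slideInt_apply i 0 hf hx, slideInt]
  simp only [hlin]

end Analysis

/-! ### Primitives of functions and Hadamard's lemma on a ball -/

section SmoothPrimitive

variable {𝕜 : Type u} [RCLike 𝕜] {p : ℕ} {U : Opens (Fin p → 𝕜)} {x₀ : Fin p → 𝕜} {r : ℝ}
  (hU : (U : Set (Fin p → 𝕜)) = Metric.ball x₀ r)

/-- The `i`-th coordinate as a smooth function. -/
def smoothCoord (U : Opens (Fin p → 𝕜)) (i : Fin p) : smoothFun U :=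
  ⟨fun x => x.1 i, smooth_of_eq (g := fun x => x i) (by fun_prop) fun _ => rfl⟩

lemma Model.coord_inl {q : ℕ} (i : Fin p) :
    Model.coord U (.inl i : Fin p ⊕ Fin q) = smoothCoord U i ⊗ₜ 1 := rfl

include hU in
lemma contDiffOn_extendZero (f : smoothFun U) :
    ContDiffOn 𝕜 ∞ (extendZero f.1) (Metric.ball x₀ r) := hU ▸ f.2

/-- The mean of a smooth function along segments in the direction of the `i`-th axis. -/
def smoothMean (i : Fin p) : smoothFun U →ₗ[𝕜] smoothFun U where
  toFun f := ⟨fun x => slideInt 𝕜 i x₀ 0 (extendZero f.1) x, by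
    refine smooth_of_eq (g := slideInt 𝕜 i x₀ 0 (extendZero f.1)) ?_ fun _ => rfl
    rw [hU]
    exact contDiffOn_slideInt i 0 (contDiffOn_extendZero hU f)⟩
  map_add' f g := by
    ext x
    have hx : x.1 ∈ Metric.ball x₀ r := hU ▸ x.2
    change slideInt 𝕜 i x₀ 0 (extendZero (f + g).1) x.1 =
      slideInt 𝕜 i x₀ 0 (extendZero f.1) x.1 + slideInt 𝕜 i x₀ 0 (extendZero g.1) x.1
    rw [slideInt, slideInt, slideInt, ← intervalIntegral.integral_add
      (intervalIntegrable_slide i 0 (contDiffOn_extendZero hU f).continuousOn hx)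
      (intervalIntegrable_slide i 0 (contDiffOn_extendZero hU g).continuousOn hx)]
    refine intervalIntegral.integral_congr fun t ht => ?_
    rw [Set.uIcc_of_le zero_le_one] at ht
    have hy : slide i x₀ t x.1 ∈ U := by
      have := slide_mem (i := i) hx ht
      rwa [← hU] at this
    have e := fun k : U → 𝕜 => extendZero_apply k ⟨_, hy⟩
    simp only at e
    simp only [e, ← smul_add]
    rfl
  map_smul' c f := by
    ext x
    have hx : x.1 ∈ Metric.ball x₀ r := hU ▸ x.2
    change slideInt 𝕜 i x₀ 0 (extendZero (c • f).1) x.1 =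
      c * slideInt 𝕜 i x₀ 0 (extendZero f.1) x.1
    rw [slideInt, slideInt, ← intervalIntegral.integral_const_mul]
    refine intervalIntegral.integral_congr fun t ht => ?_
    rw [Set.uIcc_of_le zero_le_one] at ht
    have hy : slide i x₀ t x.1 ∈ U := by
      have := slide_mem (i := i) hx ht
      rwa [← hU] at this
    have e := fun k : U → 𝕜 => extendZero_apply k ⟨_, hy⟩
    simp only at e
    simp only [e, pow_zero, one_smul]
    rfl

/-- The primitive with respect to the `i`-th coordinate that vanishes at `x₀ i`. -/
def smoothPrim (i : Fin p) : smoothFun U →ₗ[𝕜] smoothFun U :=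
  LinearMap.mulLeft 𝕜 (smoothCoord U i - algebraMap 𝕜 _ (x₀ i)) ∘ₗ smoothMean hU i

lemma smoothPrim_apply (i : Fin p) (f : smoothFun U) :
    smoothPrim hU i f = (smoothCoord U i - algebraMap 𝕜 _ (x₀ i)) * smoothMean hU i f := rfl

lemma smoothPd_algebraMap (i : Fin p) (c : 𝕜) : smoothPd U i (algebraMap 𝕜 _ c) = 0 := by
  rw [Algebra.algebraMap_eq_smul_one, map_smul, Model.smoothPd_one, smul_zero]

lemma smoothPd_smoothMean (i j : Fin p) (f : smoothFun U) (x : U) :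
    (smoothPd U j (smoothMean hU i f)).1 x =
      fderiv 𝕜 (slideInt 𝕜 i x₀ 0 (extendZero f.1)) x (Pi.single j 1) := by
  have e : extendZero (smoothMean hU i f).1 =ᶠ[nhds x.1] slideInt 𝕜 i x₀ 0 (extendZero f.1) :=
    extendZero_eventuallyEq (g := slideInt 𝕜 i x₀ 0 (extendZero f.1)) (fun y => rfl) x
  rw [smoothPd_apply, e.fderiv_eq]

lemma smoothPd_smoothPrim_self (i : Fin p) (f : smoothFun U) :
    smoothPd U i (smoothPrim hU i f) = f := by
  rw [smoothPrim_apply, smoothPd_mul, map_sub, smoothPd_algebraMap]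
  rw [show smoothPd U i (smoothCoord U i) = 1 from (smoothPd_coord i i).trans (if_pos rfl), sub_zero,
    one_mul]
  ext x
  have hx : x.1 ∈ Metric.ball x₀ r := hU ▸ x.2
  have := slideInt_add_eq i (contDiffOn_extendZero hU f) hx
  rw [extendZero_apply, ← smoothPd_smoothMean hU] at this
  exact this

lemma smoothPd_smoothPrim_of_ne {i j : Fin p} (hij : j ≠ i) (f : smoothFun U) :
    smoothPd U j (smoothPrim hU i f) = smoothPrim hU i (smoothPd U j f) := by
  rw [smoothPrim_apply, smoothPd_mul, map_sub, smoothPd_algebraMap]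
  rw [show smoothPd U j (smoothCoord U i) = 0 from (smoothPd_coord j i).trans (if_neg hij), sub_zero,
    zero_mul, zero_add, smoothPrim_apply]
  congr 1
  ext x
  have hx : x.1 ∈ Metric.ball x₀ r := hU ▸ x.2
  rw [smoothPd_smoothMean, fderiv_slideInt_of_ne hij (contDiffOn_extendZero hU f) hx]
  change slideInt 𝕜 i x₀ 0 (fun y => fderiv 𝕜 (extendZero f.1) y (Pi.single j 1)) x.1 =
    slideInt 𝕜 i x₀ 0 (extendZero (smoothPd U j f).1) x.1
  rw [slideInt, slideInt]
  refine intervalIntegral.integral_congr fun t ht => ?_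
  rw [Set.uIcc_of_le zero_le_one] at ht
  have hy : slide i x₀ t x.1 ∈ U := by
    have := slide_mem (i := i) hx ht
    rwa [← hU] at this
  have e := fun k : U → 𝕜 => extendZero_apply k ⟨_, hy⟩
  simp only at e
  simp only [e]
  rfl

include hU in
lemma smoothFun_const {f : smoothFun U} (hf : ∀ i, smoothPd U i f = 0) (x y : U) :
    f.1 x = f.1 y := by
  rw [← extendZero_apply f.1 x, ← extendZero_apply f.1 y]
  refine Metric.isOpen_ball.is_const_of_fderiv_eq_zero (𝕜 := 𝕜) (s := Metric.ball x₀ r)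
    (convex_ball x₀ r).isPreconnected ((contDiffOn_extendZero hU f).differentiableOn (by simp))
    (fun z hz => ?_) (hU ▸ x.2) (hU ▸ y.2)
  have hz' : z ∈ U := by
    have := hz
    rwa [← hU] at this
  refine ContinuousLinearMap.coe_injective (LinearMap.pi_ext' fun i => LinearMap.ext_ring ?_)
  exact congrFun (congrArg Subtype.val (hf i)) ⟨z, hz'⟩

include hU in
/-- Hadamard's lemma. -/
lemma smoothFun_hadamard (hr : 0 < r) (f : smoothFun U) :
    ∃ (c : 𝕜) (g : Fin p → smoothFun U),
      f = algebraMap 𝕜 _ c + ∑ i, (smoothCoord U i - algebraMap 𝕜 _ (x₀ i)) * g i := by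
  classical
  have hx₀ : x₀ ∈ U := by
    have := Metric.mem_ball_self (x := x₀) hr
    rwa [← hU] at this
  -- The dependence on one coordinate is removed at a time: `h - prim_j ∂_j h` no longer depends on
  -- `z_j`, earlier independences persist because `prim_j` commutes with the other derivatives, and
  -- the part removed is divisible by `z_j - x₀_j`.
  have key : ∀ s : Finset (Fin p), ∃ (h : smoothFun U) (g : Fin p → smoothFun U),
      (∀ i ∈ s, smoothPd U i h = 0) ∧
      f = h + ∑ i ∈ s, (smoothCoord U i - algebraMap 𝕜 _ (x₀ i)) * g i := by
    intro s
    induction s using Finset.induction_on with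
    | empty => exact ⟨f, 0, by simp, by simp⟩
    | insert j s hj ih =>
      obtain ⟨h, g, hh, hf⟩ := ih
      refine ⟨h - smoothPrim hU j (smoothPd U j h),
        Function.update g j (smoothMean hU j (smoothPd U j h)), fun i hi => ?_, ?_⟩
      · rw [map_sub]
        rcases eq_or_ne i j with rfl | hij
        · rw [smoothPd_smoothPrim_self, sub_self]
        · rw [smoothPd_smoothPrim_of_ne hU hij, smoothPd_comm,
            hh i (Finset.mem_of_mem_insert_of_ne hi hij), map_zero, map_zero, sub_zero]
      · rw [Finset.sum_insert hj, Function.update_self, ← smoothPrim_apply, ← add_assoc,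
          sub_add_cancel, hf]
        congr 1
        refine Finset.sum_congr rfl fun i hi => ?_
        rw [Function.update_of_ne (ne_of_mem_of_not_mem hi hj)]
  obtain ⟨h, g, hh, hf⟩ := key Finset.univ
  refine ⟨h.1 ⟨x₀, hx₀⟩, g, ?_⟩
  rw [hf]
  congr 1
  ext x
  exact smoothFun_const hU (fun i => hh i (Finset.mem_univ i)) x ⟨x₀, hx₀⟩

end SmoothPrimitive

/-! ## Coordinate domains with primitives -/

section Primitive

variable {p q : ℕ} {𝕜 : Type u} [RCLike 𝕜] {S : Type u} [Ring S] [Algebra 𝕜 S]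

/-- The operators `prim i` are primitives with respect to the even coordinates. -/
structure IsPrimitive (ε : S →ₐ[𝕜] S) (pd : Fin p ⊕ Fin q → (S →ₗ[𝕜] S))
    (x : Fin p ⊕ Fin q → S) (prim : Fin p → (S →ₗ[𝕜] S)) : Prop where
  par_prim : ∀ i f, ε (prim i f) = prim i (ε f)
  pd_self : ∀ i f, pd (.inl i) (prim i f) = f
  pd_of_ne : ∀ i b f, b ≠ .inl i → pd b (prim i f) = prim i (pd b f)
  mul_x : ∀ i α f, prim i (x (.inr α) * f) = x (.inr α) * prim i f
  -- The only use of connectedness: closed multiples of the product of the odd coordinates are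
  -- constant multiples.
  const : ∀ f, (∀ i, pd (.inl i) f = 0) → ∀ g, f = thetaTop x * g → ∃ c : 𝕜, f = c • thetaTop x

end Primitive

/-! ### Primitives of superfunctions on a ball -/

section ModelPrimitive

variable {𝕜 : Type u} [RCLike 𝕜] {p q : ℕ} {U : Opens (Fin p → 𝕜)} {x₀ : Fin p → 𝕜} {r : ℝ}
  (hU : (U : Set (Fin p → 𝕜)) = Metric.ball x₀ r)

namespace Model

/-- Primitives of superfunctions. -/
def prim (i : Fin p) : Model q U →ₗ[𝕜] Model q U := LinearMap.rTensor _ (smoothPrim hU i)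

lemma prim_tmul (i : Fin p) (f : smoothFun U) (w : ExteriorAlgebra 𝕜 (Fin q → 𝕜)) :
    prim hU i (f ⊗ₜ w) = smoothPrim hU i f ⊗ₜ w := rfl

include hU in
lemma eq_eval_of_pd {f : Model q U} (hf : ∀ i, Model.pd U (.inl i) f = 0) (x : U) :
    f = 1 ⊗ₜ eval x f := by
  rw [← sub_eq_zero]
  refine eq_zero_of_eval fun y => ?_
  have h1 : eval y ((1 : smoothFun U) ⊗ₜ[𝕜] eval x f) = eval x f := by
    rw [eval_tmul]
    exact one_smul _ _
  rw [map_sub, h1, sub_eq_zero]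
  have h2 : ∀ ξ : ExteriorAlgebra 𝕜 (Fin q → 𝕜) →ₗ[𝕜] 𝕜, ξ (eval y f) = ξ (eval x f) := fun ξ => by
    rw [← coeff_apply, ← coeff_apply]
    exact smoothFun_const hU (fun i => by rw [← coeff_pd, hf, map_zero]) y x
  exact (Module.Basis.ofVectorSpace 𝕜 (ExteriorAlgebra 𝕜 (Fin q → 𝕜))).ext_elem fun i =>
    h2 ((Module.Basis.ofVectorSpace 𝕜 _).coord i)

lemma isPrimitive (hr : 0 < r) (h : IsSuperComm (Model.parity q U)) :
    IsPrimitive (Model.parity q U) (Model.pd U) (Model.coord U) (prim hU) where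
  par_prim i f := by
    induction f using TensorProduct.induction_on with
    | zero => simp
    | add f g hf hg => simp only [map_add, hf, hg]
    | tmul f w => rfl
  pd_self i f := by
    induction f using TensorProduct.induction_on with
    | zero => simp
    | add f g hf hg => simp only [map_add, hf, hg]
    | tmul f w => rw [prim_tmul, pd_inl_tmul, smoothPd_smoothPrim_self]
  pd_of_ne i b f hb := by
    induction f using TensorProduct.induction_on with
    | zero => simp
    | add f g hf hg => simp only [map_add, hf, hg]
    | tmul f w =>
      rcases b with j | β
      · rw [prim_tmul, pd_inl_tmul, pd_inl_tmul, prim_tmul, smoothPd_smoothPrim_of_ne]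
        rintro rfl
        exact hb rfl
      · rfl
  mul_x i α f := by
    induction f using TensorProduct.induction_on with
    | zero => simp
    | add f g hf hg => simp only [mul_add, map_add, hf, hg]
    | tmul f w =>
      rw [coord_inr, Algebra.TensorProduct.tmul_mul_tmul, prim_tmul, prim_tmul,
        Algebra.TensorProduct.tmul_mul_tmul, one_mul, one_mul]
  const f hf g hg := by
    have hx₀ : x₀ ∈ U := by
      have := Metric.mem_ball_self (x := x₀) hr
      rwa [← hU] at this
    let x : U := ⟨x₀, hx₀⟩
    -- The function is determined by its value at the centre. There only the constant term `c` of
    -- `g` survives multiplication by the product of all odd coordinates.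
    obtain ⟨c, v, hv⟩ := exteriorAlgebra_decomp (eval x g)
    have h1 : thetaTop (Model.coord U) = (1 : smoothFun U) ⊗ₜ[𝕜]
        eval x (thetaTop (Model.coord (q := q) U)) := by
      rw [thetaTop, map_list_prod, List.map_ofFn]
      have : (Algebra.TensorProduct.includeRight : _ →ₐ[𝕜] Model q U)
          (List.ofFn ((eval x) ∘ fun α => Model.coord U (Sum.inr α))).prod =
          (List.ofFn fun α => Model.coord U (Sum.inr α)).prod := by
        rw [map_list_prod, List.map_ofFn]
        congr 2
        funext α
        change (1 : smoothFun U) ⊗ₜ[𝕜] eval x (Model.coord U (Sum.inr α)) = Model.coord U (Sum.inr α)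
        rw [coord_inr, eval_tmul]
        congr 1
        exact one_smul _ _
      exact this.symm
    have h2 : ∀ α, eval x (thetaTop (Model.coord (q := q) U)) * ExteriorAlgebra.ι 𝕜 (Pi.single α 1) = 0 := by
      intro α
      have h3 : thetaTop (Model.coord (q := q) U) * Model.coord U (.inr α) = 0 :=
        prod_mul_of_mem h (parity_coord_inr α) (List.mem_ofFn.2 ⟨α, rfl⟩)
      have h4 : eval x (Model.coord U (.inr α : Fin p ⊕ Fin q)) =
          ExteriorAlgebra.ι 𝕜 (Pi.single α 1) := by
        rw [coord_inr, eval_tmul]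
        exact one_smul _ _
      rw [← h4, ← map_mul, h3, map_zero]
    refine ⟨c, ?_⟩
    rw [eq_eval_of_pd hU hf x, hg, map_mul, hv, mul_add, Finset.mul_sum]
    simp only [← mul_assoc, h2, zero_mul, Finset.sum_const_zero, add_zero]
    rw [← Algebra.commutes, ← Algebra.smul_def, TensorProduct.tmul_smul, ← h1]

end Model

end ModelPrimitive

/-! ## The grading of polyfields -/

section Grading

variable {p q : ℕ} {𝕜 : Type u} [RCLike 𝕜] {S : Type u} [Ring S] [Algebra 𝕜 S]
  {ε : S →ₐ[𝕜] S}

/-- The polyfields of polynomial degree `p - i`. -/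
def homog (p q : ℕ) (𝕜 : Type u) [RCLike 𝕜] (S : Type u) [Ring S] [Algebra 𝕜 S] (i : ℤ) :
    Submodule 𝕜 (Mon p q →₀ S) :=
  Finsupp.supported S 𝕜 {n | (p : ℤ) - n.deg = i}

lemma single_mem_homog {i : ℤ} {n : Mon p q} (hn : (p : ℤ) - n.deg = i) (f : S) :
    Finsupp.single n f ∈ homog p q 𝕜 S i :=
  Finsupp.single_mem_supported 𝕜 f hn

lemma zsmul_single_mem_homog {i : ℤ} {n : Mon p q} {c : ℤ} (hn : c ≠ 0 → (p : ℤ) - n.deg = i)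
    (f : S) : c • Finsupp.single n f ∈ homog p q 𝕜 S i := by
  rcases eq_or_ne c 0 with rfl | hc
  · rw [zero_smul]
    exact zero_mem _
  · exact zsmul_mem (single_mem_homog (hn hc) f) c

lemma map_mem_homog {i j : ℤ} (F : (Mon p q →₀ S) →ₗ[𝕜] (Mon p q →₀ S))
    (hF : ∀ n f, (p : ℤ) - n.deg = i → F (Finsupp.single n f) ∈ homog p q 𝕜 S j)
    {s : Mon p q →₀ S} (hs : s ∈ homog p q 𝕜 S i) : F s ∈ homog p q 𝕜 S j := by
  rw [← s.sum_single, Finsupp.sum, map_sum]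
  exact sum_mem fun n hn => hF n _ (hs hn)

lemma deg_mulMon {a : Fin p ⊕ Fin q} {n : Mon p q} (h : mulCoeff a n ≠ 0) :
    (mulMon a n).deg = n.deg + 1 := by
  rcases a with i | α
  · have hi : i ∉ n.1 := fun hi => h (mulCoeff_of_mem hi)
    simp only [Mon.deg, mulMon, Finset.card_insert_of_notMem hi]
    ring
  · simp only [Mon.deg, mulMon]
    rw [Finsupp.sum_add_index' (fun _ => rfl) fun _ _ _ => rfl, Finsupp.sum_single_index rfl]
    ring

lemma deg_contrMon {a : Fin p ⊕ Fin q} {n : Mon p q} (h : contrCoeff a n ≠ 0) :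
    (contrMon a n).deg + 1 = n.deg := by
  rcases a with i | α
  · have hi : i ∈ n.1 := by
      by_contra hi
      exact h (contrCoeff_of_notMem hi)
    have := Finset.card_erase_add_one hi
    simp only [Mon.deg, contrMon]
    omega
  · have hn : n.2 α ≠ 0 := fun e => h (by simp [contrCoeff, e])
    have e : n.2 - Finsupp.single α 1 + Finsupp.single α 1 = n.2 :=
      tsub_add_cancel_of_le (by simpa [Finsupp.single_le_iff] using Nat.one_le_iff_ne_zero.2 hn)
    have h2 : (n.2.sum fun _ k => k) = ((n.2 - Finsupp.single α 1).sum fun _ k => k) + 1 := by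
      conv_lhs => rw [← e]
      rw [Finsupp.sum_add_index' (fun _ => rfl) fun _ _ _ => rfl, Finsupp.sum_single_index rfl]
    simp only [Mon.deg, contrMon]
    omega

lemma leftMul_mem_homog (h : IsSuperComm ε) (a : Fin p ⊕ Fin q) {i : ℤ} {s : Mon p q →₀ S}
    (hs : s ∈ homog p q 𝕜 S i) : leftMul ε.toLinearMap a s ∈ homog p q 𝕜 S (i - 1) := by
  refine map_mem_homog _ (fun n f hn => ?_) hs
  rw [leftMul_single h]
  refine zsmul_single_mem_homog (fun hc => ?_) _
  rw [deg_mulMon hc]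
  push_cast
  omega

lemma contr_mem_homog (a : Fin p ⊕ Fin q) {i : ℤ} {s : Mon p q →₀ S}
    (hs : s ∈ homog p q 𝕜 S i) : contr ε a s ∈ homog p q 𝕜 S (i + 1) := by
  refine map_mem_homog _ (fun n f hn => ?_) hs
  rw [contr_single]
  refine zsmul_single_mem_homog (fun hc => ?_) _
  have := deg_contrMon hc
  omega

lemma parOp_mem_homog {i : ℤ} {s : Mon p q →₀ S} (hs : s ∈ homog p q 𝕜 S i) :
    parOp ε s ∈ homog p q 𝕜 S i := by
  refine map_mem_homog _ (fun n f hn => ?_) hs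
  rw [parOp_single]
  exact zsmul_single_mem_homog (fun _ => hn) _

lemma coeffMap_mem_homog (d : S →ₗ[𝕜] S) {i : ℤ} {s : Mon p q →₀ S}
    (hs : s ∈ homog p q 𝕜 S i) : coeffMap d s ∈ homog p q 𝕜 S i := by
  refine map_mem_homog _ (fun n f hn => ?_) hs
  rw [coeffMap_single]
  exact single_mem_homog hn _

lemma smul_mem_homog (f : S) {i : ℤ} {s : Mon p q →₀ S}
    (hs : s ∈ homog p q 𝕜 S i) : f • s ∈ homog p q 𝕜 S i :=
  fun _ hn => hs (Finsupp.support_smul hn)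

lemma IsCoordSystem.delta_mem_homog {pd : Fin p ⊕ Fin q → (S →ₗ[𝕜] S)} {x : Fin p ⊕ Fin q → S}
    (h : IsCoordSystem ε pd x) {i : ℤ} {s : Mon p q →₀ S} (hs : s ∈ homog p q 𝕜 S i) :
    coordDelta ε.toLinearMap pd s ∈ homog p q 𝕜 S (i + 1) := by
  rw [h.coordDelta_eq]
  exact neg_mem (sum_mem fun a _ => contr_mem_homog a (coeffMap_mem_homog _ (parOp_mem_homog hs)))

lemma subst_mem_homog (h : IsSuperComm ε) (J : Matrix (Fin p ⊕ Fin q) (Fin p ⊕ Fin q) S) {i : ℤ}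
    {s : Mon p q →₀ S} (hs : s ∈ homog p q 𝕜 S i) :
    subst ε.toLinearMap J s ∈ homog p q 𝕜 S i := by
  refine map_mem_homog _ (fun n f hn => ?_) hs
  rw [subst_single, substMon_eq]
  refine smul_mem_homog f ?_
  have hlen : (n.word.length : ℤ) = n.deg := by
    rw [Mon.word, List.length_append, List.length_map, Finset.length_sort, List.length_flatMap,
      Mon.deg, Finsupp.sum_fintype _ _ fun _ => rfl, ← List.ofFn_eq_map]
    simp [List.sum_ofFn]
  have key : ∀ l : List (Fin p ⊕ Fin q),
      l.foldr (fun a s => leftMulRow ε J a s) (Finsupp.single (∅, 0) 1) ∈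
        homog p q 𝕜 S (p - l.length) := by
    intro l
    induction l with
    | nil => exact single_mem_homog (by simp [Mon.deg]) _
    | cons a l ih =>
      rw [List.foldr_cons, leftMulRow_apply, List.length_cons, Nat.cast_succ, ← sub_sub]
      exact sum_mem fun b _ => smul_mem_homog _ (leftMul_mem_homog h b ih)
  have := key n.word
  rwa [hlen, hn] at this

end Grading

/-! ## The Poincaré lemma in coordinates with primitives -/

section Poincare

variable {p q : ℕ} {𝕜 : Type u} [RCLike 𝕜] {S : Type u} [Ring S] [Algebra 𝕜 S]
  {ε : S →ₐ[𝕜] S} {pd : Fin p ⊕ Fin q → (S →ₗ[𝕜] S)} {x : Fin p ⊕ Fin q → S}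
  {prim : Fin p → (S →ₗ[𝕜] S)}

namespace IsCoordSystem

lemma parOp_delta (h : IsCoordSystem ε pd x) (s : Mon p q →₀ S) :
    parOp ε (coordDelta ε.toLinearMap pd s) = -coordDelta ε.toLinearMap pd (parOp ε s) := by
  rw [h.coordDelta_eq, h.coordDelta_eq, map_neg, map_sum]
  congr 1
  rw [← Finset.sum_neg_distrib]
  refine Finset.sum_congr rfl fun a _ => ?_
  rw [parOp_contr, h.parOp_pd, map_zsmul, smul_smul, ← pow_add]
  rcases a with i | α
  · simp
  · simp

end IsCoordSystem

/-- The homotopy operator of an even coordinate. -/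
def homotopyEven (ε : S →ₐ[𝕜] S) (prim : Fin p → (S →ₗ[𝕜] S)) (i : Fin p)
    (s : Mon p q →₀ S) : Mon p q →₀ S :=
  -leftMul ε.toLinearMap (.inl i) (coeffMap (prim i) (parOp ε s))

/-- Up to sign, contracting `π∂_{z_i}` and multiplying it back is the projection onto monomials that
contain it. -/
lemma leftMul_contr_inl (h : IsSuperComm ε) (i : Fin p) (n : Mon p q) (f : S) :
    leftMul ε.toLinearMap (.inl i) (contr ε (.inl i) (Finsupp.single n f)) =
      if i ∈ n.1 then -Finsupp.single n f else 0 := by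
  rw [contr_single]
  split_ifs with hi
  · have e1 : (insert i (n.1.erase i), n.2) = n := by simp [hi]
    have e2 : (n.1.erase i).filter (· < i) = n.1.filter (· < i) := by
      ext j; simp +contextual [ne_of_lt]
    have e3 : (-1 : ℤ) ^ (n.1.filter (· < i)).card * (-1) ^ (n.1.filter (· < i)).card = 1 := by
      rw [← pow_add, Even.neg_one_pow ⟨_, rfl⟩]
    have e4 : (ε ^ (pe (Sum.inl i : Fin p ⊕ Fin q) + 1))
        ((ε ^ (pe (Sum.inl i : Fin p ⊕ Fin q) + 1)) f) = f := by
      simp [h.invol]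
    rw [contrCoeff_of_mem hi, map_zsmul, leftMul_single h, e4, mulMon, contrMon, e1,
      mulCoeff_of_notMem (by simp), e2, smul_smul, neg_mul, e3, neg_smul, one_smul]
  · rw [contrCoeff_of_notMem hi, zero_smul, map_zero]

lemma leftMul_contr_inl_apply (h : IsSuperComm ε) (i : Fin p) (s : Mon p q →₀ S) (n : Mon p q) :
    leftMul ε.toLinearMap (.inl i) (contr ε (.inl i) s) n = if i ∈ n.1 then -s n else 0 := by
  induction s using Finsupp.induction_linear with
  | zero => simp
  | add s t hs ht =>
    simp only [map_add, Finsupp.add_apply, hs, ht]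
    split_ifs
    · rw [neg_add]
    · rw [add_zero]
  | single m f =>
    rw [leftMul_contr_inl h]
    rcases eq_or_ne m n with rfl | hmn
    · split_ifs <;> simp
    · rw [Finsupp.single_eq_of_ne hmn.symm, neg_zero, ite_self]
      split_ifs
      · rw [Finsupp.neg_apply, Finsupp.single_eq_of_ne hmn.symm, neg_zero]
      · rfl

namespace IsPrimitive

variable (hp : IsPrimitive ε pd x prim)
include hp

lemma parOp_prim (i : Fin p) (t : Mon p q →₀ S) :
    parOp ε (coeffMap (prim i) t) = coeffMap (prim i) (parOp ε t) := by
  induction t using Finsupp.induction_linear with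
  | zero => simp only [map_zero]
  | add s t hs ht => simp only [map_add, hs, ht]
  | single n f =>
    rw [coeffMap_single, parOp_single, parOp_single, map_zsmul, coeffMap_single, hp.par_prim]

lemma contr_prim (i : Fin p) (a : Fin p ⊕ Fin q) (t : Mon p q →₀ S) :
    contr ε a (coeffMap (prim i) t) = coeffMap (prim i) (contr ε a t) := by
  have hpow : ∀ k f, (ε ^ k) (prim i f) = prim i ((ε ^ k) f) := by
    intro k
    induction k with
    | zero => exact fun f => rfl
    | succ k ih =>
      intro f
      rw [pow_succ, AlgHom.mul_apply, AlgHom.mul_apply, hp.par_prim, ih]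
  induction t using Finsupp.induction_linear with
  | zero => simp only [map_zero]
  | add s t hs ht => simp only [map_add, hs, ht]
  | single n f =>
    rw [coeffMap_single, contr_single, contr_single, map_zsmul, coeffMap_single, hpow]

lemma pd_prim_of_ne (i : Fin p) {b : Fin p ⊕ Fin q} (hb : b ≠ .inl i) (t : Mon p q →₀ S) :
    coeffMap (pd b) (coeffMap (prim i) t) = coeffMap (prim i) (coeffMap (pd b) t) := by
  ext n
  exact hp.pd_of_ne i b _ hb

lemma pd_prim_self (i : Fin p) (t : Mon p q →₀ S) :
    coeffMap (pd (.inl i)) (coeffMap (prim i) t) = t := by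
  ext n
  exact hp.pd_self i _

/-- Integration in `z_i` commutes with every ingredient of `δ` except `∂_i`, where it is only a
right inverse; the last term is this defect. -/
lemma delta_prim (h : IsCoordSystem ε pd x) (i : Fin p) (t : Mon p q →₀ S) :
    coordDelta ε.toLinearMap pd (coeffMap (prim i) t) =
      coeffMap (prim i) (coordDelta ε.toLinearMap pd t) - contr ε (.inl i)
        (parOp ε t - coeffMap (prim i) (coeffMap (pd (.inl i)) (parOp ε t))) := by
  rw [h.coordDelta_eq, h.coordDelta_eq, map_neg, map_sum, ← neg_add', neg_inj,
    ← Finset.sum_erase_add _ _ (Finset.mem_univ (Sum.inl i)),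
    ← Finset.sum_erase_add (a := Sum.inl i) _ _ (Finset.mem_univ _), add_assoc]
  congr 1
  · refine Finset.sum_congr rfl fun a ha => ?_
    rw [hp.parOp_prim, hp.pd_prim_of_ne i (Finset.ne_of_mem_erase ha), hp.contr_prim]
  · rw [hp.parOp_prim, hp.pd_prim_self, map_sub, hp.contr_prim, add_sub_cancel]

/-- The homotopy formula for `z_i`. The right-hand side is the identity minus the projection that
keeps the monomials containing `π∂_{z_i}` and replaces a coefficient by its part independent of
`z_i`, namely `f - prim_i ∂_i f`. -/
lemma homotopyEven_delta (h : IsCoordSystem ε pd x) (i : Fin p) (s : Mon p q →₀ S) :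
    coordDelta ε.toLinearMap pd (homotopyEven ε prim i s) +
      homotopyEven ε prim i (coordDelta ε.toLinearMap pd s) =
    s + leftMul ε.toLinearMap (.inl i) (contr ε (.inl i)
      (s - coeffMap (prim i) (coeffMap (pd (.inl i)) s))) := by
  have e2 := hp.delta_prim h i (parOp ε s)
  rw [parOp_parOp h.toIsSuperComm] at e2
  rw [homotopyEven, homotopyEven, map_neg, h.delta_leftMul, hp.parOp_prim, hp.pd_prim_self,
    parOp_parOp h.toIsSuperComm, e2, h.parOp_delta, map_neg, map_neg, neg_neg, map_sub]
  abel

end IsPrimitive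

lemma leftMul_inr_single (h : IsSuperComm ε) (α : Fin q) (n : Mon p q) (f : S) :
    leftMul ε.toLinearMap (.inr α) (Finsupp.single n f) =
      Finsupp.single (n.1, n.2 + Finsupp.single α 1) f := by
  rw [leftMul_single h, pe_inr, h.pow_even ⟨1, rfl⟩]
  exact one_smul _ _

lemma contr_inr_single (h : IsSuperComm ε) (α : Fin q) (n : Mon p q) (f : S) :
    contr ε (.inr α) (Finsupp.single n f) =
      (n.2 α : 𝕜) • Finsupp.single (n.1, n.2 - Finsupp.single α 1) f := by
  rw [contr_single, pe_inr, h.pow_even ⟨1, rfl⟩]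
  exact (Nat.cast_smul_eq_nsmul ℤ _ _).trans (Nat.cast_smul_eq_nsmul 𝕜 _ _).symm

variable (𝕜 p S) in
/-- The weight `(m_α + 1)⁻¹` on monomials with exponents `m`. -/
def weight (α : Fin q) : (Mon p q →₀ S) →ₗ[𝕜] (Mon p q →₀ S) :=
  Finsupp.lsum 𝕜 fun n : Mon p q => ((n.2 α + 1 : 𝕜)⁻¹) • Finsupp.lsingle n

lemma weight_single (α : Fin q) (n : Mon p q) (f : S) :
    weight p 𝕜 S α (Finsupp.single n f) = ((n.2 α + 1 : 𝕜)⁻¹) • Finsupp.single n f := by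
  rw [weight, Finsupp.lsum_single]
  rfl

/-- Contracting `(π∂_{θ_α})^{m+1}` produces the factor `m + 1`, which the weight divides out; this
uses characteristic zero. -/
lemma contr_leftMul_weight (h : IsSuperComm ε) (α : Fin q) (t : Mon p q →₀ S) :
    contr ε (.inr α) (leftMul ε.toLinearMap (.inr α) (weight p 𝕜 S α t)) = t := by
  induction t using Finsupp.induction_linear with
  | zero => simp only [map_zero]
  | add s t hs ht => simp only [map_add, hs, ht]
  | single n f =>
    rw [weight_single, map_smul, map_smul, leftMul_inr_single h, contr_inr_single h, smul_smul]
    simp only [Finsupp.add_apply, Finsupp.single_eq_same, add_tsub_cancel_right]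
    rw [Nat.cast_add, Nat.cast_one, inv_mul_cancel₀ (Nat.cast_add_one_ne_zero _), one_smul]

/-- On exponent `m > 0` the three factors are `m/(m+1) - 1 + 1/(m+1) = 0`; on exponent `0` only the
last term, equal to `1`, remains. -/
lemma leftMul_contr_weight (h : IsSuperComm ε) (α : Fin q) (t : Mon p q →₀ S) :
    leftMul ε.toLinearMap (.inr α) (contr ε (.inr α) (weight p 𝕜 S α t)) -
      leftMul ε.toLinearMap (.inr α) (weight p 𝕜 S α (contr ε (.inr α) t)) + weight p 𝕜 S α t =
      t.filter fun n => n.2 α = 0 := by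
  induction t using Finsupp.induction_linear with
  | zero => simp only [map_zero, Finsupp.filter_zero, sub_zero, add_zero]
  | add s t hs ht =>
    rw [Finsupp.filter_add, ← hs, ← ht]
    simp only [map_add]
    abel
  | single n f =>
    rw [weight_single, map_smul, map_smul, contr_inr_single h, map_smul, map_smul, map_smul,
      weight_single, map_smul, leftMul_inr_single h, smul_smul, smul_smul]
    simp only [Finsupp.coe_tsub, Pi.sub_apply, Finsupp.single_eq_same]
    by_cases hn : n.2 α = 0
    · rw [Finsupp.filter_single_of_pos (fun n : Mon p q => n.2 α = 0) hn, hn]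
      simp
    · have e : n.2 - Finsupp.single α 1 + Finsupp.single α 1 = n.2 :=
        tsub_add_cancel_of_le (by simpa [Finsupp.single_le_iff] using Nat.one_le_iff_ne_zero.2 hn)
      rw [Finsupp.filter_single_of_neg (fun n : Mon p q => n.2 α = 0) hn, e, ← sub_smul, ← add_smul]
      obtain ⟨m, hm⟩ := Nat.exists_eq_succ_of_ne_zero hn
      rw [hm]
      have h1 : (m + 1 : 𝕜) ≠ 0 := Nat.cast_add_one_ne_zero m
      have h2 : (m + 1 + 1 : 𝕜) ≠ 0 := mod_cast Nat.cast_add_one_ne_zero (R := 𝕜) (m + 1)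
      have h3 : ((m.succ : 𝕜) + 1)⁻¹ * (m.succ : 𝕜) -
          (m.succ : 𝕜) * (((m.succ - 1 : ℕ) : 𝕜) + 1)⁻¹ + ((m.succ : 𝕜) + 1)⁻¹ = 0 := by
        rw [Nat.succ_sub_one, Nat.cast_succ]
        field_simp
        ring
      rw [h3, zero_smul]

lemma parOp_weight (α : Fin q) (t : Mon p q →₀ S) :
    parOp ε (weight p 𝕜 S α t) = weight p 𝕜 S α (parOp ε t) := by
  induction t using Finsupp.induction_linear with
  | zero => simp only [map_zero]
  | add s t hs ht => simp only [map_add, hs, ht]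
  | single n f =>
    rw [weight_single, map_smul, parOp_single, map_zsmul, weight_single, smul_comm]

lemma coeffMap_weight (d : S →ₗ[𝕜] S) (α : Fin q) (t : Mon p q →₀ S) :
    coeffMap d (weight p 𝕜 S α t) = weight p 𝕜 S α (coeffMap d t) := by
  induction t using Finsupp.induction_linear with
  | zero => simp only [map_zero]
  | add s t hs ht => simp only [map_add, hs, ht]
  | single n f =>
    rw [weight_single, map_smul, coeffMap_single, weight_single]

lemma contr_weight_of_ne {a : Fin p ⊕ Fin q} {α : Fin q} (ha : a ≠ .inr α) (t : Mon p q →₀ S) :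
    contr ε a (weight p 𝕜 S α t) = weight p 𝕜 S α (contr ε a t) := by
  induction t using Finsupp.induction_linear with
  | zero => simp only [map_zero]
  | add s t hs ht => simp only [map_add, hs, ht]
  | single n f =>
    rw [weight_single, map_smul, contr_single, map_zsmul, weight_single, smul_comm]
    have : (contrMon a n).2 α = n.2 α := by
      rcases a with i | β
      · rfl
      · have hβ : α ≠ β := fun e => ha (by rw [e])
        simp [contrMon, hβ]
    rw [this]

/-- The homotopy operator of an odd coordinate. -/
def homotopyOdd (ε : S →ₐ[𝕜] S) (x : Fin p ⊕ Fin q → S) (α : Fin q) (s : Mon p q →₀ S) :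
    Mon p q →₀ S :=
  x (.inr α) • leftMul ε.toLinearMap (.inr α) (weight p 𝕜 S α (parOp ε s))

/-- Only contraction by `dθ_α` changes the exponent `m_α`, so only that summand of `δ` fails to
commute with the weight. -/
lemma IsCoordSystem.delta_weight (h : IsCoordSystem ε pd x) (α : Fin q) (t : Mon p q →₀ S) :
    coordDelta ε.toLinearMap pd (weight p 𝕜 S α t) =
      weight p 𝕜 S α (coordDelta ε.toLinearMap pd t) -
        (contr ε (.inr α) (weight p 𝕜 S α (coeffMap (pd (.inr α)) (parOp ε t))) -
          weight p 𝕜 S α (contr ε (.inr α) (coeffMap (pd (.inr α)) (parOp ε t)))) := by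
  rw [h.coordDelta_eq, h.coordDelta_eq, map_neg, map_sum, ← neg_add', neg_inj,
    ← Finset.sum_erase_add _ _ (Finset.mem_univ (Sum.inr α)),
    ← Finset.sum_erase_add (a := Sum.inr α) _ _ (Finset.mem_univ _), add_assoc]
  congr 1
  · refine Finset.sum_congr rfl fun a ha => ?_
    rw [parOp_weight, coeffMap_weight, contr_weight_of_ne (Finset.ne_of_mem_erase ha)]
  · rw [parOp_weight, coeffMap_weight, add_sub_cancel]

/-- The homotopy formula for `θ_α`. The projection subtracted from the identity keeps the monomials
free of `π∂_{θ_α}` and the part `θ_α ∂_α f` of a coefficient that is divisible by `θ_α`. -/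
lemma IsCoordSystem.homotopyOdd_delta (h : IsCoordSystem ε pd x) (α : Fin q) (s : Mon p q →₀ S) :
    coordDelta ε.toLinearMap pd (homotopyOdd ε x α s) +
      homotopyOdd ε x α (coordDelta ε.toLinearMap pd s) =
    s - x (.inr α) • (coeffMap (pd (.inr α)) s).filter fun n => n.2 α = 0 := by
  have hs := h.toIsSuperComm
  -- Differentiating the factor `x_α` of the homotopy gives back `s`, because contraction undoes the
  -- weighted multiplication.
  have e1 : ∑ a, pd a ((ε ^ pe a) (x (.inr α))) •
      contr ε a (parOp ε (leftMul ε.toLinearMap (.inr α) (weight p 𝕜 S α (parOp ε s)))) = -s := by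
    rw [Finset.sum_eq_single (Sum.inr α)]
    · rw [pe_inr, pow_one, h.odd_x, map_neg, h.pd_x, if_pos rfl, neg_smul, one_smul,
        parOp_leftMul hs, pe_inr, Even.neg_one_pow ⟨1, rfl⟩, one_smul, parOp_weight,
        parOp_parOp hs, contr_leftMul_weight hs]
    · intro a _ ha
      rw [h.pd_pow, h.pd_x, if_neg ha, map_zero, smul_zero, zero_smul]
    · simp
  have e2 := h.delta_weight α (parOp ε s)
  rw [parOp_parOp hs] at e2
  rw [homotopyOdd, homotopyOdd, h.delta_smul, e1, h.delta_leftMul, parOp_weight, parOp_parOp hs,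
    e2, h.parOp_delta, map_neg, map_neg, coeffMap_weight, ← leftMul_contr_weight hs]
  simp only [map_sub, smul_sub, smul_add, smul_neg]
  abel

end Poincare

/-! ### Reduction of closed forms to multiples of the generator -/

section Reduction

variable {p q : ℕ} {𝕜 : Type u} [RCLike 𝕜] {S : Type u} [Ring S] [Algebra 𝕜 S]
  {ε : S →ₐ[𝕜] S} {pd : Fin p ⊕ Fin q → (S →ₗ[𝕜] S)} {x : Fin p ⊕ Fin q → S}
  {prim : Fin p → (S →ₗ[𝕜] S)}

/-- The polyfields fixed by the projection that belongs to the coordinate `a`. -/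
def IsReduced (pd : Fin p ⊕ Fin q → (S →ₗ[𝕜] S)) (x : Fin p ⊕ Fin q → S) (s : Mon p q →₀ S) :
    Fin p ⊕ Fin q → Prop
  | .inl i => ∀ n, (i ∉ n.1 → s n = 0) ∧ pd (.inl i) (s n) = 0
  | .inr α => ∀ n, (n.2 α ≠ 0 → s n = 0) ∧ x (.inr α) * s n = 0

namespace IsCoordSystem

lemma weight_mem_homog (α : Fin q) {i : ℤ} {s : Mon p q →₀ S} (hs : s ∈ homog p q 𝕜 S i) :
    weight p 𝕜 S α s ∈ homog p q 𝕜 S i := by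
  refine map_mem_homog _ (fun n f hn => ?_) hs
  rw [weight_single]
  exact Submodule.smul_mem _ _ (single_mem_homog hn f)

variable (h : IsCoordSystem ε pd x)
include h

lemma pd_x_mul_self (α : Fin q) (f : S) :
    pd (.inr α) (x (.inr α) * f) = f - x (.inr α) * pd (.inr α) f := by
  rw [h.leibniz, h.pd_x, if_pos rfl, one_mul, pe_inr, pow_one, h.odd_x, neg_mul, sub_eq_add_neg]

lemma pd_x_mul_of_ne {α β : Fin q} (hαβ : α ≠ β) (f : S) :
    pd (.inr α) (x (.inr β) * f) = -(x (.inr β) * pd (.inr α) f) := by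
  rw [h.leibniz, h.pd_x, if_neg (by simpa using hαβ), zero_mul, zero_add, pe_inr, pow_one, h.odd_x,
    neg_mul]

lemma pd_inl_x_mul (i : Fin p) (α : Fin q) (f : S) :
    pd (.inl i) (x (.inr α) * f) = x (.inr α) * pd (.inl i) f := by
  rw [h.leibniz, h.pd_x, if_neg (by simp), zero_mul, zero_add, pe_inl, pow_zero, AlgHom.one_apply]

lemma x_mul_x (α β : Fin q) (f : S) :
    x (.inr α) * (x (.inr β) * f) = -(x (.inr β) * (x (.inr α) * f)) := by
  rw [← mul_assoc, h.odd_anticomm _ _ (h.odd_x α) (h.odd_x β), neg_mul, mul_assoc]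

lemma x_mul_self (α : Fin q) (f : S) : x (.inr α) * (x (.inr α) * f) = 0 := by
  rw [← mul_assoc, odd_mul_self h.toIsSuperComm (isHom_one_iff.2 (h.odd_x α)), zero_mul]

lemma pd_inl_pd (i : Fin p) (a : Fin p ⊕ Fin q) (f : S) :
    pd (.inl i) (pd a f) = pd a (pd (.inl i) f) := by
  rw [h.pd_comm, pe_inl, zero_mul, pow_zero, one_smul]

/-- For closed `s` the homotopy formula says that subtracting `δ` of the homotopy leaves the
projection belonging to `a`. This projection respects the conditions for the other coordinates,
since the operators involved commute up to sign. -/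
lemma exists_reduced_step (hp : IsPrimitive ε pd x prim) (a : Fin p ⊕ Fin q) {i : ℤ}
    {s : Mon p q →₀ S} (hs : s ∈ homog p q 𝕜 S i) (hδ : coordDelta ε.toLinearMap pd s = 0) :
    ∃ t ∈ homog p q 𝕜 S (i - 1), IsReduced pd x (s - coordDelta ε.toLinearMap pd t) a ∧
      ∀ b, IsReduced pd x s b → IsReduced pd x (s - coordDelta ε.toLinearMap pd t) b := by
  have hsc := h.toIsSuperComm
  rcases a with j | α
  · refine ⟨homotopyEven ε prim j s, neg_mem (leftMul_mem_homog hsc _ (coeffMap_mem_homog _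
      (parOp_mem_homog hs))), ?_⟩
    have e := hp.homotopyEven_delta h j s
    rw [hδ, homotopyEven, homotopyEven, map_zero, map_zero, map_zero, neg_zero, add_zero,
      ← homotopyEven] at e
    have key : ∀ n, (s - coordDelta ε.toLinearMap pd (homotopyEven ε prim j s)) n =
        if j ∈ n.1 then s n - prim j (pd (.inl j) (s n)) else 0 := by
      intro n
      rw [e, sub_add_cancel_left, Finsupp.neg_apply, leftMul_contr_inl_apply hsc]
      split_ifs
      · rw [neg_neg]
        rfl
      · rw [neg_zero]
    refine ⟨fun n => ⟨fun hn => by rw [key, if_neg hn], ?_⟩, fun b hb => ?_⟩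
    · rw [key]
      split_ifs
      · rw [map_sub, hp.pd_self, sub_self]
      · rw [map_zero]
    · rcases b with k | β
      · refine fun n => ⟨fun hn => ?_, ?_⟩
        · rw [key, (hb n).1 hn, map_zero, map_zero, sub_zero, ite_self]
        · rw [key]
          split_ifs
          · rcases eq_or_ne k j with rfl | hkj
            · rw [map_sub, hp.pd_self, sub_self]
            · rw [map_sub, hp.pd_of_ne _ _ _ (by simpa using hkj), h.pd_inl_pd, (hb n).2, map_zero,
                map_zero, sub_zero]
          · rw [map_zero]
      · refine fun n => ⟨fun hn => ?_, ?_⟩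
        · rw [key, (hb n).1 hn, map_zero, map_zero, sub_zero, ite_self]
        · rw [key]
          split_ifs
          · rw [mul_sub, ← hp.mul_x, ← h.pd_inl_x_mul, (hb n).2, map_zero, map_zero, sub_zero]
          · rw [mul_zero]
  · refine ⟨homotopyOdd ε x α s, smul_mem_homog _ (leftMul_mem_homog hsc _
      (weight_mem_homog α (parOp_mem_homog hs))), ?_⟩
    have e := h.homotopyOdd_delta α s
    rw [hδ, homotopyOdd, homotopyOdd, map_zero, map_zero, map_zero, smul_zero, add_zero,
      ← homotopyOdd] at e
    have key : ∀ n, (s - coordDelta ε.toLinearMap pd (homotopyOdd ε x α s)) n =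
        if n.2 α = 0 then x (.inr α) * pd (.inr α) (s n) else 0 := by
      intro n
      rw [e, sub_sub_cancel, Finsupp.smul_apply, Finsupp.filter_apply, smul_ite, smul_zero]
      rfl
    refine ⟨fun n => ⟨fun hn => by rw [key, if_neg hn], ?_⟩, fun b hb => ?_⟩
    · rw [key]
      split_ifs
      · rw [h.x_mul_self]
      · rw [mul_zero]
    · rcases b with k | β
      · refine fun n => ⟨fun hn => ?_, ?_⟩
        · rw [key, (hb n).1 hn, map_zero, mul_zero, ite_self]
        · rw [key]
          split_ifs
          · rw [h.pd_inl_x_mul, h.pd_inl_pd, (hb n).2, map_zero, mul_zero]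
          · rw [map_zero]
      · refine fun n => ⟨fun hn => ?_, ?_⟩
        · rw [key, (hb n).1 hn, map_zero, mul_zero, ite_self]
        · rw [key]
          split_ifs
          · rcases eq_or_ne α β with rfl | hαβ
            · rw [h.x_mul_self]
            · rw [h.x_mul_x, neg_eq_zero.1 ((h.pd_x_mul_of_ne hαβ (s n)).symm.trans
                (by rw [(hb n).2, map_zero])), mul_zero, neg_zero]
          · rw [mul_zero]

lemma exists_reduced (hp : IsPrimitive ε pd x prim) (l : List (Fin p ⊕ Fin q)) {i : ℤ}
    {s : Mon p q →₀ S} (hs : s ∈ homog p q 𝕜 S i) (hδ : coordDelta ε.toLinearMap pd s = 0) :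
    ∃ t ∈ homog p q 𝕜 S (i - 1),
      ∀ a ∈ l, IsReduced pd x (s - coordDelta ε.toLinearMap pd t) a := by
  induction l with
  | nil => exact ⟨0, zero_mem _, by simp⟩
  | cons a l ih =>
    obtain ⟨t, ht, hl⟩ := ih
    have h1 : s - coordDelta ε.toLinearMap pd t ∈ homog p q 𝕜 S i := by
      have := h.delta_mem_homog ht
      rw [sub_add_cancel] at this
      exact sub_mem hs this
    have h2 : coordDelta ε.toLinearMap pd (s - coordDelta ε.toLinearMap pd t) = 0 := by
      rw [map_sub, hδ, h.delta_delta, sub_zero]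
    obtain ⟨t', ht', ha, hb⟩ := h.exists_reduced_step hp a h1 h2
    refine ⟨t + t', add_mem ht ht', fun b hbl => ?_⟩
    rw [map_add, ← sub_sub]
    rcases List.mem_cons.1 hbl with rfl | hbl
    · exact ha
    · exact hb b (hl b hbl)

/-- If `x_α f = 0`, then differentiating gives `f = x_α ∂_α f`, and `∂_α f` is still annihilated by
the remaining coordinates; so the factors can be split off one by one. -/
lemma exists_prod_mul (l : List (Fin q)) (hl : l.Nodup) {f : S}
    (hf : ∀ α ∈ l, x (.inr α) * f = 0) : ∃ g, f = (l.map fun α => x (.inr α)).prod * g := by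
  induction l generalizing f with
  | nil => exact ⟨f, by simp⟩
  | cons α l ih =>
    rw [List.nodup_cons] at hl
    have h1 : f = x (.inr α) * pd (.inr α) f := by
      have := h.pd_x_mul_self α f
      rw [hf α List.mem_cons_self, map_zero] at this
      exact (sub_eq_zero.1 this.symm)
    obtain ⟨g, hg⟩ := ih hl.2 (f := pd (.inr α) f) fun β hβ => by
      have hαβ : α ≠ β := fun e => hl.1 (e ▸ hβ)
      have := h.pd_x_mul_of_ne hαβ f
      rw [hf β (List.mem_cons_of_mem _ hβ), map_zero] at this
      exact neg_eq_zero.1 this.symm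
    exact ⟨g, by rw [List.map_cons, List.prod_cons, mul_assoc, ← hg, ← h1]⟩

/-- The Poincaré lemma for integral forms in coordinates. -/
theorem exists_eq_delta_add (hp : IsPrimitive ε pd x prim) {i : ℤ}
    {s : Mon p q →₀ S} (hs : s ∈ homog p q 𝕜 S i) (hδ : coordDelta ε.toLinearMap pd s = 0) :
    ∃ t ∈ homog p q 𝕜 S (i - 1), ∃ c : 𝕜, (i ≠ 0 → c = 0) ∧
      s = coordDelta ε.toLinearMap pd t + c • Finsupp.single (Finset.univ, 0) (thetaTop x) := by
  obtain ⟨t, ht, hr⟩ := h.exists_reduced hp Finset.univ.toList hs hδ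
  have hr : ∀ a, IsReduced pd x (s - coordDelta ε.toLinearMap pd t) a := fun a => hr a (by simp)
  refine ⟨t, ht, ?_⟩
  have hu : s - coordDelta ε.toLinearMap pd t ∈ homog p q 𝕜 S i := by
    have := h.delta_mem_homog ht
    rw [sub_add_cancel] at this
    exact sub_mem hs this
  set u := s - coordDelta ε.toLinearMap pd t with hu_def
  have hsu : s = coordDelta ε.toLinearMap pd t + u := by rw [hu_def, add_sub_cancel]
  -- Reduced in all coordinates means that all `π∂_z` and no `π∂_θ` occur.
  have h0 : ∀ n, n ≠ (Finset.univ, 0) → u n = 0 := by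
    intro n hn
    by_cases h1 : n.1 = Finset.univ
    · have h2 : n.2 ≠ 0 := fun e => hn (Prod.ext h1 e)
      obtain ⟨α, hα⟩ := Finsupp.ne_iff.1 h2
      exact (hr (.inr α) n).1 hα
    · obtain ⟨j, hj⟩ : ∃ j, j ∉ n.1 := by
        by_contra! hall
        exact h1 (Finset.eq_univ_iff_forall.2 hall)
      exact (hr (.inl j) n).1 hj
  have hsingle : u = Finsupp.single (Finset.univ, 0) (u (Finset.univ, 0)) := by
    ext n
    rcases eq_or_ne n (Finset.univ, 0) with rfl | hn
    · rw [Finsupp.single_eq_same]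
    · rw [h0 n hn, Finsupp.single_eq_of_ne hn]
  rcases eq_or_ne i 0 with rfl | hi
  · obtain ⟨g, hg⟩ := h.exists_prod_mul (List.finRange q) (List.nodup_finRange q)
      (f := u (Finset.univ, 0)) fun α _ => (hr (.inr α) _).2
    rw [← List.ofFn_eq_map] at hg
    obtain ⟨c, hc⟩ := hp.const _ (fun j => (hr (.inl j) _).2) g hg
    refine ⟨c, fun hi => absurd rfl hi, ?_⟩
    rw [Finsupp.smul_single, ← hc, ← hsingle, ← hsu]
  -- The surviving monomial has polynomial degree `p`, which homogeneity permits only for `i = 0`.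
  · refine ⟨0, fun _ => rfl, ?_⟩
    have : u = 0 := by
      rw [hsingle]
      by_contra hne
      have hmem : ((Finset.univ, 0) : Mon p q) ∈ u.support := by
        rw [Finsupp.mem_support_iff]
        intro e
        exact hne (by rw [e, Finsupp.single_zero])
      have := hu hmem
      apply hi
      rw [← this]
      simp [Mon.deg]
    rw [zero_smul, add_zero, hsu, this, add_zero]

/-- The iterated left derivative with respect to odd coordinates. -/
def iterPd (pd : Fin p ⊕ Fin q → (S →ₗ[𝕜] S)) (l : List (Fin q)) (f : S) : S :=
  l.foldl (fun f α => pd (.inr α) f) f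

omit h in
lemma iterPd_add (l : List (Fin q)) (f g : S) :
    iterPd pd l (f + g) = iterPd pd l f + iterPd pd l g := by
  induction l generalizing f g with
  | nil => rfl
  | cons α l ih =>
    change iterPd pd l (pd (.inr α) (f + g)) =
      iterPd pd l (pd (.inr α) f) + iterPd pd l (pd (.inr α) g)
    rw [map_add, ih]

omit h in
lemma iterPd_smul (l : List (Fin q)) (c : 𝕜) (f : S) :
    iterPd pd l (c • f) = c • iterPd pd l f := by
  induction l generalizing f with
  | nil => rfl
  | cons α l ih =>
    change iterPd pd l (pd (.inr α) (c • f)) = c • iterPd pd l (pd (.inr α) f)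
    rw [map_smul, ih]

/-- A repeated odd derivative can be moved, up to sign, next to its copy, and odd derivatives square
to zero: the Berezin integral of an odd derivative vanishes. -/
lemma iterPd_pd {l : List (Fin q)} {α : Fin q} (hα : α ∈ l) (f : S) :
    iterPd pd l (pd (.inr α) f) = 0 := by
  induction l generalizing f with
  | nil => simp at hα
  | cons β l ih =>
    change iterPd pd l (pd (.inr β) (pd (.inr α) f)) = 0
    have h0 : iterPd pd l (0 : S) = 0 := by
      have := iterPd_smul (pd := pd) l 0 0
      rwa [zero_smul, zero_smul] at this
    rw [h.pd_comm, pe_inr, pe_inr, mul_one, pow_one, neg_smul, one_smul]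
    rcases List.mem_cons.1 hα with rfl | hα
    · have := h.pd_comm (.inr α) (.inr α) f
      rw [pe_inr, mul_one, pow_one, neg_smul, one_smul, ← add_eq_zero_iff_eq_neg,
        ← two_smul 𝕜] at this
      rw [(smul_eq_zero.1 this).resolve_left two_ne_zero, neg_zero, h0]
    · rw [← neg_one_smul 𝕜, iterPd_smul]
      rw [ih hα (pd (.inr β) f), smul_zero]

lemma pd_prod_of_notMem {l : List (Fin q)} {α : Fin q} (hα : α ∉ l) :
    pd (.inr α) (l.map fun β => x (.inr β)).prod = 0 := by
  induction l with
  | nil => exact h.pd_one _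
  | cons β l ih =>
    rw [List.map_cons, List.prod_cons, h.pd_x_mul_of_ne (fun e => hα (by simp [e])),
      ih (fun e => hα (List.mem_cons_of_mem _ e)), mul_zero, neg_zero]

/-- Derivatives act from the head of the list, so each one meets its coordinate as the leftmost
factor and no sign arises. -/
lemma iterPd_prod (l : List (Fin q)) (hl : l.Nodup) :
    iterPd pd l (l.map fun β => x (.inr β)).prod = 1 := by
  induction l with
  | nil => rfl
  | cons α l ih =>
    rw [List.nodup_cons] at hl
    change iterPd pd l (pd (.inr α) _) = 1
    rw [List.map_cons, List.prod_cons, h.pd_x_mul_self, h.pd_prod_of_notMem hl.1, mul_zero,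
      sub_zero, ih hl.2]

/-- The generator is not exact. -/
theorem eq_zero_of_delta_eq [Nontrivial S] {t : Mon p q →₀ S} {c : 𝕜}
    (ht : coordDelta ε.toLinearMap pd t = c • Finsupp.single (Finset.univ, 0) (thetaTop x)) :
    c = 0 := by
  -- Contraction by `dz_i` removes `π∂_{z_i}` and never yields the top monomial. Its coefficient in
  -- `δt` therefore consists of odd derivatives, which the full odd derivative kills.
  have key : ∀ t : Mon p q →₀ S, iterPd pd (List.finRange q)
      (coordDelta ε.toLinearMap pd t (Finset.univ, 0)) = 0 := by
    have h0 : iterPd pd (List.finRange q) (0 : S) = 0 := by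
      have := iterPd_smul (pd := pd) (List.finRange q) 0 0
      rwa [zero_smul, zero_smul] at this
    intro t
    induction t using Finsupp.induction_linear with
    | zero => rw [map_zero, Finsupp.zero_apply, h0]
    | add s t hs ht => rw [map_add, Finsupp.add_apply, iterPd_add, hs, ht, add_zero]
    | single n f =>
      have hsum : ∀ v : Fin p ⊕ Fin q → S, (∀ a, iterPd pd (List.finRange q) (v a) = 0) →
          iterPd pd (List.finRange q) (∑ a, v a) = 0 := by
        intro v hv
        refine Finset.sum_induction v (fun f => iterPd pd (List.finRange q) f = 0)
          (fun f g hf hg => by rw [iterPd_add, hf, hg, add_zero]) h0 fun a _ => hv a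
      rw [h.coordDelta_eq, Finsupp.neg_apply, Finsupp.finsetSum_apply, ← neg_one_smul 𝕜,
        iterPd_smul, hsum, smul_zero]
      intro a
      rw [parOp_single, map_zsmul, map_zsmul, coeffMap_single, contr_single, Finsupp.smul_apply,
        Finsupp.smul_apply, ← Int.cast_smul_eq_zsmul 𝕜, ← Int.cast_smul_eq_zsmul 𝕜, iterPd_smul,
        iterPd_smul]
      rcases a with i | α
      · rw [Finsupp.single_eq_of_ne, h0, smul_zero, smul_zero]
        intro e
        have : i ∈ (contrMon (Sum.inl i) n : Mon p q).1 := by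
          rw [← e]
          exact Finset.mem_univ i
        simp [contrMon] at this
      · rw [pe_inr, h.pow_even ⟨1, rfl⟩, AlgHom.one_apply]
        rcases eq_or_ne (contrMon (Sum.inr α) n) (Finset.univ, 0) with e | e
        · rw [e, Finsupp.single_eq_same, h.iterPd_pd (List.mem_finRange α), smul_zero, smul_zero]
        · rw [Finsupp.single_eq_of_ne e.symm, h0, smul_zero, smul_zero]
  have h1 := key t
  rw [ht, Finsupp.smul_apply, Finsupp.single_eq_same, iterPd_smul, thetaTop, List.ofFn_eq_map,
    h.iterPd_prod _ (List.nodup_finRange q)] at h1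
  exact (smul_eq_zero.1 h1).resolve_right one_ne_zero

end IsCoordSystem

end Reduction

/-! ## Homomorphisms of superalgebras -/

section Naturality

variable {p q : ℕ} {𝕜 : Type u} [RCLike 𝕜] {S S' : Type u} [Ring S] [Algebra 𝕜 S] [Ring S']
  [Algebra 𝕜 S'] {ε : S →ₐ[𝕜] S} {ε' : S' →ₐ[𝕜] S'} (ρ : S →ₐ[𝕜] S')

/-- The map of polyfields induced by a homomorphism of the coefficients. -/
def polyMap (p q : ℕ) : (Mon p q →₀ S) →ₗ[𝕜] (Mon p q →₀ S') :=
  Finsupp.mapRange.linearMap ρ.toLinearMap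

lemma polyMap_single (n : Mon p q) (f : S) :
    polyMap ρ p q (Finsupp.single n f) = Finsupp.single n (ρ f) := by
  simp [polyMap]

lemma polyMap_smul (f : S) (s : Mon p q →₀ S) :
    polyMap ρ p q (f • s) = ρ f • polyMap ρ p q s := by
  ext n
  exact map_mul ρ f (s n)

lemma polyMap_mem_homog {i : ℤ} {s : Mon p q →₀ S} (hs : s ∈ homog p q 𝕜 S i) :
    polyMap ρ p q s ∈ homog p q 𝕜 S' i := by
  intro n hn
  refine hs (Finsupp.mem_support_iff.2 fun e => Finsupp.mem_support_iff.1 hn ?_)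
  change ρ (s n) = 0
  rw [e, map_zero]

lemma pow_apply_of_comm (hρ : ∀ f, ρ (ε f) = ε' (ρ f)) (k : ℕ) (f : S) :
    ρ ((ε ^ k) f) = (ε' ^ k) (ρ f) := by
  induction k generalizing f with
  | zero => rfl
  | succ k ih => rw [pow_succ, AlgHom.mul_apply, ih, hρ, pow_succ, AlgHom.mul_apply]

lemma polyMap_leftMul (h : IsSuperComm ε) (h' : IsSuperComm ε') (hρ : ∀ f, ρ (ε f) = ε' (ρ f))
    (a : Fin p ⊕ Fin q) (s : Mon p q →₀ S) :
    polyMap ρ p q (leftMul ε.toLinearMap a s) =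
      leftMul ε'.toLinearMap a (polyMap ρ p q s) := by
  induction s using Finsupp.induction_linear with
  | zero => simp only [map_zero]
  | add s t hs ht => simp only [map_add, hs, ht]
  | single n f =>
    rw [leftMul_single h, map_zsmul, polyMap_single, polyMap_single, leftMul_single h',
      pow_apply_of_comm ρ hρ]

lemma polyMap_subst (h : IsSuperComm ε) (h' : IsSuperComm ε') (hρ : ∀ f, ρ (ε f) = ε' (ρ f))
    (J : Matrix (Fin p ⊕ Fin q) (Fin p ⊕ Fin q) S) (s : Mon p q →₀ S) :
    polyMap ρ p q (subst ε.toLinearMap J s) =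
      subst ε'.toLinearMap (J.map ρ) (polyMap ρ p q s) := by
  induction s using Finsupp.induction_linear with
  | zero => simp only [map_zero]
  | add s t hs ht => simp only [map_add, hs, ht]
  | single n f =>
    rw [subst_single, polyMap_smul, polyMap_single, subst_single, substMon_eq, substMon_eq]
    congr 1
    induction n.word with
    | nil => rw [List.foldr_nil, List.foldr_nil, polyMap_single, map_one]
    | cons a l ih =>
      rw [List.foldr_cons, List.foldr_cons, ← ih, leftMulRow_apply, leftMulRow_apply, map_sum]
      refine Finset.sum_congr rfl fun b _ => ?_
      rw [polyMap_smul, polyMap_leftMul ρ h h' hρ, Matrix.map_apply]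

lemma polyMap_coordDelta {pd : Fin p ⊕ Fin q → (S →ₗ[𝕜] S)} {pd' : Fin p ⊕ Fin q → (S' →ₗ[𝕜] S')}
    {x : Fin p ⊕ Fin q → S} {x' : Fin p ⊕ Fin q → S'} (h : IsCoordSystem ε pd x)
    (h' : IsCoordSystem ε' pd' x') (hρ : ∀ f, ρ (ε f) = ε' (ρ f))
    (hpd : ∀ a f, ρ (pd a f) = pd' a (ρ f)) (s : Mon p q →₀ S) :
    polyMap ρ p q (coordDelta ε.toLinearMap pd s) =
      coordDelta ε'.toLinearMap pd' (polyMap ρ p q s) := by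
  induction s using Finsupp.induction_linear with
  | zero => simp only [map_zero]
  | add s t hs ht => simp only [map_add, hs, ht]
  | single n f =>
    rw [h.coordDelta_eq, h'.coordDelta_eq, map_neg, map_sum, polyMap_single, parOp_single,
      parOp_single]
    congr 1
    refine Finset.sum_congr rfl fun a _ => ?_
    simp only [map_zsmul, coeffMap_single, contr_single, polyMap_single, hpd,
      pow_apply_of_comm ρ hρ, hρ]

lemma map_leibnizDet {n : ℕ} (A : Matrix (Fin n) (Fin n) S) :
    ρ (leibnizDet A) = leibnizDet (A.map ρ) := by
  rw [leibnizDet, leibnizDet, map_sum]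
  refine Finset.sum_congr rfl fun σ _ => ?_
  rw [map_zsmul, map_list_prod, List.map_ofFn]
  rfl

/-- The factorization supplies an honest inverse of the lower right block, which a homomorphism
preserves; this identifies the images under `Ring.inverse`. -/
lemma map_berezinian (h : IsSuperComm ε) {J J' : Matrix (Fin p ⊕ Fin q) (Fin p ⊕ Fin q) S}
    (hJ : IsEvenMatrix ε J) (hJ' : IsEvenMatrix ε J') (hJJ' : J * J' = 1) (hJ'J : J' * J = 1) :
    ρ (berezinian J) = berezinian (J.map ρ) := by
  obtain ⟨X, P, P', D, D', Y, -, -, -, -, -, -, -, -, hD, hD', rfl⟩ := exists_udl h hJ hJ' hJJ' hJ'J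
  have e : (udl X P D Y).map ρ = udl (X.map ρ) (P.map ρ) (D.map ρ) (Y.map ρ) := by
    rw [udl, udl, Matrix.fromBlocks_map, Matrix.map_add _ (map_add ρ), Matrix.map_mul,
      Matrix.map_mul, Matrix.map_mul]
  rw [e, berezinian_udl X P Y hD hD', berezinian_udl (D' := D'.map ρ) _ _ _
    (by rw [← Matrix.map_mul, hD, Matrix.map_one _ (map_zero ρ) (map_one ρ)])
    (by rw [← Matrix.map_mul, hD', Matrix.map_one _ (map_zero ρ) (map_one ρ)]), map_mul,
    map_leibnizDet, map_leibnizDet]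

lemma map_thetaTop (x : Fin p ⊕ Fin q → S) : ρ (thetaTop x) = thetaTop fun a => ρ (x a) := by
  rw [thetaTop, thetaTop, map_list_prod, List.map_ofFn]
  rfl

lemma IsSuperComm.of_algEquiv (e : S ≃ₐ[𝕜] S') (he : ∀ f, e (ε f) = ε' (e f))
    (h : IsSuperComm ε) : IsSuperComm ε' where
  invol f := by
    obtain ⟨f, rfl⟩ := e.surjective f
    rw [← he, ← he, h.invol]
  even_comm f g hf := by
    obtain ⟨f, rfl⟩ := e.surjective f
    obtain ⟨g, rfl⟩ := e.surjective g
    rw [← he] at hf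
    rw [← map_mul, h.even_comm f g (e.injective hf), map_mul]
  odd_anticomm f g hf hg := by
    obtain ⟨f, rfl⟩ := e.surjective f
    obtain ⟨g, rfl⟩ := e.surjective g
    rw [← he, ← map_neg] at hf hg
    rw [← map_mul, h.odd_anticomm f g (e.injective hf) (e.injective hg), map_neg, map_mul]

lemma IsPrimitive.of_algEquiv (e : S ≃ₐ[𝕜] S') {pd : Fin p ⊕ Fin q → (S →ₗ[𝕜] S)}
    {pd' : Fin p ⊕ Fin q → (S' →ₗ[𝕜] S')} {x : Fin p ⊕ Fin q → S} {x' : Fin p ⊕ Fin q → S'}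
    {prim' : Fin p → (S' →ₗ[𝕜] S')} (h : IsPrimitive ε' pd' x' prim')
    (he : ∀ f, e (ε f) = ε' (e f)) (hpd : ∀ a f, e (pd a f) = pd' a (e f))
    (hx : ∀ a, e (x a) = x' a) :
    IsPrimitive ε pd x fun i => e.symm.toLinearMap ∘ₗ prim' i ∘ₗ e.toLinearMap where
  par_prim i f := e.injective <| by
    simp [he, h.par_prim]
  pd_self i f := e.injective <| by
    simp [hpd, h.pd_self]
  pd_of_ne i b f hb := e.injective <| by
    simp [hpd, h.pd_of_ne i b _ hb]
  mul_x i α f := e.injective <| by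
    simp [hx, h.mul_x]
  const f hf g hg := by
    have hθ : e (thetaTop x) = thetaTop x' := by
      rw [← funext hx]
      exact map_thetaTop e.toAlgHom x
    obtain ⟨c, hc⟩ := h.const (e f) (fun i => by rw [← hpd, hf, map_zero]) (e g)
      (by rw [hg, map_mul, hθ])
    exact ⟨c, e.injective (by rw [hc, map_smul, hθ])⟩

end Naturality

/-! ## Superderivations of the local model -/

section ModelDerivation

variable {𝕜 : Type u} [RCLike 𝕜] {p q : ℕ} {U : Opens (Fin p → 𝕜)} {x₀ : Fin p → 𝕜} {r : ℝ}

namespace Model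

lemma parity_pow_tmul_one (k : ℕ) (f : smoothFun U) :
    (Model.parity q U ^ k) (f ⊗ₜ 1) = f ⊗ₜ 1 := by
  induction k with
  | zero => rfl
  | succ k ih => rw [pow_succ, AlgHom.mul_apply, parity_tmul, map_one, ih]

lemma eval_smoothCoord_sub (hx₀ : x₀ ∈ U) (i : Fin p) :
    eval (q := q) ⟨x₀, hx₀⟩ ((smoothCoord U i - algebraMap 𝕜 _ (x₀ i)) ⊗ₜ 1) = 0 := by
  rw [eval_tmul]
  have : (smoothCoord U i - algebraMap 𝕜 (smoothFun U) (x₀ i)).1 ⟨x₀, hx₀⟩ = 0 := by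
    change x₀ i - x₀ i = 0
    rw [sub_self]
  rw [this, zero_smul]

/-- A superderivation that vanishes on the coordinates is zero. -/
lemma eval_superderivation (hU : (U : Set (Fin p → 𝕜)) = Metric.ball x₀ r) (hr : 0 < r)
    (hx₀ : x₀ ∈ U) {k : ℕ} {D : Model q U →ₗ[𝕜] Model q U}
    (hD : ∀ f g, D (f * g) = D f * g + (Model.parity q U ^ k) f * D g)
    (hx : ∀ b, D (Model.coord U b) = 0) (f : Model q U) : eval ⟨x₀, hx₀⟩ (D f) = 0 := by
  have h1 : D 1 = 0 := by
    have := hD 1 1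
    rw [mul_one, mul_one, map_one (Model.parity q U ^ k), one_mul] at this
    exact left_eq_add.1 this
  -- On the exterior algebra, generated by the odd coordinates, the Leibniz rule alone forces `D` to
  -- vanish.
  have hw : ∀ w : ExteriorAlgebra 𝕜 (Fin q → 𝕜), D (1 ⊗ₜ w) = 0 := by
    intro w
    induction w using CliffordAlgebra.left_induction with
    | algebraMap c =>
      rw [Algebra.algebraMap_eq_smul_one, TensorProduct.tmul_smul, map_smul]
      exact (congrArg _ h1).trans (smul_zero c)
    | add v w hv hw => rw [TensorProduct.tmul_add, map_add, hv, hw, add_zero]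
    | ι_mul w v hw =>
      have hv : D ((1 : smoothFun U) ⊗ₜ ExteriorAlgebra.ι 𝕜 v) = 0 := by
        have e : (1 : smoothFun U) ⊗ₜ[𝕜] ExteriorAlgebra.ι 𝕜 v =
            ∑ α, v α • Model.coord U (.inr α : Fin p ⊕ Fin q) := by
          conv_lhs => rw [← Finset.univ_sum_single v]
          rw [map_sum, TensorProduct.tmul_sum]
          refine Finset.sum_congr rfl fun α _ => ?_
          rw [coord_inr, ← TensorProduct.tmul_smul, ← map_smul]
          congr 2
          ext β
          rcases eq_or_ne β α with rfl | hβ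
          · simp
          · simp [hβ]
        rw [e, map_sum]
        exact Finset.sum_eq_zero fun α _ => by rw [map_smul, hx, smul_zero]
      have e : (1 : smoothFun U) ⊗ₜ[𝕜] (CliffordAlgebra.ι 0 v * w) =
          (1 : smoothFun U) ⊗ₜ[𝕜] ExteriorAlgebra.ι 𝕜 v * (1 : smoothFun U) ⊗ₜ[𝕜] w := by
        rw [Algebra.TensorProduct.tmul_mul_tmul, mul_one]
      rw [e, hD, hv, hw, zero_mul, mul_zero, add_zero]
  -- By Hadamard's lemma `f = c + ∑ (z_i - x₀_i) g_i`. The Leibniz rule leaves `(z_i - x₀_i) D g_i`,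
  -- whose value at the centre is zero.
  have hf : ∀ f : smoothFun U, eval ⟨x₀, hx₀⟩ (D (f ⊗ₜ 1)) = 0 := by
    intro f
    obtain ⟨c, g, rfl⟩ := smoothFun_hadamard hU hr f
    rw [TensorProduct.add_tmul, TensorProduct.sum_tmul, map_add, map_sum, map_add, map_sum]
    have h2 : ∀ c : 𝕜, D (algebraMap 𝕜 (smoothFun U) c ⊗ₜ 1) = 0 := fun c => by
      rw [Algebra.algebraMap_eq_smul_one, ← TensorProduct.smul_tmul', map_smul]
      exact (congrArg _ h1).trans (smul_zero c)
    rw [h2, map_zero, zero_add]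
    refine Finset.sum_eq_zero fun i _ => ?_
    have e : ((smoothCoord U i - algebraMap 𝕜 _ (x₀ i)) * g i) ⊗ₜ[𝕜]
        (1 : ExteriorAlgebra 𝕜 (Fin q → 𝕜)) =
        (smoothCoord U i - algebraMap 𝕜 _ (x₀ i)) ⊗ₜ 1 * g i ⊗ₜ 1 := by
      rw [Algebra.TensorProduct.tmul_mul_tmul, mul_one]
    have h3 : D ((smoothCoord U i - algebraMap 𝕜 _ (x₀ i)) ⊗ₜ 1) = 0 := by
      rw [TensorProduct.sub_tmul, map_sub, h2, sub_zero, ← Model.coord_inl, hx]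
    rw [e, hD, h3, zero_mul, zero_add, parity_pow_tmul_one, map_mul, eval_smoothCoord_sub, zero_mul]
  induction f using TensorProduct.induction_on with
  | zero => rw [map_zero, map_zero]
  | add f g hf hg => rw [map_add, map_add, hf, hg, add_zero]
  | tmul f w =>
    have e : f ⊗ₜ[𝕜] w = f ⊗ₜ[𝕜] (1 : ExteriorAlgebra 𝕜 (Fin q → 𝕜)) * (1 : smoothFun U) ⊗ₜ[𝕜] w := by
      rw [Algebra.TensorProduct.tmul_mul_tmul, mul_one, one_mul]
    rw [e, hD, hw, mul_zero, add_zero, map_mul, hf, zero_mul]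

lemma res_coord {V : Opens (Fin p → 𝕜)} (h : V ≤ U) (a : Fin p ⊕ Fin q) :
    Model.res h (Model.coord U a) = Model.coord V a := by
  rcases a with i | α
  · exact (Algebra.TensorProduct.map_tmul _ _ _ _).trans rfl
  · exact (Algebra.TensorProduct.map_tmul _ _ _ _).trans (by rw [map_one]; rfl)

end Model

end ModelDerivation

/-! ## Charts -/

namespace SuperSpace

variable {𝕜 : Type u} [RCLike 𝕜] (X : SuperSpace.{u} 𝕜)

lemma isSuperComm (W : Opens X.carrier) : IsSuperComm (X.par W) where
  invol f := congrArg (fun g => (g.app (op W)).hom f) X.parity_parity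
  even_comm := X.even_comm W
  odd_anticomm := X.odd_anticomm W

namespace Chart

variable {X} {p q : ℕ} (c : X.Chart p q) {W : Opens X.carrier} (hW : W ≤ c.dom)

/-- The isomorphism of a chart over an open subset of its domain. -/
def isoOn : X.Sec W ≃ₐ[𝕜] Model q (X.image c.e W) := c.iso W hW

lemma isoOn_res {V : Opens X.carrier} (h : V ≤ W) (f : X.Sec W) :
    c.isoOn (h.trans hW) (X.res h f) = Model.res (X.image_mono c.e h) (c.isoOn hW f) :=
  c.iso_res V W (h.trans hW) hW h f

lemma isoOn_par (f : X.Sec W) :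
    c.isoOn hW (X.par W f) = Model.parity q (X.image c.e W) (c.isoOn hW f) :=
  c.iso_par W hW f

lemma isoOn_coord (a : Fin p ⊕ Fin q) : c.isoOn hW (c.coord hW a) = Model.coord _ a :=
  (c.isoOn hW).apply_symm_apply _

lemma isoOn_pd (a : Fin p ⊕ Fin q) (f : X.Sec W) :
    c.isoOn hW (c.pd hW a f) = Model.pd _ a (c.isoOn hW f) :=
  (c.isoOn hW).apply_symm_apply _

-- Supercommutativity is an axiom for the structure sheaf; the chart transports it to the model.
include hW in
lemma isSuperComm_parity : IsSuperComm (Model.parity q (X.image c.e W)) :=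
  (X.isSuperComm W).of_algEquiv (c.isoOn hW) (c.isoOn_par hW)

lemma isCoordSystem : IsCoordSystem (X.par W) (c.pd hW) (c.coord hW) where
  toIsSuperComm := X.isSuperComm W
  leibniz a f g := (c.isoOn hW).injective <| by
    rw [isoOn_pd, map_mul (c.isoOn hW), map_add,
      map_mul (c.isoOn hW), map_mul (c.isoOn hW), isoOn_pd, isoOn_pd, Model.leibniz]
    rcases a with i | α
    · rfl
    · rw [pe_inr, pow_one, pow_one, c.isoOn_par]
  par_pd a f := (c.isoOn hW).injective <| by
    rcases a with i | α
    · rw [pe_inl, pow_zero, one_smul, c.isoOn_par, isoOn_pd, isoOn_pd, c.isoOn_par, Model.parity_pd_inl]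
    · rw [pe_inr, pow_one, neg_smul, one_smul, map_neg, c.isoOn_par, isoOn_pd, isoOn_pd, c.isoOn_par,
        Model.parity_pd_inr]
  pd_comm a b f := (c.isoOn hW).injective <| by
    rcases a with i | α
    · rw [pe_inl, zero_mul, pow_zero, one_smul]
      simp only [isoOn_pd]
      rw [Model.pd_inl_comm]
    · rcases b with j | β
      · rw [pe_inl, mul_zero, pow_zero, one_smul]
        simp only [isoOn_pd]
        rw [Model.pd_inl_comm]
      · rw [pe_inr, pe_inr, mul_one, pow_one, neg_smul, one_smul, map_neg]
        simp only [isoOn_pd]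
        rw [Model.pd_inr_comm]
  hom_x a := (c.isoOn hW).injective <| by
    rcases a with i | α
    · rw [pe_inl, pow_zero, one_smul, c.isoOn_par, isoOn_coord, Model.parity_coord_inl]
    · rw [pe_inr, pow_one, neg_smul, one_smul, map_neg, c.isoOn_par, isoOn_coord,
        Model.parity_coord_inr]
  pd_x a b := (c.isoOn hW).injective <| by
    rw [isoOn_pd, isoOn_coord, Model.pd_coord]
    split_ifs
    · rw [map_one]
    · rw [map_zero]
  odd_gen f hf := by
    obtain ⟨k, hk, e⟩ := Model.odd_gen (c.isoOn hW f) (by rw [← c.isoOn_par, hf, map_neg])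
    refine ⟨fun α => (c.isoOn hW).symm (k α), fun α => (c.isoOn hW).injective ?_,
      (c.isoOn hW).injective ?_⟩
    · rw [c.isoOn_par, AlgEquiv.apply_symm_apply, hk]
    · rw [e, map_sum]
      refine Finset.sum_congr rfl fun α _ => ?_
      rw [map_mul, isoOn_coord, AlgEquiv.apply_symm_apply]

lemma res_coord {V : Opens X.carrier} (h : V ≤ W) (a : Fin p ⊕ Fin q) :
    X.res h (c.coord hW a) = c.coord (h.trans hW) a :=
  (c.isoOn (h.trans hW)).injective <| by
    rw [c.isoOn_res hW h, isoOn_coord, isoOn_coord, Model.res_coord]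

lemma exists_isPrimitive {x₀ : Fin p → 𝕜} {r : ℝ} (hr : 0 < r)
    (hU : (X.image c.e W : Set (Fin p → 𝕜)) = Metric.ball x₀ r) :
    ∃ prim, IsPrimitive (X.par W) (c.pd hW) (c.coord hW) prim :=
  ⟨_, (Model.isPrimitive hU hr (c.isSuperComm_parity hW)).of_algEquiv (c.isoOn hW)
    (c.isoOn_par hW) (c.isoOn_pd hW) (c.isoOn_coord hW)⟩

include c hW in
lemma nontrivial_sec (hne : (W : Set X.carrier).Nonempty) : Nontrivial (X.Sec W) := by
  obtain ⟨x, hx⟩ := hne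
  have hy : c.e x ∈ X.image c.e W :=
    ⟨c.e.map_source (hW hx), by
      change c.e.symm (c.e x) ∈ W
      rwa [c.e.left_inv (hW hx)]⟩
  refine ⟨0, 1, fun e => ?_⟩
  have := congrArg (fun f => Model.eval ⟨c.e x, hy⟩ (c.isoOn hW f)) e
  simp only [map_zero, map_one] at this
  exact zero_ne_one this

/-- Coordinate balls form a basis of the topology. -/
lemma exists_ball {x : X.carrier} (hx : x ∈ W) (hxc : x ∈ c.dom) :
    ∃ V : Opens X.carrier, x ∈ V ∧ V ≤ W ∧ V ≤ c.dom ∧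
      ∃ r > 0, (X.image c.e V : Set (Fin p → 𝕜)) = Metric.ball (c.e x) r := by
  have hy : c.e x ∈ X.image c.e W :=
    ⟨c.e.map_source hxc, by
      change c.e.symm (c.e x) ∈ W
      rwa [c.e.left_inv hxc]⟩
  obtain ⟨r, hr, hball⟩ := Metric.isOpen_iff.1 (X.image c.e W).isOpen _ hy
  refine ⟨⟨c.e.source ∩ c.e ⁻¹' Metric.ball (c.e x) r,
    c.e.isOpen_inter_preimage Metric.isOpen_ball⟩, ⟨hxc, Metric.mem_ball_self hr⟩, fun y hy => ?_,
    fun y hy => hy.1, r, hr, ?_⟩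
  · have := (hball hy.2).2
    change c.e.symm (c.e y) ∈ W at this
    rwa [c.e.left_inv hy.1] at this
  · ext y
    constructor
    · rintro ⟨hy, hy'⟩
      have := hy'.2
      change c.e (c.e.symm y) ∈ Metric.ball (c.e x) r at this
      rwa [c.e.right_inv hy] at this
    · intro hyb
      have hy : y ∈ c.e.target := (hball hyb).1
      refine ⟨hy, c.e.map_target hy, ?_⟩
      change c.e (c.e.symm y) ∈ Metric.ball (c.e x) r
      rwa [c.e.right_inv hy]

variable (c' : X.Chart p q) (hW' : W ≤ c'.dom)

/-- The chain rule. -/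
theorem pd_eq_sum (a : Fin p ⊕ Fin q) (f : X.Sec W) :
    c.pd hW a f = ∑ b, X.jacobian c c' hW hW' a b * c'.pd hW' b f := by
  -- The difference of the two sides, defined on all smaller open sets compatibly with restriction
  -- so that it can be tested on balls.
  let D : ∀ V : Opens X.carrier, V ≤ W → (X.Sec V →ₗ[𝕜] X.Sec V) := fun V hV =>
    c.pd (hV.trans hW) a - ∑ b, LinearMap.mulLeft 𝕜 (c.pd (hV.trans hW) a
      (c'.coord (hV.trans hW') b)) ∘ₗ c'.pd (hV.trans hW') b
  have hDf : ∀ V hV f, D V hV f = c.pd (hV.trans hW) a f -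
      ∑ b, c.pd (hV.trans hW) a (c'.coord (hV.trans hW') b) * c'.pd (hV.trans hW') b f :=
    fun V hV f => by
      simp only [D, LinearMap.sub_apply, LinearMap.sum_apply, LinearMap.comp_apply,
        LinearMap.mulLeft_apply]
  have hDres : ∀ V hV f, X.res hV (D W le_rfl f) = D V hV (X.res hV f) := fun V hV f => by
    simp only [hDf, map_sub, map_sum, map_mul, res_pd, res_coord]
  have hDmul : ∀ V hV f g, D V hV (f * g) = D V hV f * g + (X.par V ^ pe a) f * D V hV g := by
    intro V hV f g
    have h := c.isCoordSystem (hV.trans hW)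
    have h' := c'.isCoordSystem (hV.trans hW')
    have hs := h.toIsSuperComm
    simp only [hDf, h.leibniz, h'.leibniz, mul_add, Finset.sum_add_distrib, sub_mul, mul_sub,
      Finset.sum_mul, Finset.mul_sum]
    have e : ∀ b, c.pd (hV.trans hW) a (c'.coord (hV.trans hW') b) *
        ((X.par V ^ pe b) f * c'.pd (hV.trans hW') b g) =
        (X.par V ^ pe a) f * (c.pd (hV.trans hW) a (c'.coord (hV.trans hW') b) *
          c'.pd (hV.trans hW') b g) := by
      intro b
      rw [← mul_assoc, ← mul_assoc, hs.hom_mul_comm (h.hom_pd a (h'.hom_x b)), ← AlgHom.mul_apply,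
        ← pow_add, hs.pow_congr (k := pe a + pe b + pe b) (l := pe a)
          (by simp [add_assoc, Nat.even_add])]
    simp only [e, mul_assoc]
    abel
  have hDx : ∀ V hV b, D V hV (c'.coord (hV.trans hW') b) = 0 := by
    intro V hV b
    have h' := c'.isCoordSystem (hV.trans hW')
    rw [hDf _ hV]
    simp [h'.pd_x]
  suffices D W le_rfl f = 0 by
    rw [hDf _ le_rfl] at this
    exact sub_eq_zero.1 this
  -- Values at points suffice. Around each point a ball for `c'` centred there is chosen, on which
  -- `D` is a superderivation that kills the coordinates of `c'`.
  refine (c'.isoOn hW').injective (Eq.trans (Model.eq_zero_of_eval fun y => ?_)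
    (map_zero (c'.isoOn hW')).symm)
  obtain ⟨y, hy⟩ := y
  have hyW : c'.e.symm y ∈ W := hy.2
  obtain ⟨V, hxV, hVW, hVc, r, hr, hV⟩ := c'.exists_ball hyW (c'.e.map_target hy.1)
  rw [c'.e.right_inv hy.1] at hV
  have hyV : y ∈ X.image c'.e V := ⟨hy.1, hxV⟩
  have e1 := Model.eval_res (q := q) (X.image_mono c'.e hVW) ⟨y, hyV⟩ (c'.isoOn hW' (D W le_rfl f))
  rw [← c'.isoOn_res hW' hVW, hDres] at e1
  refine e1.symm.trans ?_
  have := Model.eval_superderivation (q := q) hV hr hyV (k := pe a)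
    (D := (c'.isoOn hVc).toLinearMap ∘ₗ D V hVW ∘ₗ (c'.isoOn hVc).symm.toLinearMap) ?_ ?_
    (c'.isoOn hVc (X.res hVW f))
  · simpa using this
  · intro f g
    simp only [LinearMap.comp_apply, AlgEquiv.toLinearMap_apply, map_mul, hDmul, map_add,
      AlgEquiv.apply_symm_apply]
    congr 2
    exact (pow_apply_of_comm (c'.isoOn hVc).toAlgHom (c'.isoOn_par hVc) _ _).trans
      (congrArg _ ((c'.isoOn hVc).apply_symm_apply f))
  · intro b
    have := hDx V hVW b
    change c'.isoOn hVc (D V hVW (c'.coord hVc b)) = 0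
    rw [this, map_zero]

end Chart

end SuperSpace

/-! ## Coordinate changes -/

namespace SuperSpace

variable {𝕜 : Type u} [RCLike 𝕜] {X : SuperSpace.{u} 𝕜} {p q : ℕ} (c c' c'' : X.Chart p q)
  {W : Opens X.carrier} (h : W ≤ c.dom) (h' : W ≤ c'.dom) (h'' : W ≤ c''.dom)

lemma jacobian_apply (a b : Fin p ⊕ Fin q) :
    X.jacobian c c' h h' a b = c.pd h a (c'.coord h' b) := rfl

lemma isEvenMatrix_jacobian : IsEvenMatrix (X.par W) (X.jacobian c c' h h') :=
  (c.isCoordSystem h).isEvenMatrix (c'.isCoordSystem h') (jacobian_apply c c' h h')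

lemma jacobian_self : X.jacobian c c h h = 1 := by
  ext a b
  rw [jacobian_apply, (c.isCoordSystem h).pd_x, Matrix.one_apply]

lemma jacobian_mul :
    X.jacobian c c' h h' * X.jacobian c' c'' h' h'' = X.jacobian c c'' h h'' := by
  ext a b
  rw [Matrix.mul_apply, jacobian_apply c c'', c.pd_eq_sum h c' h']
  rfl

lemma jacobian_mul_jacobian : X.jacobian c c' h h' * X.jacobian c' c h' h = 1 := by
  rw [jacobian_mul, jacobian_self]

lemma jacobian_map_res {V : Opens X.carrier} (hV : V ≤ W) :
    (X.jacobian c c' h h').map (X.res hV) = X.jacobian c c' (hV.trans h) (hV.trans h') := by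
  ext a b
  rw [Matrix.map_apply, jacobian_apply, c.res_pd, c'.res_coord, jacobian_apply]

end SuperSpace

namespace Supermanifold

variable {𝕜 : Type u} [RCLike 𝕜] {p q : ℕ} {M : Supermanifold.{u} 𝕜 p q}

open SuperSpace

lemma exprRes_eq {V W : Opens M.carrier} (h : V ≤ W) (s : M.Expr W) :
    M.exprRes h s = polyMap (M.res h) p q s := rfl

lemma exprRes_rfl {W : Opens M.carrier} (s : M.Expr W) : M.exprRes le_rfl s = s := by
  ext n
  exact M.res_rfl (s n)

section Transition

variable (c c' c'' : M.Chart) {W : Opens M.carrier} (h : W ≤ c.dom) (h' : W ≤ c'.dom)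
  (h'' : W ≤ c''.dom)

lemma transition_apply (s : M.Expr W) : M.transition c c' h h' s =
    berezinian (M.jacobian c' c h' h) •
      subst (M.par W).toLinearMap (M.jacobian c c' h h') s := rfl

lemma exprRes_transition {V : Opens M.carrier} (hV : V ≤ W) (s : M.Expr W) :
    M.exprRes hV (M.transition c c' h h' s) =
      M.transition c c' (hV.trans h) (hV.trans h') (M.exprRes hV s) := by
  rw [transition_apply, transition_apply, exprRes_eq, exprRes_eq, polyMap_smul,
    polyMap_subst _ (M.isSuperComm W) (M.isSuperComm V) (M.res_par hV), jacobian_map_res,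
    map_berezinian _ (M.isSuperComm W) (isEvenMatrix_jacobian c' c h' h)
      (isEvenMatrix_jacobian c c' h h') (jacobian_mul_jacobian c' c h' h)
      (jacobian_mul_jacobian c c' h h'), jacobian_map_res]

/-- The cocycle condition, from the multiplicativity of the Berezinian and of substitution. The
factors `Ber(∂x/∂x')` use the inverse Jacobians and so multiply in the opposite order. -/
lemma transition_transition (s : M.Expr W) :
    M.transition c' c'' h' h'' (M.transition c c' h h' s) = M.transition c c'' h h'' s := by
  rw [transition_apply, transition_apply, subst_smul, smul_smul,
    subst_subst (M.isSuperComm W) (isEvenMatrix_jacobian c' c'' h' h'')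
      (isEvenMatrix_jacobian c c' h h'), jacobian_mul,
    ← berezinian_mul (M.isSuperComm W) (isEvenMatrix_jacobian c'' c' h'' h')
      (isEvenMatrix_jacobian c' c'' h' h'') (jacobian_mul_jacobian c'' c' h'' h')
      (jacobian_mul_jacobian c' c'' h' h'') (isEvenMatrix_jacobian c' c h' h)
      (isEvenMatrix_jacobian c c' h h') (jacobian_mul_jacobian c' c h' h)
      (jacobian_mul_jacobian c c' h h'), jacobian_mul, transition_apply]

lemma transition_mem_homog {i : ℤ} {s : M.Expr W} (hs : s ∈ homog p q 𝕜 (M.Sec W) i) :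
    M.transition c c' h h' s ∈ homog p q 𝕜 (M.Sec W) i :=
  smul_mem_homog _ (subst_mem_homog (M.isSuperComm W) _ hs)

lemma coordDelta_transition (s : M.Expr W) :
    coordDelta (M.par W).toLinearMap (c'.pd h') (M.transition c c' h h' s) =
      M.transition c c' h h' (coordDelta (M.par W).toLinearMap (c.pd h) s) :=
  delta_transition (c.isCoordSystem h) (c'.isCoordSystem h') (jacobian_apply c c' h h')
    (fun a f => c.pd_eq_sum h c' h' a f)
    (berezinian_even (M.isSuperComm W) (isEvenMatrix_jacobian c' c h' h)
      (isEvenMatrix_jacobian c c' h h') (jacobian_mul_jacobian c' c h' h)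
      (jacobian_mul_jacobian c c' h h'))
    (piola (c.isCoordSystem h) (c'.isCoordSystem h') (jacobian_apply c c' h h')
      (jacobian_apply c' c h' h) (fun a f => c'.pd_eq_sum h' c h a f)
      (jacobian_mul_jacobian c c' h h') (jacobian_mul_jacobian c' c h' h))
    (isEvenMatrix_jacobian c c' h h') s

lemma exprRes_coordDelta {V : Opens M.carrier} (hV : V ≤ W) (s : M.Expr W) :
    M.exprRes hV (coordDelta (M.par W).toLinearMap (c.pd h) s) =
      coordDelta (M.par V).toLinearMap (c.pd (hV.trans h)) (M.exprRes hV s) :=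
  polyMap_coordDelta _ (c.isCoordSystem h) (c.isCoordSystem (hV.trans h)) (M.res_par hV)
    (c.res_pd h hV) s

lemma generator_eq : M.generator c h = Finsupp.single (Finset.univ, 0) (thetaTop (c.coord h)) := rfl

lemma exprRes_generator {V : Opens M.carrier} (hV : V ≤ W) :
    M.exprRes hV (M.generator c h) = M.generator c (hV.trans h) := by
  rw [generator_eq, exprRes_eq, polyMap_single, map_thetaTop, generator_eq]
  congr 2
  funext a
  exact c.res_coord h hV a

lemma transition_generator : M.transition c c' h h' (M.generator c h) = M.generator c' h' :=
  generator_transition (c.isCoordSystem h) (c'.isCoordSystem h') (jacobian_apply c c' h h')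
    (jacobian_apply c' c h' h) (jacobian_mul_jacobian c c' h h') (jacobian_mul_jacobian c' c h' h)

lemma generator_mem_homog : M.generator c h ∈ homog p q 𝕜 (M.Sec W) 0 :=
  single_mem_homog (by simp [Mon.deg]) _

/-- The coefficient does not depend on the `z_i`, and the monomial contains no `π∂_{θ_α}` to
contract. -/
lemma coordDelta_generator :
    coordDelta (M.par W).toLinearMap (c.pd h) (M.generator c h) = 0 := by
  have hc := c.isCoordSystem h
  have h0 : ∀ (i : Fin p) (l : List (Fin q)),
      c.pd h (.inl i) (l.map fun α => c.coord h (.inr α)).prod = 0 := by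
    intro i l
    induction l with
    | nil => exact hc.pd_one _
    | cons α l ih => rw [List.map_cons, List.prod_cons, hc.pd_inl_x_mul, ih, mul_zero]
  rw [hc.coordDelta_eq, generator_eq, parOp_single, neg_eq_zero]
  refine Finset.sum_eq_zero fun a _ => ?_
  rw [map_zsmul, map_zsmul, coeffMap_single, contr_single]
  rcases a with i | α
  · have := hc.par_pd (.inl i) (thetaTop (c.coord h))
    rw [pe_inl, pow_zero, one_smul, thetaTop, List.ofFn_eq_map, h0, map_zero] at this
    rw [thetaTop, List.ofFn_eq_map, ← this, map_zero, Finsupp.single_zero, smul_zero, smul_zero]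
  · simp [contrCoeff]

end Transition

/-! ## Differential of integral forms -/

lemma delta_apply {W : Opens M.carrier} (s : M.Family W) (c : M.Chart) :
    M.delta W s c = coordDelta (M.par _).toLinearMap (c.pd inf_le_right) (s c) := rfl

theorem delta_mem {i : ℤ} {W : Opens M.carrier} {s : M.Family W} (hs : s ∈ M.integralForms i W) :
    M.delta W s ∈ M.integralForms (i + 1) W := by
  refine ⟨fun c => (c.isCoordSystem inf_le_right).delta_mem_homog (hs.1 c),
    fun c c' V hV h h' => ?_⟩
  rw [delta_apply, delta_apply, exprRes_coordDelta, exprRes_coordDelta, hs.2 c c' V hV h h',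
    coordDelta_transition]

theorem delta_delta {W : Opens M.carrier} (s : M.Family W) : M.delta W (M.delta W s) = 0 :=
  funext fun c => (c.isCoordSystem inf_le_right).delta_delta (s c)

/-! ## Integral forms on a coordinate domain -/

section LocalForm

variable (c : M.Chart) {W : Opens M.carrier} (hW : W ≤ c.dom)

/-- The integral form on a coordinate domain with a given coordinate expression. -/
def localForm : M.Expr W →ₗ[𝕜] M.Family W where
  toFun s c' := M.transition c c' (inf_le_left.trans hW) inf_le_right (M.exprRes inf_le_left s)
  map_add' s t := funext fun c' => by
    simp only [map_add]
    rfl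
  map_smul' r s := funext fun c' => by
    simp only [map_smul]
    rfl

lemma localForm_apply (s : M.Expr W) (c' : M.Chart) : localForm c hW s c' =
    M.transition c c' (inf_le_left.trans hW) inf_le_right (M.exprRes inf_le_left s) := rfl

lemma localForm_mem {i : ℤ} {s : M.Expr W} (hs : s ∈ homog p q 𝕜 (M.Sec W) i) :
    localForm c hW s ∈ M.integralForms i W := by
  refine ⟨fun c' => transition_mem_homog _ _ _ _ (polyMap_mem_homog _ hs),
    fun c' c'' V hV h' h'' => ?_⟩
  rw [localForm_apply, localForm_apply, exprRes_transition, exprRes_transition, exprRes_exprRes,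
    exprRes_exprRes, transition_transition]

lemma delta_localForm (s : M.Expr W) : M.delta W (localForm c hW s) =
    localForm c hW (coordDelta (M.par W).toLinearMap (c.pd hW) s) := by
  funext c'
  rw [delta_apply, localForm_apply, localForm_apply, coordDelta_transition, exprRes_coordDelta]

/-- Over a coordinate domain one chart determines a form, so the local problem reduces to coordinate
expressions. -/
lemma eq_localForm {i : ℤ} {s : M.Family W} (hs : s ∈ M.integralForms i W) :
    s = localForm c hW (M.exprRes (le_inf le_rfl hW) (s c)) := by
  funext c'
  have := hs.2 c c' (W ⊓ c'.dom) inf_le_left (inf_le_left.trans hW) inf_le_right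
  rw [localForm_apply, exprRes_exprRes]
  exact (exprRes_rfl (s c')).symm.trans this

end LocalForm

/-! ## The Poincaré lemma -/

variable (M) in
/-- The closed integral form `φ(x) θ_1 … θ_q ⊗ π∂_{z_1} … π∂_{z_p}`. -/
def globalGenerator : M.cocycles 0 ⊤ :=
  ⟨fun c => M.generator c inf_le_right, ⟨fun c => generator_mem_homog c _,
    fun c c' V hV h h' => by rw [exprRes_generator, exprRes_generator, transition_generator]⟩,
    funext fun c => coordDelta_generator c _⟩

lemma famRes_globalGenerator {W : Opens M.carrier} (c : M.Chart) :
    M.famRes le_top (globalGenerator M).1 c = M.generator (W := W ⊓ c.dom) c inf_le_right :=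
  exprRes_generator c _ _

/-- On a coordinate ball primitives in each `z_i` exist, so the coordinate version applies;
`localForm` turns the primitive found there into an integral form. -/
theorem exists_local_primitive {i : ℤ} {W : Opens M.carrier} {s : M.Family W}
    (hs : s ∈ M.cocycles i W) {x : M.carrier} (hx : x ∈ W) :
    ∃ (V : Opens M.carrier) (hV : V ≤ W), x ∈ V ∧ ∃ t ∈ M.integralForms (i - 1) V, ∃ a : 𝕜,
      (i ≠ 0 → a = 0) ∧
      M.famRes hV s = M.delta V t + a • M.famRes le_top (globalGenerator M).1 := by
  obtain ⟨c, hxc⟩ := M.exists_chart x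
  obtain ⟨V, hxV, hV, hVc, r, hr, hball⟩ := c.exists_ball hx hxc
  refine ⟨V, hV, hxV, ?_⟩
  obtain ⟨prim, hp⟩ := c.exists_isPrimitive hVc hr hball
  obtain ⟨hf, hδ⟩ := M.famRes_mem_cocycles hV hs
  set s' := M.famRes hV s with hs'
  clear_value s'
  set u : M.Expr V := M.exprRes (le_inf le_rfl hVc) (s' c) with hu
  have hu1 : u ∈ homog p q 𝕜 (M.Sec V) i := polyMap_mem_homog _ (hf.1 c)
  have hu2 : coordDelta (M.par V).toLinearMap (c.pd hVc) u = 0 := by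
    have h0 : M.delta V s' = 0 := hδ
    have : M.delta V s' c = 0 := congrFun h0 c
    rw [hu, ← exprRes_coordDelta c inf_le_right, ← delta_apply, this, map_zero]
  obtain ⟨t, ht, a, ha, e⟩ := (c.isCoordSystem hVc).exists_eq_delta_add hp hu1 hu2
  refine ⟨localForm c hVc t, localForm_mem c hVc ht, a, ha, ?_⟩
  have hg : M.famRes le_top (globalGenerator M).1 = localForm c hVc (M.generator c hVc) := by
    rw [eq_localForm c hVc (M.famRes_mem le_top (globalGenerator M).2.1), famRes_globalGenerator,
      exprRes_generator]
  rw [delta_localForm, hg, eq_localForm c hVc hf, ← hu, e, map_add]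
  exact congrArg _ (map_smul (localForm c hVc) a (M.generator c hVc))

/-- Nonexactness needs no ball: the odd derivatives detect the generator in any chart meeting `W`.
-/
theorem eq_zero_of_delta_eq_smul {W : Opens M.carrier} (hW : (W : Set M.carrier).Nonempty)
    {t : M.Family W} {a : 𝕜}
    (h : M.delta W t = a • M.famRes le_top (globalGenerator M).1) : a = 0 := by
  obtain ⟨x, hx⟩ := hW
  obtain ⟨c, hxc⟩ := M.exists_chart x
  have hle : W ⊓ c.dom ≤ c.dom := inf_le_right
  have := c.nontrivial_sec hle ⟨x, hx, hxc⟩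
  refine (c.isCoordSystem hle).eq_zero_of_delta_eq (t := t c) ((congrFun h c).trans ?_)
  change a • M.famRes le_top (globalGenerator M).1 c = _
  rw [famRes_globalGenerator, generator_eq]

end Supermanifold

/-! ## Cohomology sheaves -/

namespace Supermanifold

variable {𝕜 : Type u} [RCLike 𝕜] {p q : ℕ} (M : Supermanifold.{u} 𝕜 p q)

variable {M} in
/-- The class of a closed form over an open set. -/
def classOf {i : ℤ} {W : Opens M.carrier} (s : M.cocycles i W) : M.Cohomology i W :=
  Submodule.Quotient.mk s

variable {M} in
lemma classOf_surjective {i : ℤ} {W : Opens M.carrier} (y : M.Cohomology i W) :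
    ∃ s, classOf s = y :=
  Submodule.Quotient.mk_surjective _ y

variable {M} in
lemma classOf_eq_iff {i : ℤ} {W : Opens M.carrier} (s t : M.cocycles i W) :
    classOf s = classOf t ↔ ∃ u ∈ M.integralForms (i - 1) W, M.delta W u = s.1 - t.1 :=
  Submodule.Quotient.eq _

lemma exists_res_classOf_eq {i : ℤ} {W : Opens M.carrier} (s : M.cocycles i W) {x : M.carrier}
    (hx : x ∈ W) : ∃ (V : Opens M.carrier) (hV : V ≤ W), x ∈ V ∧ ∃ a : 𝕜, (i ≠ 0 → a = 0) ∧
      ∃ t ∈ M.integralForms (i - 1) V,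
        M.delta V t = M.famRes hV s.1 - a • M.famRes le_top (globalGenerator M).1 := by
  obtain ⟨V, hV, hxV, t, ht, a, ha, e⟩ := exists_local_primitive s.2 hx
  exact ⟨V, hV, hxV, a, ha, t, ht, by rw [e, add_sub_cancel_right]⟩

/-- Outside degree `0` every cohomology class vanishes locally. -/
lemma exists_cohomologyRes_eq_zero {i : ℤ} (hi : i ≠ 0) {W : Opens M.carrier}
    (y : M.Cohomology i W) {x : M.carrier} (hx : x ∈ W) :
    ∃ (V : Opens M.carrier) (hV : V ≤ W), x ∈ V ∧ M.cohomologyRes i hV y = 0 := by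
  obtain ⟨s, rfl⟩ := classOf_surjective y
  obtain ⟨V, hV, hxV, a, ha, t, ht, e⟩ := M.exists_res_classOf_eq s hx
  refine ⟨V, hV, hxV, ?_⟩
  rw [ha hi, zero_smul] at e
  exact (classOf_eq_iff (M.cocycleRes i hV s) 0).2 ⟨t, ht, e⟩

/-- The class of the generator over an open set. -/
def generatorClass (W : Opens M.carrier) : M.Cohomology 0 W :=
  classOf (M.cocycleRes 0 le_top (globalGenerator M))

lemma smul_generatorClass (W : Opens M.carrier) (a : 𝕜) :
    a • M.generatorClass W = classOf (a • M.cocycleRes 0 le_top (globalGenerator M)) := rfl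

lemma famRes_famRes {U V W : Opens M.carrier} (h : V ≤ W) (k : U ≤ V) (s : M.Family W) :
    M.famRes k (M.famRes h s) = M.famRes (k.trans h) s :=
  funext fun c => exprRes_exprRes M _ _ (s c)

lemma cohomologyRes_generatorClass {V W : Opens M.carrier} (h : V ≤ W) :
    M.cohomologyRes 0 h (M.generatorClass W) = M.generatorClass V :=
  congrArg classOf (Subtype.ext (M.famRes_famRes le_top h (globalGenerator M).1))

/-- In degree `0` every cohomology class is locally a multiple of the generator. -/
lemma exists_cohomologyRes_eq_smul {W : Opens M.carrier} (y : M.Cohomology 0 W) {x : M.carrier}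
    (hx : x ∈ W) : ∃ (V : Opens M.carrier) (hV : V ≤ W), x ∈ V ∧
      ∃ a : 𝕜, M.cohomologyRes 0 hV y = a • M.generatorClass V := by
  obtain ⟨s, rfl⟩ := classOf_surjective y
  obtain ⟨V, hV, hxV, a, -, t, ht, e⟩ := M.exists_res_classOf_eq s hx
  exact ⟨V, hV, hxV, a, (classOf_eq_iff (M.cocycleRes 0 hV s)
    (a • M.cocycleRes 0 le_top (globalGenerator M))).2 ⟨t, ht, e⟩⟩

lemma smul_generatorClass_injective {W : Opens M.carrier} (hW : (W : Set M.carrier).Nonempty)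
    {a b : 𝕜} (h : a • M.generatorClass W = b • M.generatorClass W) : a = b := by
  rw [smul_generatorClass, smul_generatorClass, classOf_eq_iff] at h
  obtain ⟨t, -, e⟩ := h
  refine sub_eq_zero.1 (eq_zero_of_delta_eq_smul (M := M) hW (t := t) (e.trans ?_))
  exact (sub_smul a b (M.famRes le_top (globalGenerator M).1)).symm

/-- Since classes vanish locally, the zero endomorphism of the presheaf is locally bijective.
Sheafification makes it an isomorphism, and an object whose zero endomorphism is invertible is zero.
-/
theorem isZero_cohomologySheaf {i : ℤ} (hi : i ≠ 0) : Limits.IsZero (M.cohomologySheaf i) := by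
  let J := Opens.grothendieckTopology M.carrier
  let φ : M.cohomologyPresheaf i ⟶ M.cohomologyPresheaf i := 0
  have hinj : Presheaf.IsLocallyInjective J φ := ⟨fun {W} y z _ x hx => by
    obtain ⟨V, hV, hxV, e⟩ := M.exists_cohomologyRes_eq_zero hi (W := W.unop) (y - z) hx
    refine ⟨V, homOfLE hV, ?_, hxV⟩
    exact sub_eq_zero.1 ((map_sub (M.cohomologyRes i hV) y z).symm.trans e)⟩
  have hsurj : Presheaf.IsLocallySurjective J φ := ⟨fun {W} y x hx => by
    obtain ⟨V, hV, hxV, e⟩ := M.exists_cohomologyRes_eq_zero hi (W := W) y hx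
    exact ⟨V, homOfLE hV, ⟨(0 : M.Cohomology i V), e.symm⟩, hxV⟩⟩
  have hφ : IsIso ((presheafToSheaf J (ModuleCat.{u} 𝕜)).map φ) :=
    (J.W_iff φ).1 (J.W_of_isLocallyBijective φ)
  have := Functor.preservesZeroMorphisms_of_isLeftAdjoint (presheafToSheaf J (ModuleCat.{u} 𝕜))
  rw [Functor.map_zero] at hφ
  exact (Limits.IsZero.iff_id_eq_zero _).2 (Limits.isIsoZeroSelfEquiv _ hφ)

/-- The morphism from the constant presheaf given by the class of the generator. -/
def constToCohomology :
    (Functor.const (Opens M.carrier)ᵒᵖ).obj (ModuleCat.of 𝕜 𝕜) ⟶ M.cohomologyPresheaf 0 where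
  app W := ModuleCat.ofHom (LinearMap.toSpanSingleton 𝕜 _ (M.generatorClass W.unop))
  naturality W V f := by
    ext
    change (1 : 𝕜) • M.generatorClass V.unop =
      M.cohomologyRes 0 f.unop.le ((1 : 𝕜) • M.generatorClass W.unop)
    rw [map_smul, cohomologyRes_generatorClass]

/-- Local surjectivity is the Poincaré lemma and local injectivity the nonexactness of the
generator; sheafification inverts locally bijective morphisms. -/
lemma isIso_constToCohomology : IsIso ((presheafToSheaf (Opens.grothendieckTopology M.carrier)
    (ModuleCat.{u} 𝕜)).map M.constToCohomology) := by
  let J := Opens.grothendieckTopology M.carrier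
  -- No shrinking is needed: the point `x` makes `W` nonempty, where the map is already injective.
  have hinj : Presheaf.IsLocallyInjective J M.constToCohomology := ⟨fun {W} a b h x hx =>
    ⟨W.unop, 𝟙 _, M.smul_generatorClass_injective (W := W.unop) ⟨x, hx⟩ h, hx⟩⟩
  have hsurj : Presheaf.IsLocallySurjective J M.constToCohomology := ⟨fun {W} y x hx => by
    obtain ⟨V, hV, hxV, a, e⟩ := M.exists_cohomologyRes_eq_smul (W := W) y hx
    exact ⟨V, homOfLE hV, ⟨a, e.symm⟩, hxV⟩⟩
  exact (J.W_iff _).1 (J.W_of_isLocallyBijective M.constToCohomology)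

/-- The isomorphism of the constant sheaf with the cohomology sheaf in degree `0`. -/
def constIsoCohomology : M.constSheaf ≅ M.cohomologySheaf 0 :=
  @asIso _ _ _ _ ((presheafToSheaf (Opens.grothendieckTopology M.carrier)
    (ModuleCat.{u} 𝕜)).map M.constToCohomology) M.isIso_constToCohomology

lemma constIsoCohomology_constSection (W : Opens M.carrier) (a : 𝕜) :
    (M.constIsoCohomology.hom.hom.app (op W)).hom (M.constSection W a) =
      M.cohomologyClass (a • M.cocycleRes 0 le_top (globalGenerator M)) := by
  have e := toSheafify_naturality (Opens.grothendieckTopology M.carrier) M.constToCohomology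
  have e' := congrArg (fun g => (g.app (op W)).hom a) e
  exact e'.symm

end Supermanifold

end

end SuperGeometry

/-! ### The Poincaré lemma for integral forms -/

theorem mainTheorem2 {𝕜 : Type u} [RCLike 𝕜] {p q : ℕ}
    (M : SuperGeometry.Supermanifold.{u} 𝕜 p q) :
    -- the coordinate formula for `δ` defines differentials `Σ^i → Σ^{i+1}` with `δ² = 0`
    (∀ (i : ℤ) (W : Opens M.carrier), ∀ s ∈ M.integralForms i W,
      M.delta W s ∈ M.integralForms (i + 1) W ∧ M.delta W (M.delta W s) = 0) ∧
    -- the cohomology sheaves vanish outside degree `0`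
    (∀ i : ℤ, i ≠ 0 → Limits.IsZero (M.cohomologySheaf i)) ∧
    -- in degree `0` the cohomology sheaf is the constant sheaf, generated by the class of `s₀`
    ∃ s₀ : M.cocycles 0 ⊤,
      (∀ c : M.Chart, s₀.1 c = M.generator c inf_le_right) ∧
      ∃ κ : M.constSheaf ≅ M.cohomologySheaf 0,
        ∀ (W : Opens M.carrier) (a : 𝕜),
          (κ.hom.hom.app (op W)).hom (M.constSection W a) =
            M.cohomologyClass (a • M.cocycleRes 0 le_top s₀) :=
  ⟨fun _ _ s hs => ⟨SuperGeometry.Supermanifold.delta_mem hs,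
      SuperGeometry.Supermanifold.delta_delta s⟩,
    fun _ hi => M.isZero_cohomologySheaf hi,
    SuperGeometry.Supermanifold.globalGenerator M, fun _ => rfl,
    M.constIsoCohomology, M.constIsoCohomology_constSection⟩
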